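/- All manifolds and maps are smooth. Let $Y$ be an oriented $3$-manifold embedded in an oriented $5$-manifold $W$, let $\gamma\subset Y$ be an oriented embedded circle, and let $\Delta\subset W$ be an embedded closed disk with $\partial\Delta=\gamma=\Delta\cap Y$ and $T_p\Delta\cap T_pY=T_p\gamma$ for every $p\in\gamma$. Write $N_Y(\gamma)=TY|_\gamma/T\gamma$ and $N_W(\Delta)=TW|_\Delta/T\Delta$ for the normal bundles, so that $N_Y(\gamma)$ is a subbundle of $N_W(\Delta)|_\gamma$; the bundle $N_Y(\gamma)$ is oriented by the orientations of $\gamma$ and $Y$. A framing of $N_Y(\gamma)$ is a smooth orientation-preserving trivialization, i.e. a pair $(v_1,v_2)$ of smooth sections of $N_Y(\gamma)$ forming a positive basis of every fibre; framings are considered up to homotopy through framings. An integer $k$ acts on framings by rotating $k$ times along $\gamma$: with $\gamma$ parametrized, compatibly with its orientation, by an angle $\theta\in\mathbb{R}/2\pi\mathbb{Z}$, $$k\cdot(v_1,v_2)=(\cos(k\theta)\,v_1+\sin(k\theta)\,v_2,\;-\sin(k\theta)\,v_1+\cos(k\theta)\,v_2).$$ A framing $\phi$ of $N_Y(\gamma)$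 is called $\Delta$-admissible if there is a smooth $2$-dimensional subbundle $B\subset N_W(\Delta)$ with a smooth framing (a pair of smooth sections forming a basis of every fibre of $B$) whose restriction to $\gamma$ is $\phi$. Then the action of $\mathbb{Z}$ on the set of homotopy classes of framings of $N_Y(\gamma)$ is free and transitive. Moreover, for every framing $\phi$ of $N_Y(\gamma)$, one of the following holds: the $\Delta$-admissible framings are exactly the framings homotopic to $k\cdot\phi$ for some even integer $k$, or they are exactly the framings homotopic to $k\cdot\phi$ for some odd integer $k$. -/

import Mathlib

open Manifold Topology
open scoped ContDiff

namespace AmbientSurgery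

noncomputable section

/-- An orientation of a manifold `M` with tangent spaces of dimension `n`: an orientation of each
tangent space, such that near every point there is a continuous local frame which is
positive at each point. -/
structure ManifoldOrientation {n : ℕ} {H : Type*} [TopologicalSpace H]
    (I : ModelWithCorners ℝ (EuclideanSpace ℝ (Fin n)) H)
    (M : Type*) [TopologicalSpace M] [ChartedSpace H M] [IsManifold I 1 M] where
  orientationAt : ∀ x : M, Orientation ℝ (TangentSpace I x) (Fin n)
  exists_oriented_frame : ∀ x₀ : M, ∃ U ∈ 𝓝 x₀, ∃ X : Fin n → ∀ x : M, TangentSpace I x,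
    (∀ i, ContinuousOn (fun x => (⟨x, X i x⟩ : TangentBundle I M)) U) ∧
    ∀ x ∈ U, ∃ b : Module.Basis (Fin n) ℝ (TangentSpace I x),
      (∀ i, b i = X i x) ∧ b.orientation = orientationAt x

section Curve

variable {H : Type*} [TopologicalSpace H]
  {J : ModelWithCorners ℝ (EuclideanSpace ℝ (Fin 3)) H}
  {Y : Type*} [TopologicalSpace Y] [ChartedSpace H Y]

variable (J) in
/-- The velocity at `z` of a closed curve, i.e. the derivative of `t ↦ γ (z * exp (i t))` at `0`.
It spans the tangent line of `γ` and points in the direction of its orientation. -/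
def velocity (γ : Circle → Y) (z : Circle) : TangentSpace J (γ z) :=
  mfderiv 𝓘(ℝ, ℝ) J (fun t : ℝ => γ (z * Circle.exp t)) 0 (1 : ℝ)

variable (J) in
/-- The tangent line of the curve `γ` at `γ z`. -/
abbrev tangentLine (γ : Circle → Y) (z : Circle) : Submodule ℝ (TangentSpace J (γ z)) :=
  Submodule.span ℝ {velocity J γ z}

variable (J) in
/-- The fibre at `γ z` of the normal bundle `N_Y(γ) = TY|_γ / Tγ`. -/
abbrev CurveNormal (γ : Circle → Y) (z : Circle) : Type _ :=
  TangentSpace J (γ z) ⧸ tangentLine J γ z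

variable [IsManifold J 1 Y]

/-- A section of `N_Y(γ)` is smooth if it is the class of a smooth vector field along `γ`. -/
def IsSmoothCurveNormalSection (γ : Circle → Y) (s : ∀ z, CurveNormal J γ z) : Prop :=
  ∃ v : ∀ z, TangentSpace J (γ z),
    ContMDiff (𝓡 1) J.tangent ∞ (fun z => (⟨γ z, v z⟩ : TangentBundle J Y)) ∧
    ∀ z, (tangentLine J γ z).mkQ (v z) = s z

/-- A pair of normal vectors is a positive basis of the fibre of `N_Y(γ)` at `γ z`, for the
orientation induced by those of `γ` and `Y`: the velocity of `γ` followed by representatives of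
the two normal vectors is a positive basis of the tangent space of `Y`. -/
def IsPositiveNormalBasis (o : ManifoldOrientation J Y) (γ : Circle → Y) (z : Circle)
    (n : Fin 2 → CurveNormal J γ z) : Prop :=
  ∃ v : Fin 2 → TangentSpace J (γ z), (∀ i, (tangentLine J γ z).mkQ (v i) = n i) ∧
    ∃ b : Module.Basis (Fin 3) ℝ (TangentSpace J (γ z)),
      ⇑b = ![velocity J γ z, v 0, v 1] ∧ b.orientation = o.orientationAt (γ z)

/-- A framing of `N_Y(γ)`: a smooth, orientation-preserving trivialization, given by the pair of
sections that corresponds to the standard basis of `ℝ²`. -/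
@[ext]
structure Framing (o : ManifoldOrientation J Y) (γ : Circle → Y) where
  vec : Fin 2 → ∀ z, CurveNormal J γ z
  smooth : ∀ i, IsSmoothCurveNormalSection γ (vec i)
  positive : ∀ z, IsPositiveNormalBasis o γ z (fun i => vec i z)

/-- Homotopy through framings: a family of framings, indexed by `[0, 1]`, whose two
sections are the classes of vector fields along `γ` that depend jointly continuously on the
parameter and the point. -/
def Homotopic {o : ManifoldOrientation J Y} {γ : Circle → Y} (φ ψ : Framing o γ) : Prop :=
  ∃ Φ : unitInterval → Framing o γ, Φ 0 = φ ∧ Φ 1 = ψ ∧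
    ∀ i, ∃ v : unitInterval → ∀ z, TangentSpace J (γ z),
      Continuous (fun p : unitInterval × Circle =>
        (⟨γ p.2, v p.1 p.2⟩ : TangentBundle J Y)) ∧
      ∀ t z, (tangentLine J γ z).mkQ (v t z) = (Φ t).vec i z

/-- A linear combination of continuous vector fields along a map is continuous. -/
lemma continuous_comb {X : Type*} [TopologicalSpace X] {g : X → Y}
    {v w : ∀ x, TangentSpace J (g x)} {a b : X → ℝ} (ha : Continuous a) (hb : Continuous b)
    (hv : Continuous (fun x => (⟨g x, v x⟩ : TangentBundle J Y)))
    (hw : Continuous (fun x => (⟨g x, w x⟩ : TangentBundle J Y))) :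
    Continuous (fun x => (⟨g x, a x • v x + b x • w x⟩ : TangentBundle J Y)) := by
  rw [continuous_iff_continuousAt]
  intro x
  have h1 := (FiberBundle.continuousAt_totalSpace _ _).1 (hv.continuousAt (x := x))
  have h2 := (FiberBundle.continuousAt_totalSpace _ _).1 (hw.continuousAt (x := x))
  rw [FiberBundle.continuousAt_totalSpace]
  refine ⟨h1.1, ?_⟩
  refine ((ha.continuousAt.smul h1.2).add (hb.continuousAt.smul h2.2)).congr ?_
  have hmem : ∀ᶠ y in 𝓝 x, g y ∈ (trivializationAt (EuclideanSpace ℝ (Fin 3))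
      (TangentSpace J : Y → Type _) (g x)).baseSet :=
    h1.1.tendsto.eventually ((Bundle.Trivialization.open_baseSet _).mem_nhds
      (FiberBundle.mem_baseSet_trivializationAt' (F := EuclideanSpace ℝ (Fin 3))
        (E := (TangentSpace J : Y → Type _)) (g x)))
  filter_upwards [hmem] with y hy
  have hl := (trivializationAt (EuclideanSpace ℝ (Fin 3))
      (TangentSpace J : Y → Type _) (g x)).linear ℝ hy
  simp only [hl.map_add, hl.map_smul, Pi.add_apply, Pi.smul_apply']

/-- A linear combination of smooth vector fields along a curve is smooth. -/
lemma contMDiff_comb {g : Circle → Y}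
    {v w : ∀ x, TangentSpace J (g x)} {a b : Circle → ℝ}
    (ha : ContMDiff (𝓡 1) 𝓘(ℝ, ℝ) ∞ a) (hb : ContMDiff (𝓡 1) 𝓘(ℝ, ℝ) ∞ b)
    (hv : ContMDiff (𝓡 1) J.tangent ∞ (fun x => (⟨g x, v x⟩ : TangentBundle J Y)))
    (hw : ContMDiff (𝓡 1) J.tangent ∞ (fun x => (⟨g x, w x⟩ : TangentBundle J Y))) :
    ContMDiff (𝓡 1) J.tangent ∞
      (fun x => (⟨g x, a x • v x + b x • w x⟩ : TangentBundle J Y)) := by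
  intro x
  have h1 := Bundle.contMDiffAt_totalSpace.1 (hv x)
  have h2 := Bundle.contMDiffAt_totalSpace.1 (hw x)
  refine Bundle.contMDiffAt_totalSpace.2 ⟨h1.1, ?_⟩
  refine (((ha x).smul h1.2).add ((hb x).smul h2.2)).congr_of_eventuallyEq ?_
  have hmem : ∀ᶠ y in 𝓝 x, g y ∈ (trivializationAt (EuclideanSpace ℝ (Fin 3))
      (TangentSpace J : Y → Type _) (g x)).baseSet :=
    h1.1.continuousAt.tendsto.eventually ((Bundle.Trivialization.open_baseSet _).mem_nhds
      (FiberBundle.mem_baseSet_trivializationAt' (F := EuclideanSpace ℝ (Fin 3))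
        (E := (TangentSpace J : Y → Type _)) (g x)))
  filter_upwards [hmem] with y hy
  have hl := (trivializationAt (EuclideanSpace ℝ (Fin 3))
      (TangentSpace J : Y → Type _) (g x)).linear ℝ hy
  simp only [hl.map_add, hl.map_smul, Pi.add_apply, Pi.smul_apply']

variable {o : ManifoldOrientation J Y} {γ : Circle → Y}

lemma Homotopic.refl (φ : Framing o γ) : Homotopic φ φ := by
  refine ⟨fun _ => φ, rfl, rfl, fun i => ?_⟩
  obtain ⟨v, hv, h⟩ := φ.smooth i
  exact ⟨fun _ => v, hv.continuous.comp continuous_snd, fun _ => h⟩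

lemma Homotopic.symm {φ ψ : Framing o γ} (h : Homotopic φ ψ) : Homotopic ψ φ := by
  obtain ⟨Φ, h0, h1, h⟩ := h
  refine ⟨fun t => Φ (unitInterval.symm t), by simpa using h1, by simpa using h0, fun i => ?_⟩
  obtain ⟨v, hv, hvq⟩ := h i
  refine ⟨fun t => v (unitInterval.symm t), ?_, fun t => hvq _⟩
  exact hv.comp (f := fun p : unitInterval × Circle => (unitInterval.symm p.1, p.2))
    (by fun_prop)

lemma Homotopic.trans {φ ψ χ : Framing o γ} (h : Homotopic φ ψ) (h' : Homotopic ψ χ) :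
    Homotopic φ χ := by
  obtain ⟨Φ, h0, h1, h⟩ := h
  obtain ⟨Ψ, h0', h1', h'⟩ := h'
  let l : unitInterval → unitInterval := fun t => Set.projIcc 0 1 zero_le_one (2 * (t : ℝ))
  let r : unitInterval → unitInterval := fun t => Set.projIcc 0 1 zero_le_one (2 * (t : ℝ) - 1)
  have hl : Continuous l := continuous_projIcc.comp (by fun_prop)
  have hr : Continuous r := continuous_projIcc.comp (by fun_prop)
  have hl1 : ∀ t : unitInterval, (t : ℝ) = 1 / 2 → l t = 1 := fun t ht => by
    simp only [l, ht]; exact Set.projIcc_of_right_le _ (by norm_num)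
  have hr0 : ∀ t : unitInterval, (t : ℝ) = 1 / 2 → r t = 0 := fun t ht => by
    simp only [r, ht]; exact Set.projIcc_of_le_left _ (by norm_num)
  refine ⟨fun t => if (t : ℝ) ≤ 1 / 2 then Φ (l t) else Ψ (r t), ?_, ?_, fun i => ?_⟩
  · have : l 0 = 0 := Set.projIcc_of_le_left _ (by norm_num)
    simp [this, h0]
  · have : r 1 = 1 := Set.projIcc_of_right_le _ (by norm_num)
    have h2 : ¬ (((1 : unitInterval) : ℝ) ≤ 1 / 2) := by norm_num
    simp only [this, h1', h2, if_false]
  obtain ⟨v, hv, hvq⟩ := h i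
  obtain ⟨w, hw, hwq⟩ := h' i
  have hd : Continuous (fun p : unitInterval × Circle => (⟨γ p.2,
      (1 : ℝ) • w p.1 p.2 + (1 : ℝ) • ((1 : ℝ) • v 1 p.2 + (-1 : ℝ) • w 0 p.2)⟩ :
      TangentBundle J Y)) := by
    refine continuous_comb continuous_const continuous_const hw
      (continuous_comb continuous_const continuous_const ?_ ?_)
    · exact hv.comp (f := fun p : unitInterval × Circle => ((1 : unitInterval), p.2))
        (by fun_prop)
    · exact hw.comp (f := fun p : unitInterval × Circle => ((0 : unitInterval), p.2))
        (by fun_prop)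
  refine ⟨fun t z => if (t : ℝ) ≤ 1 / 2 then v (l t) z else
    (1 : ℝ) • w (r t) z + (1 : ℝ) • ((1 : ℝ) • v 1 z + (-1 : ℝ) • w 0 z), ?_, ?_⟩
  · have hc := Continuous.if_le
      (f := fun p : unitInterval × Circle => (p.1 : ℝ)) (g := fun _ => 1 / 2)
      (hv.comp (f := fun p : unitInterval × Circle => (l p.1, p.2)) (by fun_prop))
      (hd.comp (f := fun p : unitInterval × Circle => (r p.1, p.2)) (by fun_prop))
      (by fun_prop) continuous_const (fun p hp => by simp [hl1 p.1 hp, hr0 p.1 hp])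
    refine hc.congr fun p => ?_
    by_cases hp : (p.1 : ℝ) ≤ 1 / 2
    · simp only [hp, if_true]; rfl
    · simp only [hp, if_false]; rfl
  · intro t z
    by_cases ht : (t : ℝ) ≤ 1 / 2
    · simp only [ht, if_true]; exact hvq _ _
    · simp only [ht, if_false, map_add, map_smul, hwq, hvq, h1, h0']
      module

/-- The relation of homotopy through framings. -/
instance framingSetoid (o : ManifoldOrientation J Y) (γ : Circle → Y) : Setoid (Framing o γ) :=
  ⟨Homotopic, Homotopic.refl, Homotopic.symm, Homotopic.trans⟩

/-- The set of framings of `N_Y(γ)` up to homotopy. -/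
def FramingClass (o : ManifoldOrientation J Y) (γ : Circle → Y) : Type _ :=
  Quotient (framingSetoid o γ)

/-- The homotopy class of a framing. -/
def Framing.toClass (φ : Framing o γ) : FramingClass o γ := Quotient.mk _ φ

/-- The matrix of the rotation of the plane by the angle of `u`. -/
def rot (u : Circle) : Matrix (Fin 2) (Fin 2) ℝ :=
  !![(u : ℂ).re, (u : ℂ).im; -(u : ℂ).im, (u : ℂ).re]

lemma contMDiff_rot (k : ℤ) (i j : Fin 2) :
    ContMDiff (𝓡 1) 𝓘(ℝ, ℝ) ∞ (fun z : Circle => rot (z ^ k) i j) := by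
  have : Fact (Module.finrank ℝ ℂ = 1 + 1) := finrank_real_complex_fact'
  have hz : ContMDiff (𝓡 1) (𝓡 1) ∞ (fun z : Circle => z ^ k) := by
    have : LieGroup (𝓡 1) ∞ Circle := LieGroup.of_le (n := ω) le_top
    obtain ⟨m, rfl | rfl⟩ := k.eq_nat_or_neg
    · simpa using contMDiff_pow (I := 𝓡 1) (G := Circle) (n := ∞) m
    · simpa using (contMDiff_pow (I := 𝓡 1) (G := Circle) (n := ∞) m).inv
  have hc : ContMDiff (𝓡 1) 𝓘(ℝ, ℂ) ∞ (fun z : Circle => ((z ^ k : Circle) : ℂ)) :=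
    (contMDiff_coe_sphere (E := ℂ) (n := 1)).comp hz
  have hre : ContMDiff (𝓡 1) 𝓘(ℝ, ℝ) ∞ (fun z : Circle => ((z ^ k : Circle) : ℂ).re) :=
    Complex.reCLM.contMDiff.comp hc
  have him : ContMDiff (𝓡 1) 𝓘(ℝ, ℝ) ∞ (fun z : Circle => ((z ^ k : Circle) : ℂ).im) :=
    Complex.imCLM.contMDiff.comp hc
  fin_cases i <;> fin_cases j
  · exact hre
  · exact him
  · exact him.neg
  · exact hre

/-- The action of `k : ℤ` on framings: the framing is rotated `k` times in the positive direction
as one goes once around `γ`. -/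
def Framing.rotate (k : ℤ) (φ : Framing o γ) : Framing o γ where
  vec i z := rot (z ^ k) i 0 • φ.vec 0 z + rot (z ^ k) i 1 • φ.vec 1 z
  smooth i := by
    obtain ⟨v, hv, hvq⟩ := φ.smooth 0
    obtain ⟨w, hw, hwq⟩ := φ.smooth 1
    exact ⟨_, contMDiff_comb (contMDiff_rot k i 0) (contMDiff_rot k i 1) hv hw,
      fun z => by rw [map_add, map_smul, map_smul, hvq, hwq]⟩
  positive z := by
    obtain ⟨v, hv, b, hb, hbo⟩ := φ.positive z
    have hu : (rot (z ^ k) 0 0) * (rot (z ^ k) 0 0) + rot (z ^ k) 0 1 * rot (z ^ k) 0 1 = 1 := by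
      have := Circle.normSq_coe (z ^ k)
      rw [Complex.normSq_apply] at this
      simpa [rot] using this
    have e1 : rot (z ^ k) 1 0 = - rot (z ^ k) 0 1 := by simp [rot]
    have e2 : rot (z ^ k) 1 1 = rot (z ^ k) 0 0 := by simp [rot]
    have hdet : b.det ![velocity J γ z,
        rot (z ^ k) 0 0 • v 0 + rot (z ^ k) 0 1 • v 1,
        rot (z ^ k) 1 0 • v 0 + rot (z ^ k) 1 1 • v 1] = 1 := by
      have b0 : velocity J γ z = b 0 := by rw [hb]; rfl
      have b1 : v 0 = b 1 := by rw [hb]; rfl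
      have b2 : v 1 = b 2 := by rw [hb]; rfl
      rw [Module.Basis.det_apply, Matrix.det_fin_three, b0, b1, b2, e1, e2]
      simp [Module.Basis.toMatrix_apply]
      linarith
    refine ⟨fun i => rot (z ^ k) i 0 • v 0 + rot (z ^ k) i 1 • v 1,
      fun i => by rw [map_add, map_smul, map_smul, hv, hv], ?_⟩
    have hbas := (Module.Basis.is_basis_iff_det b).2 (hdet ▸ isUnit_one)
    refine ⟨Module.Basis.mk hbas.1 hbas.2.ge, by simp, ?_⟩
    rw [← hbo, eq_comm, Module.Basis.orientation_eq_iff_det_pos, Module.Basis.coe_mk, hdet]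
    exact one_pos

instance : AddAction ℤ (Framing o γ) where
  vadd k φ := φ.rotate k
  zero_vadd φ := by
    ext i z
    change rot (z ^ (0 : ℤ)) i 0 • φ.vec 0 z + rot (z ^ (0 : ℤ)) i 1 • φ.vec 1 z = φ.vec i z
    fin_cases i <;> simp [rot]
  add_vadd j k φ := by
    ext i z
    change rot (z ^ (j + k)) i 0 • φ.vec 0 z + rot (z ^ (j + k)) i 1 • φ.vec 1 z =
      rot (z ^ j) i 0 • (rot (z ^ k) 0 0 • φ.vec 0 z + rot (z ^ k) 0 1 • φ.vec 1 z) +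
      rot (z ^ j) i 1 • (rot (z ^ k) 1 0 • φ.vec 0 z + rot (z ^ k) 1 1 • φ.vec 1 z)
    rw [zpow_add]
    fin_cases i <;> simp [rot] <;> module

lemma Homotopic.vadd {φ ψ : Framing o γ} (k : ℤ) (h : Homotopic φ ψ) :
    Homotopic (k +ᵥ φ) (k +ᵥ ψ) := by
  obtain ⟨Φ, h0, h1, h⟩ := h
  refine ⟨fun t => k +ᵥ Φ t, congrArg (k +ᵥ ·) h0, congrArg (k +ᵥ ·) h1, fun i => ?_⟩
  obtain ⟨v, hv, hvq⟩ := h 0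
  obtain ⟨w, hw, hwq⟩ := h 1
  refine ⟨fun t z => rot (z ^ k) i 0 • v t z + rot (z ^ k) i 1 • w t z,
    continuous_comb ((contMDiff_rot k i 0).continuous.comp continuous_snd)
      ((contMDiff_rot k i 1).continuous.comp continuous_snd) hv hw, fun t z => ?_⟩
  rw [map_add, map_smul, map_smul, hvq, hwq]
  rfl

/-- The induced action of `ℤ` on homotopy classes of framings. -/
instance : AddAction ℤ (FramingClass o γ) where
  vadd k := Quotient.map (k +ᵥ ·) fun _ _ h => h.vadd k
  zero_vadd c := by
    induction c using Quotient.inductionOn with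
    | h φ => exact congrArg Framing.toClass (zero_vadd ℤ φ)
  add_vadd j k c := by
    induction c using Quotient.inductionOn with
    | h φ => exact congrArg Framing.toClass (add_vadd j k φ)

end Curve

section Disk

variable {H : Type*} [TopologicalSpace H]
  {J : ModelWithCorners ℝ (EuclideanSpace ℝ (Fin 3)) H}
  {Y : Type*} [TopologicalSpace Y] [ChartedSpace H Y]
  {G : Type*} [TopologicalSpace G]
  {I : ModelWithCorners ℝ (EuclideanSpace ℝ (Fin 5)) G}
  {W : Type*} [TopologicalSpace W] [ChartedSpace G W]

/-- The closed unit disk in the plane. -/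
abbrev disk : Set ℂ := Metric.closedBall 0 1

variable (I) in
/-- The tangent plane at `Δ z` of a disk `Δ`; only the values of `Δ` on the closed
unit disk matter. -/
abbrev tangentPlane (Δ : ℂ → W) (z : ℂ) : Submodule ℝ (TangentSpace I (Δ z)) :=
  (mfderivWithin 𝓘(ℝ, ℂ) I Δ disk z).range

variable (I) in
/-- The fibre at `Δ z` of the normal bundle `N_W(Δ) = TW|_Δ / TΔ`. -/
abbrev DiskNormal (Δ : ℂ → W) (z : ℂ) : Type _ :=
  TangentSpace I (Δ z) ⧸ tangentPlane I Δ z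

/-- `Δ` is a smoothly embedded disk in `W` with boundary the curve `γ` in `Y`, which
meets `Y` (embedded by `ι`) exactly in `γ` and is not tangent to `Y` there: along `γ`
the tangent spaces of `Y` and `Δ` meet only in the tangent line of `γ`, so that `N_Y(γ)` is a
subbundle of the restriction of `N_W(Δ)` to `γ`. (Tangent spaces at the equal points
`ι (γ z)` and `Δ z` are identified.) -/
structure IsSpanningDisk (J : ModelWithCorners ℝ (EuclideanSpace ℝ (Fin 3)) H)
    (I : ModelWithCorners ℝ (EuclideanSpace ℝ (Fin 5)) G)
    (ι : Y → W) (γ : Circle → Y) (Δ : ℂ → W) : Prop where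
  smooth : ContMDiffOn 𝓘(ℝ, ℂ) I ∞ Δ disk
  injOn : Set.InjOn Δ disk
  immersion : ∀ z ∈ disk, Function.Injective (mfderivWithin 𝓘(ℝ, ℂ) I Δ disk z)
  boundary : ∀ z : Circle, Δ z = ι (γ z)
  inter : Δ '' disk ∩ Set.range ι = Set.range (ι ∘ γ)
  clean : ∀ z : Circle,
    ((mfderiv J I ι (γ z)).range : Submodule ℝ (TangentSpace I (Δ z))) ⊓ tangentPlane I Δ z
      = (tangentLine J γ z).map (mfderiv J I ι (γ z)).toLinearMap

variable [IsManifold I 1 W]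

/-- A section of `N_W(Δ)` is smooth on a set `U` if it is there the class of a smooth vector field
along `Δ`. -/
def IsSmoothDiskNormalSectionOn (Δ : ℂ → W) (s : ∀ z, DiskNormal I Δ z) (U : Set ℂ) : Prop :=
  ∃ v : ∀ z, TangentSpace I (Δ z),
    ContMDiffOn 𝓘(ℝ, ℂ) I.tangent ∞ (fun z => (⟨Δ z, v z⟩ : TangentBundle I W)) U ∧
    ∀ z ∈ U, (tangentPlane I Δ z).mkQ (v z) = s z

/-- `s` is a smooth frame over `U` of the family of subspaces `B` of the fibres of `N_W(Δ)`. -/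
def IsSmoothFrameOn (Δ : ℂ → W) (B : ∀ z, Submodule ℝ (DiskNormal I Δ z)) {k : ℕ}
    (s : Fin k → ∀ z, DiskNormal I Δ z) (U : Set ℂ) : Prop :=
  (∀ i, IsSmoothDiskNormalSectionOn Δ (s i) U) ∧
    ∀ z ∈ U, LinearIndependent ℝ (fun i => s i z) ∧
      Submodule.span ℝ (Set.range fun i => s i z) = B z

/-- The family `B` of subspaces of the fibres of `N_W(Δ)` is a smooth subbundle of rank `k`. -/
def IsSubbundle (Δ : ℂ → W) (k : ℕ) (B : ∀ z, Submodule ℝ (DiskNormal I Δ z)) : Prop :=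
  ∀ z₀ ∈ disk, ∃ U ∈ 𝓝 z₀, ∃ s : Fin k → ∀ z, DiskNormal I Δ z, IsSmoothFrameOn Δ B s (U ∩ disk)

variable [IsManifold J 1 Y]

/-- A framing `φ` of `N_Y(γ)` is `Δ`-admissible if there is a smooth subbundle `B` of rank two of
`N_W(Δ)` with a framing `Φ` that extends `φ`: at the boundary, the differential of `ι` maps
representatives of `φ` to representatives of `Φ`. -/
def Admissible (I : ModelWithCorners ℝ (EuclideanSpace ℝ (Fin 5)) G) [IsManifold I 1 W]
    {o : ManifoldOrientation J Y} {γ : Circle → Y} (ι : Y → W) (Δ : ℂ → W)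
    (φ : Framing o γ) : Prop :=
  ∃ B : ∀ z, Submodule ℝ (DiskNormal I Δ z), IsSubbundle Δ 2 B ∧
    ∃ Φ : Fin 2 → ∀ z, DiskNormal I Δ z, IsSmoothFrameOn Δ B Φ disk ∧
      ∀ (z : Circle) (i : Fin 2) (v : TangentSpace J (γ z)),
        (tangentLine J γ z).mkQ v = φ.vec i z →
          (tangentPlane I Δ z).mkQ (mfderiv J I ι (γ z) v) = Φ i z

end Disk

end

end AmbientSurgery

/-! Relative to a fixed framing `φ`, a framing is a pair of plane loops `(u, w)` with `Im(ū w) > 0`.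
Here `u = z ^ k exp g` contracts to `z ^ k`, and `w / u` stays in the upper half-plane and contracts
to `i`. So every framing is homotopic to some `k · φ` (`exists_rotationHomotopic`). The integer `k`
is unique because the winding number of the first vector is a homotopy invariant
(`eq_zero_of_homotopy`).

The normal bundle of the disk is trivial of rank three (`exists_normal_frame`), and the clean
intersection makes `N_Y(γ)` inject into it. A framing of the curve thus becomes a loop of linearly
independent pairs in `ℝ³`. It is admissible exactly when this loop extends over the disk, the
subbundle being the span of the extended pair (`exists_admissible_iff`). The space of such pairs is
homotopy equivalent to `SO(3)`, whose fundamental group is `ℤ/2`, and rotating `k` times adds `k`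
modulo 2. Both halves of this are proved by hand.

Existence (`exists_disk_extension`): the first vector extends without zeros for reasons of
dimension. In a frame around it the second vector has a winding number `d`, and the loop deforms to
`k` turns about one axis combined with `d` turns about another. Swinging the axes together gives `k
+ d` turns. If `k + d = 2n`, reversing one axis deforms these to `n - n` turns, which is a constant
loop (`radialExtension_rotation`).

Obstruction (`even_of_linearIndependent_disk`): a pair in `ℝ³` yields an isotropic vector of `ℂ³`,
that is, a symmetric complex `2 × 2` matrix of rank one, the square of a spinor unique up to sign.
Over the disk the spinor can be chosen continuously, as an eigenvector field. Along the boundary of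
the `m`-fold rotation it turns by half of `m`, so `m` is even. -/

open Manifold Topology
open scoped ContDiff

namespace AmbientSurgery

noncomputable section

/-! ### Trivialising subbundles over the disk -/

section Transport

lemma smul_mem_disk {z : ℂ} (hz : z ∈ disk) {t : ℝ} (h0 : 0 ≤ t) (h1 : t ≤ 1) :
    (t : ℂ) * z ∈ disk := by
  simp only [Metric.mem_closedBall, dist_zero_right, norm_mul, Complex.norm_real] at hz ⊢
  rw [Real.norm_of_nonneg h0]
  exact mul_le_one₀ h1 (norm_nonneg _) hz

/-- The range of a continuous family of idempotents over the disk is a trivial bundle: composing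
the idempotents along a fine subdivision of the rays transports the fibre over `0` injectively to
all other fibres. -/
theorem exists_transport_of_idempotent {F : Type*} [NormedAddCommGroup F] [NormedSpace ℝ F]
    (Q : ℂ → F →L[ℝ] F) (hQ : ContinuousOn Q disk) (hidem : ∀ z ∈ disk, ∀ f, Q z (Q z f) = Q z f) :
    ∃ P : ℂ → F →L[ℝ] F, ContinuousOn P disk ∧
      (ContDiffOn ℝ ∞ Q disk → ContDiffOn ℝ ∞ P disk) ∧
      ∀ z ∈ disk, (∀ f, Q z (P z f) = P z f) ∧ ∀ f, Q 0 f = f → P z f = 0 → f = 0 := by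
  -- By compactness, steps of length at most `1 / N < δ` along a ray change `Q` by less than `1` in
  -- operator norm.
  have huc := (isCompact_closedBall (0 : ℂ) 1).uniformContinuousOn_of_continuous hQ
  obtain ⟨δ, hδ, hδQ⟩ := Metric.uniformContinuousOn_iff.1 huc 1 one_pos
  obtain ⟨N, hN⟩ := exists_nat_gt (1 / δ)
  have hN0 : (0 : ℝ) < N := (one_div_pos.2 hδ).trans hN
  -- `T n z` is the product `Q (n z / N) ∘ ⋯ ∘ Q (z / N) ∘ Q 0`; the point `z` is reached at `n =
  -- N`.
  let T : ℕ → ℂ → F →L[ℝ] F := fun n => n.rec (fun _ => Q 0)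
    (fun n T z => (Q ((((n + 1 : ℕ) : ℝ) / N : ℝ) * z)).comp (T z))
  have hTs : ∀ n z, T (n + 1) z = (Q ((((n + 1 : ℕ) : ℝ) / N : ℝ) * z)).comp (T n z) :=
    fun n z => rfl
  have hmem : ∀ n ≤ N, ∀ z ∈ disk, (((n : ℝ) / N : ℝ) : ℂ) * z ∈ disk := fun n hn z hz =>
    smul_mem_disk hz (by positivity) ((div_le_one hN0).2 (by exact_mod_cast hn))
  have hcont : ∀ n ≤ N, ContinuousOn (T n) disk := by
    intro n
    induction n with
    | zero => exact fun _ => continuousOn_const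
    | succ n ih =>
      intro hn
      exact (hQ.comp (by fun_prop) (hmem _ hn)).clm_comp (ih (by omega))
  have hsm : ContDiffOn ℝ ∞ Q disk → ∀ n ≤ N, ContDiffOn ℝ ∞ (T n) disk := by
    intro hQs n
    induction n with
    | zero => exact fun _ => contDiffOn_const
    | succ n ih =>
      intro hn
      exact (hQs.comp (by fun_prop) (hmem _ hn)).clm_comp (ih (by omega))
  have hprop : ∀ n ≤ N, ∀ z ∈ disk, (∀ f, Q (((n : ℝ) / N : ℝ) * z) (T n z f) = T n z f) ∧
      ∀ f, Q 0 f = f → T n z f = 0 → f = 0 := by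
    intro n
    induction n with
    | zero =>
      intro _ z _
      refine ⟨fun f => ?_, fun f h1 h2 => ?_⟩
      · simpa using! hidem 0 (by simp) f
      · rw [← h1]; exact h2
    | succ n ih =>
      intro hn z hz
      obtain ⟨i1, i2⟩ := ih (by omega) z hz
      refine ⟨fun f => ?_, fun f h1 h2 => i2 f h1 ?_⟩
      · rw [hTs]
        exact hidem _ (hmem _ hn z hz) _
      · rw [hTs, ContinuousLinearMap.comp_apply] at h2
        have hd : dist (Q (((n : ℝ) / N : ℝ) * z)) (Q ((((n + 1 : ℕ) : ℝ) / N : ℝ) * z)) < 1 := by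
          refine hδQ _ (hmem n (by omega) z hz) _ (hmem _ hn z hz) ?_
          rw [dist_eq_norm, ← sub_mul, ← Complex.ofReal_sub, norm_mul, Complex.norm_real]
          have e : (n : ℝ) / N - ((n + 1 : ℕ) : ℝ) / N = -(1 / N) := by push_cast; ring
          rw [e, norm_neg, Real.norm_of_nonneg (by positivity)]
          have hz1 : ‖z‖ ≤ 1 := by simpa using hz
          calc 1 / (N : ℝ) * ‖z‖ ≤ 1 / N * 1 := by gcongr
            _ < δ := by
              rw [mul_one, div_lt_iff₀ hN0]
              rw [div_lt_iff₀ hδ] at hN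
              linarith
        rw [dist_eq_norm] at hd
        -- A nonzero `T n z f` is fixed by one idempotent and killed by the next, so their
        -- difference maps it to itself although it has norm below `1`.
        by_contra hne
        have hpos := norm_pos_iff.2 hne
        have h3 := (Q (((n : ℝ) / N : ℝ) * z) - Q ((((n + 1 : ℕ) : ℝ) / N : ℝ) * z)).le_opNorm
          (T n z f)
        rw [sub_apply, i1, h2, sub_zero] at h3
        nlinarith
  refine ⟨T N, hcont N le_rfl, fun h => hsm h N le_rfl, fun z hz => ?_⟩
  have := hprop N le_rfl z hz
  rwa [div_self hN0.ne', Complex.ofReal_one, one_mul] at this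

/-! ### Linear combination maps and smoothness of orthogonal projections -/

section Comb

variable {E : Type*} [NormedAddCommGroup E] [NormedSpace ℝ E]

/-- The linear map `ℝ^ι → E` with prescribed values on the standard basis. -/
def euclideanComb {ι : Type*} [Fintype ι] (l : ι → E) : EuclideanSpace ℝ ι →L[ℝ] E :=
  ∑ i, (EuclideanSpace.proj i : EuclideanSpace ℝ ι →L[ℝ] ℝ).smulRight (l i)

lemma euclideanComb_apply {ι : Type*} [Fintype ι] (l : ι → E) (c : EuclideanSpace ℝ ι) :
    euclideanComb l c = ∑ i, c i • l i := by
  simp [euclideanComb]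

lemma contDiffWithinAt_euclideanComb {ι : Type*} [Fintype ι] {l : ι → ℂ → E} {s : Set ℂ} {z₀ : ℂ}
    (hl : ∀ i, ContDiffWithinAt ℝ ∞ (l i) s z₀) :
    ContDiffWithinAt ℝ ∞ (fun z => euclideanComb (fun i => l i z)) s z₀ := by
  unfold euclideanComb
  exact ContDiffWithinAt.sum fun i _ => contDiffWithinAt_const.smulRight (hl i)

lemma euclideanComb_injective {ι : Type*} [Fintype ι] {l : ι → E} (hl : LinearIndependent ℝ l) :
    Function.Injective (euclideanComb l) := by
  refine (injective_iff_map_eq_zero _).2 fun c hc => ?_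
  rw [euclideanComb_apply] at hc
  ext i
  exact Fintype.linearIndependent_iff.1 hl _ hc i

lemma euclideanComb_range {ι : Type*} [Fintype ι] (l : ι → E) :
    (euclideanComb l).range = Submodule.span ℝ (Set.range l) := by
  ext x
  rw [Submodule.mem_span_range_iff_exists_fun]
  constructor
  · rintro ⟨c, rfl⟩
    exact ⟨c, (euclideanComb_apply l c).symm⟩
  · rintro ⟨c, rfl⟩
    exact ⟨WithLp.toLp 2 c, euclideanComb_apply l _⟩

end Comb

variable {E G : Type*} [NormedAddCommGroup E] [InnerProductSpace ℝ E] [FiniteDimensional ℝ E]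
  [NormedAddCommGroup G] [InnerProductSpace ℝ G] [FiniteDimensional ℝ G]

open ContinuousLinearMap in
lemma isInvertible_adjoint_comp_self {L : G →L[ℝ] E} (hL : Function.Injective L) :
    ((adjoint L).comp L).IsInvertible := by
  have hinj : Function.Injective ((adjoint L).comp L) := by
    have := L.ker_adjoint_comp_self
    rw [LinearMap.ker_eq_bot.2 hL] at this
    exact LinearMap.ker_eq_bot.1 this
  exact ⟨(LinearEquiv.ofInjectiveEndo _ hinj).toContinuousLinearEquiv, by ext; rfl⟩

-- The normal equations: `L (L* L)⁻¹ L* u` lies in the range, and its difference from `u` is killed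
-- by `L*`.
open ContinuousLinearMap in
lemma starProjection_range_eq {L : G →L[ℝ] E} (hL : Function.Injective L) :
    (L.range).starProjection = L.comp ((inverse ((adjoint L).comp L)).comp (adjoint L)) := by
  ext u
  refine (Submodule.eq_starProjection_of_mem_of_inner_eq_zero (LinearMap.mem_range_self _ _) ?_)
  rintro _ ⟨w, rfl⟩
  have h := (isInvertible_adjoint_comp_self hL).self_apply_inverse (adjoint L u)
  simp only [comp_apply] at h ⊢
  change inner ℝ _ (L w) = 0
  rw [← adjoint_inner_left, map_sub, h, sub_self, inner_zero_left]

-- Taking adjoints is linear and inversion is smooth at invertible operators, so the formula `L (L*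
-- L)⁻¹ L*` is smooth in `z`. A local injective parametrisation of `K` suffices.
open ContinuousLinearMap in
lemma contDiffWithinAt_starProjection_range {L : ℂ → G →L[ℝ] E} {s : Set ℂ} {z₀ : ℂ} (hz₀ : z₀ ∈ s)
    (hL : ContDiffWithinAt ℝ ∞ L s z₀) {K : ℂ → Submodule ℝ E}
    (hK : ∀ᶠ z in 𝓝[s] z₀, Function.Injective (L z) ∧ K z = (L z).range) :
    ContDiffWithinAt ℝ ∞ (fun z => (K z).starProjection) s z₀ := by
  have h0 := hK.self_of_nhdsWithin hz₀
  have hadj : ContDiffWithinAt ℝ ∞ (fun z => adjoint (L z)) s z₀ :=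
    ((adjoint : (G →L[ℝ] E) ≃ₗᵢ⋆[ℝ] (E →L[ℝ] G)).toLinearIsometry.toContinuousLinearMap
      |> fun A : (G →L[ℝ] E) →L[ℝ] (E →L[ℝ] G) => A.contDiff).comp_contDiffWithinAt hL
  have hinv : ContDiffWithinAt ℝ ∞ (fun z => inverse ((adjoint (L z)).comp (L z))) s z₀ :=
    ContDiffAt.comp_contDiffWithinAt (g := inverse) z₀
      (isInvertible_adjoint_comp_self h0.1).contDiffAt_map_inverse (hadj.clm_comp hL)
  refine (hL.clm_comp (hinv.clm_comp hadj)).congr_of_eventuallyEq ?_ ?_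
  · filter_upwards [hK] with z hz
    simp only [hz.2]
    exact starProjection_range_eq hz.1
  · simp only [h0.2]
    exact starProjection_range_eq h0.1

/-- Smooth linearly independent vectors over the disk can be completed smoothly to a basis. -/
theorem exists_smooth_complement {k m : ℕ} (hkm : k + m = Module.finrank ℝ E) (l : Fin k → ℂ → E)
    (hl : ∀ i, ContDiffOn ℝ ∞ (l i) disk)
    (hind : ∀ z ∈ disk, LinearIndependent ℝ (fun i => l i z)) :
    ∃ C : Fin m → ℂ → E, (∀ i, ContDiffOn ℝ ∞ (C i) disk) ∧
      ∀ z ∈ disk, ∀ c : Fin m → ℝ,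
        ∑ i, c i • C i z ∈ Submodule.span ℝ (Set.range fun i => l i z) → c = 0 := by
  let K : ℂ → Submodule ℝ E := fun z => Submodule.span ℝ (Set.range fun i => l i z)
  have hK : ContDiffOn ℝ ∞ (fun z => (K z).starProjection) disk := by
    intro z₀ hz₀
    refine contDiffWithinAt_starProjection_range hz₀
      (contDiffWithinAt_euclideanComb fun i => hl i z₀ hz₀) ?_
    filter_upwards [self_mem_nhdsWithin] with z hz
    exact ⟨euclideanComb_injective (hind z hz), (euclideanComb_range _).symm⟩
  -- A basis of the orthogonal complement over `0` is transported to the other fibres and becomes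
  -- the fields `C i`.
  let Q : ℂ → E →L[ℝ] E := fun z => (K z)ᗮ.starProjection
  have hQ : ContDiffOn ℝ ∞ Q disk := by
    have : Q = fun z => ContinuousLinearMap.id ℝ E - (K z).starProjection := by
      funext z
      ext x
      simp [Q]
    rw [this]
    exact contDiffOn_const.sub hK
  obtain ⟨P, -, hPs, hP⟩ := exists_transport_of_idempotent Q hQ.continuousOn
    (fun z _ f => Submodule.starProjection_eq_self_iff.2 (Submodule.starProjection_apply_mem _ _))
  have h0 : (0 : ℂ) ∈ disk := by simp
  have hdim : Module.finrank ℝ (K 0)ᗮ = m := by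
    have h1 := (K 0).finrank_add_finrank_orthogonal
    have h2 : Module.finrank ℝ (K 0) = k := by
      simpa using finrank_span_eq_card (hind 0 h0)
    omega
  let b : Module.Basis (Fin m) ℝ (K 0)ᗮ := Module.finBasisOfFinrankEq ℝ _ hdim
  refine ⟨fun i z => P z (b i), fun i => (hPs hQ).clm_apply contDiffOn_const, ?_⟩
  intro z hz c hc
  have e : ∑ i, c i • P z (b i) = P z (∑ i, c i • b i : (K 0)ᗮ) := by simp
  rw [e] at hc
  obtain ⟨p1, p2⟩ := hP z hz
  -- The vector lies in `K z` by hypothesis and in its orthogonal complement by construction.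
  have hz0 : P z (∑ i, c i • b i : (K 0)ᗮ) = 0 := by
    have h1 : P z (∑ i, c i • b i : (K 0)ᗮ) ∈ (K z)ᗮ := Submodule.starProjection_eq_self_iff.1 (p1 _)
    have := Submodule.inner_right_of_mem_orthogonal hc h1
    exact inner_self_eq_zero.1 this
  have h3 := p2 _ (Submodule.starProjection_eq_self_iff.2 (Subtype.coe_prop _)) hz0
  have h4 : (∑ i, c i • b i : (K 0)ᗮ) = 0 := Subtype.ext h3
  funext i
  exact Fintype.linearIndependent_iff.1 b.linearIndependent c h4 i

end Transport

/-! ### Winding numbers of plane loops -/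

section Degree

open Complex

/-- The logarithms of `1` form the discrete set `2πiℤ`, so a continuous choice among them is locally
constant. -/
lemma eq_of_exp_eq_one {X : Type*} [TopologicalSpace X] [PreconnectedSpace X] {f : X → ℂ}
    (hf : Continuous f) (h : ∀ x, exp (f x) = 1) (x y : X) : f x = f y := by
  have hloc : IsLocallyConstant f := by
    rw [IsLocallyConstant.iff_eventually_eq]
    intro x
    have hx := Metric.tendsto_nhds.1 (hf.tendsto x) (2 * Real.pi) Real.two_pi_pos
    filter_upwards [hx] with y hy
    have he : exp (f y - f x) = 1 := by rw [exp_sub, h, h, div_one]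
    obtain ⟨n, hn⟩ := exp_eq_one_iff.1 he
    rw [dist_eq_norm, hn, norm_mul, norm_mul, norm_mul, norm_I, mul_one, norm_real, norm_intCast,
      Real.norm_of_nonneg Real.pi_pos.le] at hy
    have h2 : |(n : ℝ)| < 1 := by
      have hp := Real.two_pi_pos
      have e : ‖(2 : ℂ)‖ = 2 := by simp
      rw [e] at hy
      nlinarith
    have h3 : n = 0 := Int.abs_lt_one_iff.1 (by exact_mod_cast h2)
    rw [h3] at hn
    simpa [sub_eq_zero] using hn
  exact hloc.apply_eq_of_preconnectedSpace x y

/-- A real topological vector space is simply connected, so the map lifts through the covering `exp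
: ℂ → ℂ \ {0}`. -/
lemma exists_continuous_log {V : Type*} [AddCommGroup V] [Module ℝ V] [TopologicalSpace V]
    [IsTopologicalAddGroup V] [ContinuousSMul ℝ V] [LocallyPathConnectedSpace V] {f : V → ℂ}
    (hf : Continuous f) (h0 : ∀ x, f x ≠ 0) :
    ∃ F : V → ℂ, Continuous F ∧ ∀ x, exp (F x) = f x := by
  obtain ⟨F, ⟨-, hF⟩, -⟩ := isCoveringMapOn_exp.existsUnique_continuousMap_lifts
    (⟨f, hf⟩ : C(V, ℂ)) (a₀ := 0) (exp_log (h0 0)) h0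
  exact ⟨F, F.continuous, fun x => congrFun hF x⟩

/-- A smooth loop in `ℂ \ {0}` (thought of as a map on `ℂ \ {0}`) is a power times an
exponential. -/
theorem exists_zpow_mul_exp {u : ℂ → ℂ} (hu : ∀ z, z ≠ 0 → ContDiffAt ℝ ∞ u z)
    (h0 : ∀ z, z ≠ 0 → u z ≠ 0) :
    ∃ (d : ℤ) (g : ℂ → ℂ), (∀ z, z ≠ 0 → ContDiffAt ℝ ∞ g z) ∧
      ∀ z, z ≠ 0 → u z = z ^ d * exp (g z) := by
  -- `exp` is the universal covering of the punctured plane; after pulling back along it, `u` has a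
  -- global logarithm `U`.
  have hsm : ∀ w, ContDiffAt ℝ ∞ (fun w => u (exp w)) w := fun w =>
    (hu _ (exp_ne_zero w)).comp w contDiff_exp.contDiffAt
  obtain ⟨U, hUc, hU⟩ := exists_continuous_log (V := ℂ) (f := fun w => u (exp w))
    (continuous_iff_continuousAt.2 fun w => (hsm w).continuousAt) (fun w => h0 _ (exp_ne_zero w))
  have hUs : ∀ w, ContDiffAt ℝ ∞ U w := by
    intro w
    -- Near `w` the continuous lift coincides with a branch of the logarithm, hence is smooth.
    have h1 : ContDiffAt ℝ ∞ (fun x => U w + log (u (exp x) / u (exp w))) w := by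
      refine contDiffAt_const.add ?_
      refine ContDiffAt.comp (g := log) w ?_ ((hsm w).div_const _)
      refine (contDiffAt_log ?_).restrict_scalars ℝ
      rw [div_self (h0 _ (exp_ne_zero w))]
      exact one_mem_slitPlane
    refine h1.congr_of_eventuallyEq ?_
    have hx := Metric.tendsto_nhds.1 (hUc.tendsto w) Real.pi Real.pi_pos
    filter_upwards [hx] with x hx
    rw [dist_eq_norm] at hx
    have him := (abs_im_le_norm (U x - U w)).trans_lt hx
    rw [abs_lt] at him
    rw [← hU, ← hU, ← exp_sub, log_exp him.1 him.2.le]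
    ring
  have hper : ∀ w, exp (U (w + 2 * Real.pi * I) - U w) = 1 := by
    intro w
    rw [exp_sub, hU, hU, exp_add, exp_two_pi_mul_I, mul_one, div_self (h0 _ (exp_ne_zero w))]
  obtain ⟨d, hd⟩ := exp_eq_one_iff.1 (hper 0)
  have hconst : ∀ w, U (w + 2 * Real.pi * I) - U w = d * (2 * Real.pi * I) := fun w => by
    rw [← hd]
    exact eq_of_exp_eq_one (f := fun w => U (w + 2 * Real.pi * I) - U w) (by fun_prop) hper w 0
  -- The increment of `U` over one period is `2πid`; subtracting `d * w` leaves a periodic function,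
  -- which descends to the punctured plane.
  let V : ℂ → ℂ := fun w => U w - d * w
  have hVp : Function.Periodic V (2 * Real.pi * I) := fun w => by
    have := hconst w
    simp only [V]
    linear_combination this
  have hVexp : ∀ w w', exp w = exp w' → V w = V w' := by
    intro w w' h
    obtain ⟨n, rfl⟩ := exp_eq_exp_iff_exists_int.1 h
    exact hVp.int_mul n w'
  have hVs : ∀ w, ContDiffAt ℝ ∞ V w := fun w => (hUs w).sub (contDiffAt_const.mul contDiffAt_id)
  refine ⟨d, fun z => V (log z), fun z₀ hz₀ => ?_, fun z hz => ?_⟩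
  -- The principal `log` may jump, but `V` depends only on the exponential of its argument, so near
  -- `z₀` a smooth branch can be used instead.
  · have h1 : ContDiffAt ℝ ∞ (fun z => V (log z₀ + log (z / z₀))) z₀ := by
      refine (hVs _).comp z₀ (contDiffAt_const.add ?_)
      refine ContDiffAt.comp (g := log) z₀ ?_ (contDiffAt_id.div_const _)
      refine (contDiffAt_log ?_).restrict_scalars ℝ
      rw [div_self hz₀]
      exact one_mem_slitPlane
    refine h1.congr_of_eventuallyEq ?_
    filter_upwards [isOpen_ne.mem_nhds hz₀] with z hz
    refine hVexp _ _ ?_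
    rw [exp_add, exp_log hz, exp_log hz₀, exp_log (div_ne_zero hz hz₀), mul_div_cancel₀ _ hz₀]
  · have e1 : exp (V (log z)) = u z / z ^ d := by
      simp only [V]
      rw [exp_sub, hU, exp_log hz, exp_int_mul, exp_log hz]
    rw [e1, mul_div_cancel₀ _ (zpow_ne_zero d hz)]

/-- The winding number is a homotopy invariant. -/
theorem eq_zero_of_homotopy {H : ℝ × ℝ → ℂ} (hH : Continuous H) (h0 : ∀ p, H p ≠ 0)
    (hper : ∀ t θ, H (t, θ + 2 * Real.pi) = H (t, θ)) {k : ℤ}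
    (hs : ∀ θ : ℝ, H (0, θ) = exp (k * (θ * I))) (he : ∀ θ : ℝ, H (1, θ) = 1) : k = 0 := by
  obtain ⟨F, hFc, hF⟩ := exists_continuous_log hH h0
  -- The increment of the lift over one turn is a continuous multiple of `2πi`, hence the same at
  -- both ends of the homotopy; it is `2πik` at `t = 0` and `0` at `t = 1`.
  have hconst := eq_of_exp_eq_one
    (f := fun p : ℝ × ℝ => F (p.1, p.2 + 2 * Real.pi) - F p) (by fun_prop) (fun p => by
      rw [exp_sub, hF, hF, hper, div_self (h0 _)]) (0, 0) (1, 0)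
  have h1 := eq_of_exp_eq_one (f := fun θ : ℝ => F (1, θ)) (by fun_prop)
    (fun θ => by rw [hF, he]) (0 + 2 * Real.pi) 0
  have h2 := eq_of_exp_eq_one (f := fun θ : ℝ => F (0, θ) - k * (θ * I)) (by fun_prop)
    (fun θ => by rw [exp_sub, hF, hs, div_self (exp_ne_zero _)]) (0 + 2 * Real.pi) 0
  simp only at hconst h1 h2
  rw [h1, sub_self] at hconst
  have h3 : (k : ℂ) * (2 * Real.pi * I) = 0 := by
    push_cast at h2
    linear_combination hconst - h2
  have h4 : (2 * Real.pi * I : ℂ) ≠ 0 := two_pi_I_ne_zero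
  exact_mod_cast (mul_eq_zero.1 h3).resolve_right h4

/-- The pair of loops `(u, w)` in the plane, a positive basis at every point, is smoothly
homotopic through such pairs to the standard basis rotated `k` times. -/
def RotationHomotopic (k : ℤ) (u w : ℂ → ℂ) : Prop :=
  ∃ U W : ℝ → ℂ → ℂ,
    (∀ t z, z ≠ 0 → ContDiffAt ℝ ∞ (Function.uncurry U) (t, z)) ∧
    (∀ t z, z ≠ 0 → ContDiffAt ℝ ∞ (Function.uncurry W) (t, z)) ∧
    (∀ t ∈ Set.Icc (0 : ℝ) 1, ∀ z, z ≠ 0 → 0 < ((starRingEnd ℂ) (U t z) * W t z).im) ∧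
    (∀ z, z ≠ 0 → U 0 z = z ^ k) ∧ (∀ z, z ≠ 0 → W 0 z = I * z ^ k) ∧
    (∀ z, z ≠ 0 → U 1 z = u z) ∧ (∀ z, z ≠ 0 → W 1 z = w z)

lemma contDiffAt_zpow (k : ℤ) {z : ℂ} (hz : z ≠ 0) : ContDiffAt ℝ ∞ (fun z : ℂ => z ^ k) z :=
  (((analyticAt_id (𝕜 := ℂ) (z := z)).zpow hz (n := k)).contDiffAt).restrict_scalars ℝ

theorem exists_rotationHomotopic {u w : ℂ → ℂ} (hu : ∀ z, z ≠ 0 → ContDiffAt ℝ ∞ u z)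
    (hw : ∀ z, z ≠ 0 → ContDiffAt ℝ ∞ w z)
    (hpos : ∀ z, z ≠ 0 → 0 < ((starRingEnd ℂ) (u z) * w z).im) :
    ∃ k, RotationHomotopic k u w := by
  have h0 : ∀ z, z ≠ 0 → u z ≠ 0 := fun z hz h => by simpa [h] using hpos z hz
  obtain ⟨k, g, hg, hug⟩ := exists_zpow_mul_exp hu h0
  have him : ∀ a b : ℂ, ((starRingEnd ℂ) a * (b * a)).im = normSq a * b.im := fun a b => by
    simp [normSq_apply]; ring
  have hζ : ∀ z, z ≠ 0 → 0 < (w z / u z).im := by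
    intro z hz
    have h1 := hpos z hz
    rw [← div_mul_cancel₀ (w z) (h0 z hz), him] at h1
    exact pos_of_mul_pos_right h1 (normSq_nonneg _)
  have hU : ∀ (t : ℝ) z, z ≠ 0 → ContDiffAt ℝ ∞ (Function.uncurry fun (t : ℝ) z =>
      z ^ k * exp (t * g z)) (t, z) := by
    intro t z hz
    refine ContDiffAt.mul (𝕜 := ℝ) ((contDiffAt_zpow k hz).comp (t, z) contDiffAt_snd) ?_
    refine contDiff_exp.contDiffAt.comp (t, z) ?_
    exact (ofRealCLM.contDiff.contDiffAt.comp (t, z) contDiffAt_fst).mul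
      ((hg z hz).comp (t, z) contDiffAt_snd)
  -- The factor `exp g` of `u` is deformed from `1`. Positivity says that `w / u` lies in the upper
  -- half-plane, which is convex and contains `I`, so the quotient moves along the segment from `I`
  -- to `w / u`.
  refine ⟨k, fun t z => z ^ k * exp (t * g z), fun t z => (t * (w z / u z) + (1 - t) * I) *
    (z ^ k * exp (t * g z)), hU, fun t z hz => ?_, ?_, ?_, ?_, ?_, ?_⟩
  · have ht : ContDiffAt ℝ ∞ (fun p : ℝ × ℂ => (p.1 : ℂ)) (t, z) :=
      ofRealCLM.contDiff.contDiffAt.comp (t, z) contDiffAt_fst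
    have hdiv : ContDiffAt ℝ ∞ (fun z => w z / u z) z := by
      simp only [div_eq_mul_inv]
      exact (hw z hz).mul ((hu z hz).inv (h0 z hz))
    refine ContDiffAt.mul (𝕜 := ℝ) ?_ (hU t z hz)
    exact (ht.mul (hdiv.comp (t, z) contDiffAt_snd)).add
      ((contDiffAt_const.sub ht).mul contDiffAt_const)
  · intro t ht z hz
    rw [him]
    have e : (t * (w z / u z) + (1 - t) * I).im = t * (w z / u z).im + (1 - t) := by
      simp
    rw [e]
    refine mul_pos (normSq_pos.2 (mul_ne_zero (zpow_ne_zero _ hz) (exp_ne_zero _))) ?_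
    rcases ht.1.eq_or_lt with h | h
    · rw [← h]; norm_num
    · have := mul_pos h (hζ z hz)
      linarith [ht.2]
  · intro z hz; simp
  · intro z hz; simp
  · intro z hz; simp [hug z hz]
  · intro z hz
    simp only [ofReal_one, one_mul, sub_self, zero_mul, add_zero]
    rw [← hug z hz, div_mul_cancel₀ _ (h0 z hz)]

end Degree

/-! ### Extending loops over the plane and the disk -/

section Extension

open Complex

/-- The radial projection of the plane to the unit circle. -/
def radial (z : ℂ) : ℂ := ((‖z‖⁻¹ : ℝ) : ℂ) * z

lemma contDiffAt_radial {z : ℂ} (hz : z ≠ 0) : ContDiffAt ℝ ∞ radial z :=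
  (ofRealCLM.contDiff.contDiffAt.comp z ((contDiffAt_norm ℝ hz).inv (norm_ne_zero_iff.2 hz))).mul
    contDiffAt_id

lemma norm_radial {z : ℂ} (hz : z ≠ 0) : ‖radial z‖ = 1 := by
  rw [radial, norm_mul, norm_real, norm_inv, norm_norm, inv_mul_cancel₀ (norm_ne_zero_iff.2 hz)]

lemma radial_ne_zero {z : ℂ} (hz : z ≠ 0) : radial z ≠ 0 :=
  norm_ne_zero_iff.1 (by rw [norm_radial hz]; exact one_ne_zero)

lemma radial_of_norm_eq_one {z : ℂ} (hz : ‖z‖ = 1) : radial z = z := by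
  simp [radial, hz]

lemma radial_mul_of_pos {r : ℝ} (hr : 0 < r) (z : ℂ) : radial (r * z) = radial z := by
  unfold radial
  rw [norm_mul, norm_real, Real.norm_of_nonneg hr.le]
  push_cast
  have : (r : ℂ) ≠ 0 := by exact_mod_cast hr.ne'
  field_simp

variable {E : Type*} [NormedAddCommGroup E] [NormedSpace ℝ E]

/-- A map on the unit circle extends smoothly to the plane, with values in `S`, and radially
outside of the unit disk. -/
def RadialExtension (S : Set E) (a : ℂ → E) : Prop :=
  ∃ F : ℂ → E, ContDiff ℝ ∞ F ∧ (∀ z, F z ∈ S) ∧ ∀ z, 1 ≤ ‖z‖ → F z = a (radial z)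

lemma RadialExtension.congr {S : Set E} {a b : ℂ → E} (ha : RadialExtension S a)
    (h : ∀ z, ‖z‖ = 1 → a z = b z) : RadialExtension S b := by
  obtain ⟨F, h1, h2, h3⟩ := ha
  refine ⟨F, h1, h2, fun z hz => ?_⟩
  rw [h3 z hz, h _ (norm_radial (norm_pos_iff.1 (one_pos.trans_le hz)))]

lemma radialExtension_const {S : Set E} {x : E} (hx : x ∈ S) : RadialExtension S (fun _ => x) :=
  ⟨fun _ => x, contDiff_const, fun _ => hx, fun _ _ => rfl⟩

/-- The old extension is shrunk into the disk of radius `1 / 2`, and the homotopy is run in the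
collar `1 / 2 ≤ ‖z‖ ≤ 1`. -/
theorem RadialExtension.homotopy {S : Set E} (h : ℝ → ℂ → E)
    (hh : ∀ t z, z ≠ 0 → ContDiffAt ℝ ∞ (Function.uncurry h) (t, z))
    (hS : ∀ t ∈ Set.Icc (0 : ℝ) 1, ∀ z, ‖z‖ = 1 → h t z ∈ S)
    (h0 : RadialExtension S (h 0)) : RadialExtension S (h 1) := by
  obtain ⟨F, hF, hFS, hFb⟩ := h0
  have hout : ∀ z : ℂ, z ≠ 0 → ContDiffAt ℝ ∞
      (fun z => h (Real.smoothTransition (2 * ‖z‖ - 1)) (radial z)) z := by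
    intro z hz
    refine (hh _ _ (radial_ne_zero hz)).comp z (ContDiffAt.prodMk ?_ (contDiffAt_radial hz))
    exact Real.smoothTransition.contDiffAt.comp z
      ((contDiffAt_const.mul (contDiffAt_norm ℝ hz)).sub contDiffAt_const)
  have hin : ContDiff ℝ ∞ (fun z : ℂ => F (((4 : ℝ) : ℂ) * z)) :=
    hF.comp (contDiff_const.mul contDiff_id)
  -- Scaling by `4` rather than `2` makes the shrunk extension radial from radius `1 / 4` on, while
  -- the transition function is still `0` up to radius `1 / 2`. The overlap is a whole annulus,
  -- which gives smoothness of the glued map.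
  have hagree : ∀ z : ℂ, 1 / 4 ≤ ‖z‖ → ‖z‖ ≤ 1 / 2 → F (((4 : ℝ) : ℂ) * z) =
      h (Real.smoothTransition (2 * ‖z‖ - 1)) (radial z) := by
    intro z h1 h2
    rw [Real.smoothTransition.zero_of_nonpos (by linarith), hFb, radial_mul_of_pos (by norm_num)]
    rw [norm_mul, norm_real, Real.norm_of_nonneg (by norm_num)]
    linarith
  refine ⟨fun z => if ‖z‖ ≤ 1 / 2 then F (((4 : ℝ) : ℂ) * z) else
    h (Real.smoothTransition (2 * ‖z‖ - 1)) (radial z), ?_, ?_, ?_⟩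
  · rw [contDiff_iff_contDiffAt]
    intro z
    by_cases hz : ‖z‖ < 1 / 2
    · refine hin.contDiffAt.congr_of_eventuallyEq ?_
      filter_upwards [(isOpen_lt continuous_norm continuous_const).mem_nhds hz] with y hy
      exact if_pos (le_of_lt hy)
    · have hz4 : 1 / 4 < ‖z‖ := by linarith [not_lt.1 hz]
      refine (hout z (norm_pos_iff.1 (by linarith))).congr_of_eventuallyEq ?_
      filter_upwards [(isOpen_lt continuous_const continuous_norm).mem_nhds hz4] with y hy
      by_cases hy2 : ‖y‖ ≤ 1 / 2
      · rw [if_pos hy2]; exact hagree y (le_of_lt hy) hy2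
      · rw [if_neg hy2]
  · intro z
    by_cases hz : ‖z‖ ≤ 1 / 2
    · simp only [hz, if_true]; exact hFS _
    · simp only [hz, if_false]
      have : z ≠ 0 := fun h0 => hz (by rw [h0, norm_zero]; norm_num)
      exact hS _ ⟨Real.smoothTransition.nonneg _, Real.smoothTransition.le_one _⟩ _
        (norm_radial this)
  · intro z hz
    have h1 : ¬ ‖z‖ ≤ 1 / 2 := by linarith
    simp only [h1, if_false]
    rw [Real.smoothTransition.one_of_one_le (by linarith)]

/-- A continuous version of `RadialExtension.homotopy`. -/
theorem exists_continuousOn_disk_of_homotopy {E : Type*} [TopologicalSpace E] {S : Set E}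
    (h : ℝ → ℂ → E) (hh : ∀ t z, z ≠ 0 → ContinuousAt (Function.uncurry h) (t, z))
    (hS : ∀ t ∈ Set.Icc (0 : ℝ) 1, ∀ z, ‖z‖ = 1 → h t z ∈ S) {F : ℂ → E}
    (hF : ContinuousOn F disk) (hFS : ∀ z ∈ disk, F z ∈ S) (hF0 : ∀ z, ‖z‖ = 1 → F z = h 0 z) :
    ∃ F' : ℂ → E, ContinuousOn F' disk ∧ (∀ z ∈ disk, F' z ∈ S) ∧
      ∀ z, ‖z‖ = 1 → F' z = h 1 z := by
  have hmem : ∀ z : ℂ, ‖z‖ ≤ 1 / 2 → ((2 : ℝ) : ℂ) * z ∈ disk := fun z hz => by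
    simp only [Metric.mem_closedBall, dist_zero_right, norm_mul, norm_real]
    norm_num
    linarith
  refine ⟨fun z => if ‖z‖ ≤ 1 / 2 then F (((2 : ℝ) : ℂ) * z) else
    h (2 * ‖z‖ - 1) (radial z), ?_, ?_, ?_⟩
  · refine Continuous.continuousOn ?_
    refine continuous_if_le continuous_norm continuous_const ?_ ?_ ?_
    · exact hF.comp (by fun_prop) hmem
    · intro z hz
      have hz0 : z ≠ 0 := norm_pos_iff.1 (lt_of_lt_of_le (by norm_num) hz)
      refine ContinuousAt.continuousWithinAt ?_
      refine ContinuousAt.comp (g := Function.uncurry h) (f := fun z => (2 * ‖z‖ - 1, radial z))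
        (hh _ _ (radial_ne_zero hz0)) ?_
      exact (by fun_prop : ContinuousAt (fun z : ℂ => 2 * ‖z‖ - 1) z).prodMk
        (contDiffAt_radial hz0).continuousAt
    · intro z hz
      have hz0 : z ≠ 0 := norm_pos_iff.1 (by rw [hz]; norm_num)
      have e : ((2 : ℝ) : ℂ) * z = radial z := by
        rw [← radial_mul_of_pos two_pos, radial_of_norm_eq_one]
        rw [norm_mul, norm_real, hz]
        norm_num
      rw [e, hz, hF0 _ (norm_radial hz0)]
      norm_num
  · intro z hz
    by_cases h2 : ‖z‖ ≤ 1 / 2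
    · simp only [h2, if_true]; exact hFS _ (hmem z h2)
    · simp only [h2, if_false]
      have hz1 : ‖z‖ ≤ 1 := by simpa using hz
      have : z ≠ 0 := fun h0 => h2 (by rw [h0, norm_zero]; norm_num)
      exact hS _ ⟨by linarith, by linarith⟩ _ (norm_radial this)
  · intro z hz
    have h1 : ¬ ‖z‖ ≤ 1 / 2 := by rw [hz]; norm_num
    simp only [h1, if_false]
    rw [radial_of_norm_eq_one hz, hz]
    norm_num

/-- A smooth loop of nonzero vectors in a space of dimension at least three extends to a nowhere
vanishing map on the plane. -/
theorem radialExtension_ne_zero [FiniteDimensional ℝ E] (hE : 2 < Module.finrank ℝ E) {a : ℂ → E}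
    (ha : ∀ z, z ≠ 0 → ContDiffAt ℝ ∞ a z) (h0 : ∀ z, z ≠ 0 → a z ≠ 0) :
    RadialExtension {x | x ≠ 0} a := by
  -- The cone over the loop is a `C¹` image of `ℝ²`, so it misses some point `p` in dimension at
  -- least three.
  have hcone : ContDiff ℝ 1 (fun p : ℝ × ℝ => p.1 • a (exp (p.2 * I))) := by
    rw [contDiff_iff_contDiffAt]
    intro p
    refine contDiffAt_fst.smul ?_
    refine ((ha _ (exp_ne_zero _)).of_le (by simp)).comp p ?_
    exact contDiff_exp.contDiffAt.comp p
      ((ofRealCLM.contDiff.contDiffAt.comp p contDiffAt_snd).mul contDiffAt_const)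
  obtain ⟨p, hp⟩ := (hcone.dense_compl_range_of_finrank_lt_finrank (by simpa using hE)).nonempty
  have hp' : ∀ (s : ℝ) (z : ℂ), ‖z‖ = 1 → p ≠ s • a z := by
    intro s z hz h
    refine hp ⟨(s, arg z), ?_⟩
    have : exp (arg z * I) = z := by simpa [hz] using norm_mul_exp_arg_mul_I z
    simp only [this, h]
  -- The loop contracts to `p` along segments; a zero on a segment would make `p` a multiple of some
  -- `a z`.
  have key := RadialExtension.homotopy (S := {x : E | x ≠ 0}) (fun t z => t • a z + (1 - t) • p)
    (fun t z hz => (contDiffAt_fst.smul ((ha z hz).comp (t, z) contDiffAt_snd)).add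
      ((contDiffAt_const.sub contDiffAt_fst).smul contDiffAt_const)) ?_ ?_
  · exact key.congr fun z hz => by simp
  · intro t ht z hz h
    rcases ht.2.eq_or_lt with rfl | h1
    · simp only [one_smul, sub_self, zero_smul, add_zero] at h
      exact h0 z (norm_pos_iff.1 (by rw [hz]; exact one_pos)) h
    · refine hp' (-(1 - t)⁻¹ * t) z hz ?_
      have h2 : 1 - t ≠ 0 := by linarith
      rw [mul_smul, eq_neg_of_add_eq_zero_left h, smul_neg, neg_smul, neg_neg, smul_smul,
        inv_mul_cancel₀ h2, one_smul]
  · refine (radialExtension_const (S := {x : E | x ≠ 0}) (x := p) ?_).congr fun z hz => by simp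
    intro h
    exact hp' 0 1 (by simp) (by rw [h, zero_smul])

end Extension

/-! ### Coefficients with respect to a moving basis -/

section Coefficients

variable {E : Type*} [NormedAddCommGroup E] [NormedSpace ℝ E]
  {EX : Type*} [NormedAddCommGroup EX] [NormedSpace ℝ EX] {HX : Type*} [TopologicalSpace HX]
  {IX : ModelWithCorners ℝ EX HX} {X : Type*} [TopologicalSpace X] [ChartedSpace HX X]

lemma contDiff_euclideanComb {ι : Type*} [Fintype ι] {n : WithTop ℕ∞} :
    ContDiff ℝ n (fun l : ι → E => euclideanComb l) := by
  unfold euclideanComb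
  exact ContDiff.sum fun i _ => contDiff_const.smulRight (contDiff_apply ℝ E i)

variable [FiniteDimensional ℝ E]

lemma isInvertible_euclideanComb {ι : Type*} [Fintype ι] {l : ι → E} (hl : LinearIndependent ℝ l)
    (hcard : Fintype.card ι = Module.finrank ℝ E) : (euclideanComb l).IsInvertible :=
  ⟨(LinearEquiv.ofInjectiveOfFinrankEq (euclideanComb l).toLinearMap (euclideanComb_injective hl)
    (by simpa using hcard)).toContinuousLinearEquiv, by ext; rfl⟩

/-- The coefficients of a vector with respect to a moving basis are as regular as the vector and
the basis. -/
theorem contMDiffWithinAt_coeff {ι : Type*} [Fintype ι] {n : WithTop ℕ∞} {s : Set X} {x₀ : X}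
    (hx₀ : x₀ ∈ s) {b : ι → X → E} {v : X → E} {c : X → ι → ℝ}
    (hb : ∀ i, ContMDiffWithinAt IX 𝓘(ℝ, E) n (b i) s x₀)
    (hv : ContMDiffWithinAt IX 𝓘(ℝ, E) n v s x₀)
    (hcard : Fintype.card ι = Module.finrank ℝ E)
    (hc : ∀ᶠ x in 𝓝[s] x₀, LinearIndependent ℝ (fun i => b i x) ∧ v x = ∑ i, c x i • b i x)
    (i : ι) : ContMDiffWithinAt IX 𝓘(ℝ, ℝ) n (fun x => c x i) s x₀ := by
  have hL : ContMDiffWithinAt IX 𝓘(ℝ, EuclideanSpace ℝ ι →L[ℝ] E) n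
      (fun x => euclideanComb (fun i => b i x)) s x₀ :=
    (contDiff_euclideanComb (ι := ι) (E := E) (n := n)).contMDiff.contMDiffAt.comp_contMDiffWithinAt
      x₀ (contMDiffWithinAt_pi_space.2 hb)
  have hinv : ContMDiffWithinAt IX 𝓘(ℝ, E →L[ℝ] EuclideanSpace ℝ ι) n
      (fun x => (euclideanComb (fun i => b i x)).inverse) s x₀ :=
    ContMDiffAt.comp_contMDiffWithinAt (g := ContinuousLinearMap.inverse) x₀
      ((isInvertible_euclideanComb (hc.self_of_nhdsWithin hx₀).1 hcard).contDiffAt_map_inverse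
        (n := n)).contMDiffAt hL
  have hco : ∀ x, LinearIndependent ℝ (fun i => b i x) ∧ v x = ∑ i, c x i • b i x →
      c x i = EuclideanSpace.proj (𝕜 := ℝ) i ((euclideanComb (fun i => b i x)).inverse (v x)) := by
    rintro x ⟨h1, h2⟩
    have h3 : v x = euclideanComb (fun i => b i x) (WithLp.toLp 2 (c x)) := by
      rw [euclideanComb_apply, h2]
    rw [h3, (isInvertible_euclideanComb h1 hcard).inverse_apply_self]
    rfl
  refine ContMDiffWithinAt.congr_of_eventuallyEq
    (((EuclideanSpace.proj (𝕜 := ℝ) i : EuclideanSpace ℝ ι →L[ℝ] ℝ).contMDiff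
      (n := n)).contMDiffAt.comp_contMDiffWithinAt x₀
      (hinv.clm_apply hv)) ?_ (hco _ (hc.self_of_nhdsWithin hx₀))
  filter_upwards [hc] with x hx
  exact hco x hx

end Coefficients

/-! ### Rotations of pairs of vectors -/

section Rotation

open Complex

variable {V : Type*} [AddCommGroup V] [Module ℝ V]

/-- The combination of two vectors with the real and imaginary part of `u` as coefficients. -/
def planeComb (u : ℂ) (p q : V) : V := u.re • p + u.im • q

/-- Multiplication of `a` by `I` is the quarter turn of the pair, so rotating twice multiplies the
complex coefficients. -/
lemma planeComb_planeComb (u a : ℂ) (p q : V) :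
    planeComb u (planeComb a p q) (planeComb (I * a) p q) = planeComb (u * a) p q := by
  simp only [planeComb, mul_re, mul_im, I_re, I_im]
  module

lemma linearIndependent_planeComb {u w : ℂ} (h : 0 < ((starRingEnd ℂ) u * w).im) {p q : V}
    (hpq : LinearIndependent ℝ ![p, q]) :
    LinearIndependent ℝ ![planeComb u p q, planeComb w p q] := by
  rw [LinearIndependent.pair_iff] at hpq ⊢
  intro s t hst
  have e : (s * u.re + t * w.re) • p + (s * u.im + t * w.im) • q = 0 := by
    rw [← hst, planeComb, planeComb]; module
  obtain ⟨h1, h2⟩ := hpq _ _ e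
  have hD : u.re * w.im - u.im * w.re ≠ 0 := by
    simp only [mul_im, conj_re, conj_im] at h
    linarith
  constructor
  · refine (mul_eq_zero.1 ?_).resolve_right hD
    linear_combination w.im * h1 - w.re * h2
  · refine (mul_eq_zero.1 ?_).resolve_right hD
    linear_combination u.re * h2 - u.im * h1

/-- The image of the first basis vector under the rotation with axis `(S, 0, C)` by the angle
of `τ`. -/
def axisRotFst (τ : ℂ) (S C : ℝ) : Fin 3 → ℝ :=
  ![τ.re + (1 - τ.re) * S ^ 2, τ.im * C, (1 - τ.re) * S * C]

/-- The image of the second basis vector under the rotation with axis `(S, 0, C)` by the angle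
of `τ`. -/
def axisRotSnd (τ : ℂ) (S C : ℝ) : Fin 3 → ℝ :=
  ![-τ.im * C, τ.re, τ.im * S]

/-- The two vectors are orthonormal: pairing a linear relation with either of them isolates its
coefficient. -/
lemma linearIndependent_axisRot {τ : ℂ} (hτ : τ.re ^ 2 + τ.im ^ 2 = 1) {S C : ℝ}
    (hSC : S ^ 2 + C ^ 2 = 1) : LinearIndependent ℝ ![axisRotFst τ S C, axisRotSnd τ S C] := by
  rw [LinearIndependent.pair_iff]
  intro s t h
  have h0 := congrFun h 0
  have h1 := congrFun h 1
  have h2 := congrFun h 2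
  simp [axisRotFst, axisRotSnd] at h0 h1 h2
  constructor
  · linear_combination (τ.re + (1 - τ.re) * S ^ 2) * h0 + τ.im * C * h1 + (1 - τ.re) * S * C * h2
      - s * (1 - S ^ 2) * hτ - s * (τ.im ^ 2 + (1 - τ.re) ^ 2 * S ^ 2) * hSC
  · linear_combination -τ.im * C * h0 + τ.re * h1 + τ.im * S * h2 - t * hτ - t * τ.im ^ 2 * hSC

lemma contDiffAt_planeComb {M V : Type*} [NormedAddCommGroup M] [NormedSpace ℝ M]
    [NormedAddCommGroup V] [NormedSpace ℝ V] {u : M → ℂ} {p q : M → V} {x : M}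
    (hu : ContDiffAt ℝ ∞ u x) (hp : ContDiffAt ℝ ∞ p x) (hq : ContDiffAt ℝ ∞ q x) :
    ContDiffAt ℝ ∞ (fun y => planeComb (u y) (p y) (q y)) x :=
  ((reCLM.contDiff.contDiffAt.comp x hu).smul hp).add
    ((imCLM.contDiff.contDiffAt.comp x hu).smul hq)

lemma contDiffAt_vec3 {M : Type*} [NormedAddCommGroup M] [NormedSpace ℝ M] {f g h : M → ℝ} {x : M}
    (hf : ContDiffAt ℝ ∞ f x) (hg : ContDiffAt ℝ ∞ g x) (hh : ContDiffAt ℝ ∞ h x) :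
    ContDiffAt ℝ ∞ (fun y => ![f y, g y, h y]) x := by
  rw [contDiffAt_pi]
  intro i
  fin_cases i
  · exact hf
  · exact hg
  · exact hh

lemma contDiffAt_axisRot {M : Type*} [NormedAddCommGroup M] [NormedSpace ℝ M] {τ : M → ℂ}
    {S C : M → ℝ} {x : M} (hτ : ContDiffAt ℝ ∞ τ x) (hS : ContDiffAt ℝ ∞ S x)
    (hC : ContDiffAt ℝ ∞ C x) :
    ContDiffAt ℝ ∞ (fun y => axisRotFst (τ y) (S y) (C y)) x ∧
      ContDiffAt ℝ ∞ (fun y => axisRotSnd (τ y) (S y) (C y)) x := by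
  have hre : ContDiffAt ℝ ∞ (fun y => (τ y).re) x := reCLM.contDiff.contDiffAt.comp x hτ
  have him : ContDiffAt ℝ ∞ (fun y => (τ y).im) x := imCLM.contDiff.contDiffAt.comp x hτ
  exact ⟨contDiffAt_vec3 (by fun_prop) (by fun_prop) (by fun_prop),
    contDiffAt_vec3 (by fun_prop) (by fun_prop) (by fun_prop)⟩

/-- The pairs of linearly independent vectors of a vector space. -/
def indepPairs (V : Type*) [AddCommGroup V] [Module ℝ V] : Set (V × V) :=
  {x | LinearIndependent ℝ ![x.1, x.2]}

lemma re_sq_add_im_sq_zpow {z : ℂ} (hz : ‖z‖ = 1) (d : ℤ) :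
    (z ^ d).re ^ 2 + (z ^ d).im ^ 2 = 1 := by
  have : ‖z ^ d‖ = 1 := by rw [norm_zpow, hz, one_zpow]
  have h2 := Complex.sq_norm (z ^ d)
  rw [this, normSq_apply] at h2
  linarith

lemma conj_mul_I_mul_im_pos {z : ℂ} (hz : z ≠ 0) (k : ℤ) :
    0 < ((starRingEnd ℂ) (z ^ k) * (I * z ^ k)).im := by
  have h : ∀ a : ℂ, ((starRingEnd ℂ) a * (I * a)).im = normSq a := fun a => by
    simp [normSq_apply]
  rw [h]
  exact normSq_pos.2 (zpow_ne_zero _ hz)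

/-- Rotating the standard basis `k` times about the third axis and `d` times about the first
axis gives a contractible loop when `k + d` is even. -/
lemma radialExtension_rotation {k d : ℤ} (h : Even (k + d)) :
    RadialExtension (indepPairs (Fin 3 → ℝ)) (fun z =>
      (planeComb (z ^ k) ![1, 0, 0] ![0, (z ^ d).re, (z ^ d).im],
        planeComb (I * z ^ k) ![1, 0, 0] ![0, (z ^ d).re, (z ^ d).im])) := by
  have hz0 : ∀ z : ℂ, ‖z‖ = 1 → z ≠ 0 := fun z hz => norm_pos_iff.1 (by rw [hz]; exact one_pos)
  -- The pair is the standard one turned by `z ^ m` about the third axis and then by `z ^ n` about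
  -- the axis `(sin α, 0, cos α)`. Moving `α` is a homotopy of such loops.
  have gen : ∀ (m n : ℤ) (α : ℝ → ℝ), ContDiff ℝ ∞ α →
      RadialExtension (indepPairs (Fin 3 → ℝ)) (fun z =>
        (planeComb (z ^ m) (axisRotFst (z ^ n) (Real.sin (α 0)) (Real.cos (α 0)))
            (axisRotSnd (z ^ n) (Real.sin (α 0)) (Real.cos (α 0))),
          planeComb (I * z ^ m) (axisRotFst (z ^ n) (Real.sin (α 0)) (Real.cos (α 0)))
            (axisRotSnd (z ^ n) (Real.sin (α 0)) (Real.cos (α 0))))) →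
      RadialExtension (indepPairs (Fin 3 → ℝ)) (fun z =>
        (planeComb (z ^ m) (axisRotFst (z ^ n) (Real.sin (α 1)) (Real.cos (α 1)))
            (axisRotSnd (z ^ n) (Real.sin (α 1)) (Real.cos (α 1))),
          planeComb (I * z ^ m) (axisRotFst (z ^ n) (Real.sin (α 1)) (Real.cos (α 1)))
            (axisRotSnd (z ^ n) (Real.sin (α 1)) (Real.cos (α 1))))) := by
    intro m n α hα h0
    refine RadialExtension.homotopy (fun t z =>
      (planeComb (z ^ m) (axisRotFst (z ^ n) (Real.sin (α t)) (Real.cos (α t)))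
            (axisRotSnd (z ^ n) (Real.sin (α t)) (Real.cos (α t))),
          planeComb (I * z ^ m) (axisRotFst (z ^ n) (Real.sin (α t)) (Real.cos (α t)))
            (axisRotSnd (z ^ n) (Real.sin (α t)) (Real.cos (α t))))) ?_ ?_ h0
    · intro t z hz
      have hm : ContDiffAt ℝ ∞ (fun p : ℝ × ℂ => p.2 ^ m) (t, z) :=
        (contDiffAt_zpow m hz).comp (t, z) contDiffAt_snd
      have hn : ContDiffAt ℝ ∞ (fun p : ℝ × ℂ => p.2 ^ n) (t, z) :=
        (contDiffAt_zpow n hz).comp (t, z) contDiffAt_snd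
      have ha : ContDiffAt ℝ ∞ (fun p : ℝ × ℂ => α p.1) (t, z) :=
        hα.contDiffAt.comp (t, z) contDiffAt_fst
      have hf := contDiffAt_axisRot hn ha.sin ha.cos
      exact (contDiffAt_planeComb hm hf.1 hf.2).prodMk
        (contDiffAt_planeComb (contDiffAt_const.mul hm) hf.1 hf.2)
    · intro t _ z hz
      exact linearIndependent_planeComb (conj_mul_I_mul_im_pos (hz0 z hz) m)
        (linearIndependent_axisRot (re_sq_add_im_sq_zpow hz n) (Real.sin_sq_add_cos_sq _))
  obtain ⟨n, hn⟩ := h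
  have e0 : ∀ τ, axisRotFst τ 0 1 = planeComb τ ![1, 0, 0] ![0, 1, 0] ∧
      axisRotSnd τ 0 1 = planeComb (I * τ) ![1, 0, 0] ![0, 1, 0] := by
    intro τ
    constructor <;> ext i <;> fin_cases i <;> simp [axisRotFst, axisRotSnd, planeComb]
  have hbase : RadialExtension (indepPairs (Fin 3 → ℝ))
      (fun _ => ((![1, 0, 0], ![0, 1, 0]) : (Fin 3 → ℝ) × (Fin 3 → ℝ))) := by
    refine radialExtension_const ?_
    change LinearIndependent ℝ ![![1, 0, 0], ![0, 1, 0]]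
    rw [LinearIndependent.pair_iff]
    intro s t hst
    exact ⟨by simpa using congrFun hst 0, by simpa using congrFun hst 1⟩
  -- At angle `π` the axis is reversed and the two `n`-fold turns cancel; at angle `0` they add up
  -- to `2n` turns about the third axis.
  have h1 := gen n n (fun t => Real.pi * (1 - t)) (by fun_prop) (hbase.congr fun z hz => by
    have hn1 := re_sq_add_im_sq_zpow hz n
    simp only [sub_zero, mul_one, Real.sin_pi, Real.cos_pi]
    refine Prod.ext ?_ ?_ <;> ext i <;> fin_cases i <;>
      simp [axisRotFst, axisRotSnd, planeComb] <;> linarith)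
  -- At angle `0` the axes coincide and there are `k + d = n + n` turns; at `π / 2` the `d`-fold
  -- rotation is about the first axis.
  have h2 := gen k d (fun t => Real.pi / 2 * t) (by fun_prop) (h1.congr fun z hz => by
    simp only [sub_self, mul_zero, Real.sin_zero, Real.cos_zero, e0, planeComb_planeComb,
      mul_assoc]
    rw [← zpow_add₀ (hz0 z hz), ← zpow_add₀ (hz0 z hz), hn])
  refine h2.congr fun z hz => ?_
  simp only [mul_one, Real.sin_pi_div_two, Real.cos_pi_div_two]
  have e1 : axisRotFst (z ^ d) 1 0 = ![1, 0, 0] := by simp [axisRotFst]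
  have e2 : axisRotSnd (z ^ d) 1 0 = ![0, (z ^ d).re, (z ^ d).im] := by simp [axisRotSnd]
  rw [e1, e2]

end Rotation

/-! ### Extension of rotated pairs for one parity -/

section Existence

open Complex

variable {E : Type*} [NormedAddCommGroup E] [InnerProductSpace ℝ E] [FiniteDimensional ℝ E]

lemma linearIndependent_vecCons_of_complement {V : Type*} [AddCommGroup V] [Module ℝ V]
    {v : V} (hv : v ≠ 0) {C : Fin 2 → V}
    (hC : ∀ c : Fin 2 → ℝ, ∑ i, c i • C i ∈ Submodule.span ℝ {v} → c = 0) :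
    LinearIndependent ℝ ![v, C 0, C 1] := by
  rw [Fintype.linearIndependent_iff]
  intro g hg
  rw [Fin.sum_univ_three] at hg
  simp only [Matrix.cons_val_zero, Matrix.cons_val_one, Matrix.cons_val] at hg
  have h1 := hC ![g 1, g 2] (by
    rw [Submodule.mem_span_singleton]
    refine ⟨-g 0, ?_⟩
    simp only [Fin.sum_univ_two, Matrix.cons_val_zero, Matrix.cons_val_one]
    rw [neg_smul, neg_eq_iff_add_eq_zero, ← add_assoc]
    exact hg)
  have h2 : g 1 = 0 := congrFun h1 0
  have h3 : g 2 = 0 := congrFun h1 1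
  rw [h2, h3, zero_smul, zero_smul, add_zero, add_zero] at hg
  intro i
  fin_cases i
  · exact (smul_eq_zero.1 hg).resolve_right hv
  · exact h2
  · exact h3

lemma exists_coeff_of_linearIndependent {V ι : Type*} [Fintype ι] [AddCommGroup V] [Module ℝ V]
    [FiniteDimensional ℝ V] {b : ι → V} (hb : LinearIndependent ℝ b)
    (hcard : Fintype.card ι = Module.finrank ℝ V) (v : V) : ∃ c : ι → ℝ, v = ∑ i, c i • b i := by
  have : v ∈ Submodule.span ℝ (Set.range b) := by
    rw [hb.span_eq_top_of_card_eq_finrank' hcard]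
    trivial
  obtain ⟨c, hc⟩ := (Submodule.mem_span_range_iff_exists_fun ℝ).1 this
  exact ⟨c, hc.symm⟩

lemma radial_mem_disk (z : ℂ) : radial z ∈ disk := by
  by_cases hz : z = 0
  · simp [radial, hz]
  · simp [norm_radial hz]

lemma contDiffAt_comp_radial {F : Type*} [NormedAddCommGroup F] [NormedSpace ℝ F] {f : ℂ → F}
    (hf : ContDiffOn ℝ ∞ f disk) {z : ℂ} (hz : z ≠ 0) :
    ContDiffAt ℝ ∞ (fun z => f (radial z)) z := by
  rw [← contDiffWithinAt_univ]
  exact (hf _ (radial_mem_disk z)).comp z (contDiffAt_radial hz).contDiffWithinAt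
    (fun y _ => radial_mem_disk y)

/-- Let `(a₁, a₂)` be a loop of linearly independent pairs in a three-dimensional space. For all
`k` of one of the two parities, the pairs obtained by rotating `(a₁, a₂)` `k` times extend to the
disk. -/
theorem exists_disk_extension (hE : Module.finrank ℝ E = 3) {a₁ a₂ : ℂ → E}
    (h₁ : ∀ z, z ≠ 0 → ContDiffAt ℝ ∞ a₁ z) (h₂ : ∀ z, z ≠ 0 → ContDiffAt ℝ ∞ a₂ z)
    (hind : ∀ z, z ≠ 0 → LinearIndependent ℝ ![a₁ z, a₂ z]) :
    ∃ d : ℤ, ∀ k : ℤ, Even (k + d) → ∀ u w : ℂ → ℂ, RotationHomotopic k u w →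
      ∃ F G : ℂ → E, ContDiffOn ℝ ∞ F disk ∧ ContDiffOn ℝ ∞ G disk ∧
        (∀ z ∈ disk, LinearIndependent ℝ ![F z, G z]) ∧
        ∀ z, ‖z‖ = 1 → F z = planeComb (u z) (a₁ z) (a₂ z) ∧ G z = planeComb (w z) (a₁ z) (a₂ z) := by
  have hz0 : ∀ z : ℂ, ‖z‖ = 1 → z ≠ 0 := fun z hz => norm_pos_iff.1 (by rw [hz]; exact one_pos)
  -- Dimension three leaves room to fill in the loop `a₁` without zeros; the filling `V` is then
  -- completed to a frame over the disk.
  obtain ⟨V, hVs, hV0, hVb⟩ := radialExtension_ne_zero (by omega) h₁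
    (fun z hz => (hind z hz).ne_zero 0)
  obtain ⟨C, hCs, hC⟩ := exists_smooth_complement (E := E) (k := 1) (m := 2) (by omega)
    (fun _ => V) (fun _ => hVs.contDiffOn) (fun z _ => by
      rw [linearIndependent_unique_iff]
      exact hV0 z)
  let b : ℂ → Fin 3 → E := fun z => ![V z, C 0 z, C 1 z]
  have hbs : ∀ i, ContDiffOn ℝ ∞ (fun z => b z i) disk := by
    intro i
    fin_cases i
    · exact hVs.contDiffOn
    · exact hCs 0
    · exact hCs 1
  have hbi : ∀ z ∈ disk, LinearIndependent ℝ (b z) := by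
    intro z hz
    refine linearIndependent_vecCons_of_complement (C := fun i => C i z) (hV0 z) fun c hc => ?_
    refine hC z hz c ?_
    rwa [Set.range_const]
  have hcard : Fintype.card (Fin 3) = Module.finrank ℝ E := by simp [hE]
  choose c hc using fun z => exists_coeff_of_linearIndependent
    (hbi (radial z) (radial_mem_disk z)) hcard (a₂ (radial z))
  have hcs : ∀ i z, z ≠ 0 → ContDiffAt ℝ ∞ (fun z => c z i) z := by
    intro i z hz
    rw [← contMDiffAt_iff_contDiffAt, ← contMDiffWithinAt_univ]
    refine contMDiffWithinAt_coeff (b := fun i z => b (radial z) i) (Set.mem_univ z)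
      (fun i => ?_) (v := fun z => a₂ (radial z)) ?_ hcard
      (Filter.Eventually.of_forall fun z => ⟨hbi _ (radial_mem_disk z), hc z⟩) i
    · exact (contDiffAt_comp_radial (hbs i) hz).contMDiffAt.contMDiffWithinAt
    · exact ((h₂ _ (radial_ne_zero hz)).comp z
        (contDiffAt_radial hz)).contMDiffAt.contMDiffWithinAt
  -- On the circle `V = a₁`, so `y` represents `a₂` modulo `a₁` and never vanishes. Its winding
  -- number is the `d` of the statement.
  let y : ℂ → ℂ := fun z => (c z 1 : ℂ) + (c z 2 : ℂ) * I
  have hyre : ∀ z, (y z).re = c z 1 := fun z => by simp [y]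
  have hyim : ∀ z, (y z).im = c z 2 := fun z => by simp [y]
  have hV1 : ∀ z, ‖z‖ = 1 → V z = a₁ z := fun z hz => by
    rw [hVb z hz.ge, radial_of_norm_eq_one hz]
  have hys : ∀ z, z ≠ 0 → ContDiffAt ℝ ∞ y z := fun z hz =>
    (ofRealCLM.contDiff.contDiffAt.comp z (hcs 1 z hz)).add
      ((ofRealCLM.contDiff.contDiffAt.comp z (hcs 2 z hz)).mul contDiffAt_const)
  have hy0 : ∀ z, z ≠ 0 → y z ≠ 0 := by
    intro z hz h
    have e1 : c z 1 = 0 := by rw [← hyre, h, zero_re]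
    have e2 : c z 2 = 0 := by rw [← hyim, h, zero_im]
    have e := hc z
    rw [Fin.sum_univ_three, e1, e2, zero_smul, zero_smul, add_zero, add_zero] at e
    have hb0 : b (radial z) 0 = a₁ (radial z) := hV1 _ (norm_radial hz)
    rw [hb0] at e
    have := LinearIndependent.pair_iff.1 (hind _ (radial_ne_zero hz)) (-c z 0) 1
      (by rw [e]; module)
    exact one_ne_zero this.2
  obtain ⟨d, g, hgs, hyg⟩ := exists_zpow_mul_exp hys hy0
  refine ⟨d, fun k hk u w hrot => ?_⟩
  obtain ⟨U, W, hU, hW, hpos, hU0, hW0, hU1, hW1⟩ := hrot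
  -- The coordinates of `a₂` are deformed from the model `(0, z ^ d)` at `t = 0` to the true ones at
  -- `t = 1`. The last two never vanish together, so independence from `(1, 0, 0)` persists.
  let r : ℝ → ℂ → Fin 3 → ℝ := fun t z =>
    ![t * c z 0, (z ^ d * exp (t * g z)).re, (z ^ d * exp (t * g z)).im]
  have hr : ∀ t z, z ≠ 0 → ContDiffAt ℝ ∞ (Function.uncurry r) (t, z) := by
    intro t z hz
    have h3 : ContDiffAt ℝ ∞ (fun p : ℝ × ℂ => p.2 ^ d * exp (p.1 * g p.2)) (t, z) := by
      refine ContDiffAt.mul (𝕜 := ℝ) ((contDiffAt_zpow d hz).comp (t, z) contDiffAt_snd) ?_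
      refine contDiff_exp.contDiffAt.comp (t, z) ?_
      exact (ofRealCLM.contDiff.contDiffAt.comp (t, z) contDiffAt_fst).mul
        ((hgs z hz).comp (t, z) contDiffAt_snd)
    exact contDiffAt_vec3 (contDiffAt_fst.mul ((hcs 0 z hz).comp (t, z) contDiffAt_snd))
      (reCLM.contDiff.contDiffAt.comp (t, z) h3) (imCLM.contDiff.contDiffAt.comp (t, z) h3)
  have hext := RadialExtension.homotopy (S := indepPairs (Fin 3 → ℝ)) (fun t z =>
    (planeComb (U t z) ![1, 0, 0] (r t z), planeComb (W t z) ![1, 0, 0] (r t z)))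
    (fun t z hz => (contDiffAt_planeComb (hU t z hz) contDiffAt_const (hr t z hz)).prodMk
      (contDiffAt_planeComb (hW t z hz) contDiffAt_const (hr t z hz)))
    (fun t ht z hz => by
      refine linearIndependent_planeComb (hpos t ht z (hz0 z hz)) ?_
      rw [LinearIndependent.pair_iff]
      intro s s' h
      have q0 := congrFun h 0
      have q1 := congrFun h 1
      have q2 := congrFun h 2
      simp only [r, Pi.add_apply, Pi.smul_apply, Matrix.cons_val_zero, Matrix.cons_val_one,
        Matrix.cons_val, smul_eq_mul, mul_zero, zero_add, Pi.zero_apply, mul_one] at q0 q1 q2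
      have hs' : s' = 0 := by
        by_contra hne
        refine mul_ne_zero (zpow_ne_zero d (hz0 z hz)) (exp_ne_zero (t * g z)) ?_
        exact Complex.ext ((mul_eq_zero.1 q1).resolve_left hne)
          ((mul_eq_zero.1 q2).resolve_left hne)
      rw [hs', zero_mul, add_zero] at q0
      exact ⟨q0, hs'⟩)
    ((radialExtension_rotation hk).congr fun z hz => by
      simp [r, hU0 z (hz0 z hz), hW0 z (hz0 z hz)])
  obtain ⟨F, hFs, hFi, hFb⟩ := hext
  have hF1 : ContDiff ℝ ∞ (fun z => (F z).1) := contDiff_fst.comp hFs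
  have hF2 : ContDiff ℝ ∞ (fun z => (F z).2) := contDiff_snd.comp hFs
  refine ⟨fun z => ∑ i, (F z).1 i • b z i, fun z => ∑ i, (F z).2 i • b z i,
    ContDiffOn.sum fun i _ => ((contDiff_pi.1 hF1 i).contDiffOn).smul (hbs i),
    ContDiffOn.sum fun i _ => ((contDiff_pi.1 hF2 i).contDiffOn).smul (hbs i), ?_, ?_⟩
  · intro z hz
    rw [LinearIndependent.pair_iff]
    intro s t hst
    have hFz : LinearIndependent ℝ ![(F z).1, (F z).2] := hFi z
    refine LinearIndependent.pair_iff.1 hFz s t ?_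
    refine funext fun i => Fintype.linearIndependent_iff.1 (hbi z hz)
      (s • (F z).1 + t • (F z).2) ?_ i
    rw [← hst, Finset.smul_sum, Finset.smul_sum, ← Finset.sum_add_distrib]
    refine Finset.sum_congr rfl fun j _ => ?_
    rw [Pi.add_apply, Pi.smul_apply, Pi.smul_apply, smul_eq_mul, smul_eq_mul]
    module
  · intro z hz
    have hzz := hz0 z hz
    have hFz := hFb z hz.ge
    have hcz := hc z
    rw [radial_of_norm_eq_one hz] at hFz hcz
    have hr1 : r 1 z = c z := by
      have e := hyg z hzz
      ext i
      fin_cases i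
      · simp [r]
      · simp [r, ← hyre, e]
      · simp [r, ← hyim, e]
    have key : ∀ v : ℂ, ∑ i, (planeComb v ![1, 0, 0] (c z)) i • b z i =
        planeComb v (a₁ z) (a₂ z) := by
      intro v
      have hb0 : b z 0 = a₁ z := hV1 z hz
      rw [hcz, ← hb0]
      simp only [Fin.sum_univ_three, planeComb, Pi.add_apply, Pi.smul_apply, smul_eq_mul,
        Matrix.cons_val_zero, Matrix.cons_val_one, Matrix.cons_val]
      module
    simp only [hFz, hr1, hU1 z hzz, hW1 z hzz, key, and_self]

end Existence

/-! ### The parity obstruction, by spinors -/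

section Parity

open Complex

/-- The antilinear map of `ℂ²` with the symmetric matrix `(a, b; b, c)`. -/
def symmAntilinear (a b c : ℂ) : ℂ × ℂ →L[ℝ] ℂ × ℂ :=
  let K : ℂ →L[ℝ] ℂ := conjCLE.toContinuousLinearMap
  let A : ℂ × ℂ →L[ℝ] ℂ := K.comp (ContinuousLinearMap.fst ℝ ℂ ℂ)
  let B : ℂ × ℂ →L[ℝ] ℂ := K.comp (ContinuousLinearMap.snd ℝ ℂ ℂ)
  (a • A + b • B).prod (b • A + c • B)

lemma symmAntilinear_apply (a b c : ℂ) (x : ℂ × ℂ) : symmAntilinear a b c x =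
    (a * (starRingEnd ℂ) x.1 + b * (starRingEnd ℂ) x.2,
      b * (starRingEnd ℂ) x.1 + c * (starRingEnd ℂ) x.2) := rfl

/-- Vanishing determinant means that the matrix is `v vᵀ` for a spinor `v`. The antilinear map `x ↦
v vᵀ x̄` then has eigenvalues `±‖v‖²` on the real lines through `v` and `iv`, and vanishes on the
complex orthogonal complement of `v`. The scalar here is `‖v‖⁴`. -/
lemma symmAntilinear_cube {a b c : ℂ} (h : a * c = b ^ 2) (x : ℂ × ℂ) :
    symmAntilinear a b c (symmAntilinear a b c (symmAntilinear a b c x)) =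
      (normSq a + 2 * normSq b + normSq c) • symmAntilinear a b c x := by
  have ha := mul_conj a
  have hb := mul_conj b
  have hc := mul_conj c
  refine Prod.ext ?_ ?_
  · simp only [symmAntilinear_apply, map_add, map_mul, conj_conj, Prod.smul_mk, real_smul,
      ofReal_add, ofReal_mul, ofReal_ofNat, ← ha, ← hb, ← hc]
    linear_combination (-(starRingEnd ℂ) c * (starRingEnd ℂ) x.1
      + (starRingEnd ℂ) b * (starRingEnd ℂ) x.2) * h
  · simp only [symmAntilinear_apply, map_add, map_mul, conj_conj, Prod.smul_mk, real_smul,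
      ofReal_add, ofReal_mul, ofReal_ofNat, ← ha, ← hb, ← hc]
    linear_combination ((starRingEnd ℂ) b * (starRingEnd ℂ) x.1
      - (starRingEnd ℂ) a * (starRingEnd ℂ) x.2) * h

lemma continuousOn_symmAntilinear {a b c : ℂ → ℂ} {s : Set ℂ} (ha : ContinuousOn a s)
    (hb : ContinuousOn b s) (hc : ContinuousOn c s) :
    ContinuousOn (fun z => symmAntilinear (a z) (b z) (c z)) s := by
  have e : ∀ z, symmAntilinear (a z) (b z) (c z) =
      (ContinuousLinearMap.inl ℝ ℂ ℂ).comp (a z • conjCLE.toContinuousLinearMap.comp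
        (ContinuousLinearMap.fst ℝ ℂ ℂ) + b z • conjCLE.toContinuousLinearMap.comp
        (ContinuousLinearMap.snd ℝ ℂ ℂ)) +
      (ContinuousLinearMap.inr ℝ ℂ ℂ).comp (b z • conjCLE.toContinuousLinearMap.comp
        (ContinuousLinearMap.fst ℝ ℂ ℂ) + c z • conjCLE.toContinuousLinearMap.comp
        (ContinuousLinearMap.snd ℝ ℂ ℂ)) := by
    intro z
    refine ContinuousLinearMap.ext fun x => ?_
    refine Prod.ext ?_ ?_ <;> simp [symmAntilinear_apply]
  simp only [e]
  exact (continuousOn_const.clm_comp ((ha.smul continuousOn_const).add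
    (hb.smul continuousOn_const))).add (continuousOn_const.clm_comp
    ((hb.smul continuousOn_const).add (hc.smul continuousOn_const)))

/-- A continuous family of operators over the disk with `T ^ 3 = l ^ 2 T`, for which `l` is an
eigenvalue at the origin, has a continuous nowhere vanishing field of eigenvectors. -/
theorem exists_eigenvector_field {F : Type*} [NormedAddCommGroup F] [NormedSpace ℝ F]
    {T : ℂ → F →L[ℝ] F} {l : ℂ → ℝ} (hT : ContinuousOn T disk) (hl : ContinuousOn l disk)
    (hl0 : ∀ z ∈ disk, l z ≠ 0) (hcube : ∀ z ∈ disk, ∀ x, T z (T z (T z x)) = (l z ^ 2) • T z x)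
    {x₀ : F} (hx₀ : T 0 (T 0 x₀) + l 0 • T 0 x₀ ≠ 0) :
    ∃ q : ℂ → F, ContinuousOn q disk ∧ ∀ z ∈ disk, q z ≠ 0 ∧ T z (q z) = l z • q z := by
  -- The polynomial `x² / 2l² + x / 2l` is `1` at `l` and `0` at `-l` and `0`, so `Q` is the
  -- projection onto the eigenspace of `l`. Transporting a vector of the central eigenspace gives
  -- the field.
  let Q : ℂ → F →L[ℝ] F := fun z => (2 * l z ^ 2)⁻¹ • (T z).comp (T z) + (2 * l z)⁻¹ • T z
  have hQap : ∀ z x, Q z x = (2 * l z ^ 2)⁻¹ • T z (T z x) + (2 * l z)⁻¹ • T z x :=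
    fun z x => rfl
  have c1 : ContinuousOn (fun z => (2 * l z ^ 2)⁻¹) disk :=
    (continuousOn_const.mul (hl.pow 2)).inv₀ fun z hz =>
      mul_ne_zero two_ne_zero (pow_ne_zero 2 (hl0 z hz))
  have c2 : ContinuousOn (fun z => (2 * l z)⁻¹) disk :=
    (continuousOn_const.mul hl).inv₀ fun z hz => mul_ne_zero two_ne_zero (hl0 z hz)
  have hQ : ContinuousOn Q disk := (c1.smul (hT.clm_comp hT)).add (c2.smul hT)
  have hTQ : ∀ z ∈ disk, ∀ x, T z (Q z x) = l z • Q z x := by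
    intro z hz x
    have h0 := hl0 z hz
    simp only [hQap, map_add, map_smul, hcube z hz, smul_add, smul_smul]
    have e1 : (2 * l z ^ 2)⁻¹ * l z ^ 2 = l z * (2 * l z)⁻¹ := by field_simp
    have e2 : l z * (2 * l z ^ 2)⁻¹ = (2 * l z)⁻¹ := by field_simp
    rw [e1, e2, add_comm]
  have hidem : ∀ z ∈ disk, ∀ x, Q z (Q z x) = Q z x := by
    intro z hz x
    have h0 := hl0 z hz
    rw [hQap z (Q z x), hTQ z hz, map_smul, hTQ z hz, smul_smul, smul_smul, smul_smul, ← add_smul]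
    have e : (2 * l z ^ 2)⁻¹ * (l z * l z) + (2 * l z)⁻¹ * l z = 1 := by
      field_simp; norm_num
    rw [← mul_assoc] at e
    rw [e, one_smul]
  obtain ⟨P, hPc, -, hP⟩ := exists_transport_of_idempotent Q hQ hidem
  have h0d : (0 : ℂ) ∈ disk := by simp
  have hq₀ : Q 0 x₀ ≠ 0 := by
    intro h
    have h0 := hl0 0 h0d
    refine hx₀ ?_
    have h2 := congrArg (fun y => (2 * l 0 ^ 2) • y) h
    simp only [hQap, smul_add, smul_smul, smul_zero] at h2
    have e1 : 2 * l 0 ^ 2 * (2 * l 0 ^ 2)⁻¹ = 1 := by field_simp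
    have e2 : 2 * l 0 ^ 2 * (2 * l 0)⁻¹ = l 0 := by field_simp
    rwa [e1, e2, one_smul] at h2
  refine ⟨fun z => P z (Q 0 x₀), hPc.clm_apply continuousOn_const, fun z hz => ⟨fun h => ?_, ?_⟩⟩
  · exact hq₀ ((hP z hz).2 _ (hidem 0 h0d x₀) h)
  · have h1 := hTQ z hz (P z (Q 0 x₀))
    rwa [(hP z hz).1] at h1

/-- By antilinearity, multiplication by `I` exchanges the eigenvalues `l` and `-l`. If `T² + lT`
vanished, so would `T² - lT`, hence `T` and all its entries. -/
lemma exists_symmAntilinear_add_ne_zero {a b c : ℂ} {l : ℝ}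
    (hne : 0 < normSq a + 2 * normSq b + normSq c) (hl : l ≠ 0) :
    ∃ x, symmAntilinear a b c (symmAntilinear a b c x) + l • symmAntilinear a b c x ≠ 0 := by
  by_contra! hcon
  have hTI : ∀ x, symmAntilinear a b c (I • x) = -(I • symmAntilinear a b c x) := by
    intro x
    refine Prod.ext ?_ ?_ <;> simp [symmAntilinear_apply] <;> ring
  have hT0 : ∀ x, symmAntilinear a b c x = 0 := by
    intro x
    have h1 := hcon (I • x)
    rw [hTI, map_neg, hTI, neg_neg, eq_neg_of_add_eq_zero_left (hcon x)] at h1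
    have h2 : (-(2 * l)) • (I • symmAntilinear a b c x) = 0 := by
      rw [← h1, smul_neg, smul_neg, smul_comm I l]
      module
    have h3 := (smul_eq_zero.1 h2).resolve_left (neg_ne_zero.2 (mul_ne_zero two_ne_zero hl))
    exact (smul_eq_zero.1 h3).resolve_left I_ne_zero
  have hv1 := hT0 (1, 0)
  have hv2 := hT0 (0, 1)
  simp only [symmAntilinear_apply, map_one, map_zero, mul_one, mul_zero, add_zero, zero_add,
    Prod.mk_eq_zero] at hv1 hv2
  simp [hv1.1, hv1.2, hv2.2] at hne

/-- A continuous nowhere vanishing family over the disk of symmetric complex matrices of rank one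
has even winding number on the boundary, since it is the square of a spinor field. -/
theorem even_of_symm_rank_one {a b c : ℂ → ℂ} (ha : ContinuousOn a disk) (hb : ContinuousOn b disk)
    (hc : ContinuousOn c disk) (hdet : ∀ z ∈ disk, a z * c z = b z ^ 2)
    (hne : ∀ z ∈ disk, 0 < normSq (a z) + 2 * normSq (b z) + normSq (c z)) {m : ℤ}
    (hbd : ∀ z : ℂ, ‖z‖ = 1 → b z = 0 ∧ c z = 0 ∧
      ∃ ρ : ℝ, 0 < ρ ∧ a z = ρ * (starRingEnd ℂ) (z ^ m)) : Even m := by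
  have hl : ContinuousOn
      (fun z => Real.sqrt (normSq (a z) + 2 * normSq (b z) + normSq (c z))) disk := by
    refine Real.continuous_sqrt.comp_continuousOn ?_
    exact ((continuous_normSq.comp_continuousOn ha).add (continuousOn_const.mul
      (continuous_normSq.comp_continuousOn hb))).add (continuous_normSq.comp_continuousOn hc)
  have h0d : (0 : ℂ) ∈ disk := by simp
  obtain ⟨x₀, hx₀⟩ := exists_symmAntilinear_add_ne_zero (hne 0 h0d)
    (Real.sqrt_pos.2 (hne 0 h0d)).ne'
  -- Up to real factors, `q` is a continuous choice over the disk of the spinor whose square is the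
  -- matrix.
  obtain ⟨q, hqc, hq⟩ := exists_eigenvector_field (continuousOn_symmAntilinear ha hb hc) hl
    (fun z hz => (Real.sqrt_pos.2 (hne z hz)).ne') (fun z hz x => by
      rw [Real.sq_sqrt (hne z hz).le]
      exact symmAntilinear_cube (hdet z hz) x) hx₀
  have hmem : ∀ θ : ℝ, exp (θ * I) ∈ disk := fun θ => by simp [norm_exp_ofReal_mul_I]
  let x : ℝ → ℂ := fun θ => (q (exp (θ * I))).1
  have hxc : Continuous x :=
    continuous_fst.comp (hqc.comp_continuous (by fun_prop) hmem)
  -- On the boundary the operator is `(x, y) ↦ (ρ z̄ᵐ x̄, 0)`. An eigenvector for `ρ` is therefore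
  -- `(x, 0)` with `x = z̄ᵐ x̄`, so that `exp(imθ/2) x` is real.
  have hx : ∀ θ : ℝ, x θ ≠ 0 ∧ x θ = exp (-(m * (θ * I))) * (starRingEnd ℂ) (x θ) := by
    intro θ
    obtain ⟨hne0, hfix⟩ := hq _ (hmem θ)
    obtain ⟨hb0, hc0, ρ, hρ, haρ⟩ := hbd _ (norm_exp_ofReal_mul_I θ)
    have hτ : (starRingEnd ℂ) (exp (θ * I) ^ m) = exp (-(m * (θ * I))) := by
      rw [← exp_int_mul, ← exp_conj]
      simp
    rw [hτ] at haρ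
    have hτ1 : normSq (exp (-(m * (θ * I)))) = 1 := by
      have : -(m * (θ * I)) = ((-(m * θ) : ℝ) : ℂ) * I := by push_cast; ring
      rw [normSq_eq_norm_sq, this, norm_exp_ofReal_mul_I, one_pow]
    have hρ0 : (ρ : ℂ) ≠ 0 := by exact_mod_cast hρ.ne'
    simp only [haρ, hb0, hc0, map_mul, hτ1, normSq_ofReal, map_zero, mul_zero, add_zero, mul_one,
      Real.sqrt_mul_self hρ.le, symmAntilinear_apply, zero_mul] at hfix
    have f1 := congrArg Prod.fst hfix
    have f2 := congrArg Prod.snd hfix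
    simp only [Prod.smul_fst, Prod.smul_snd, real_smul] at f1 f2
    have hx0 : x θ ≠ 0 := fun h => hne0 (Prod.ext h ((mul_eq_zero.1 f2.symm).resolve_left hρ0))
    refine ⟨hx0, mul_left_cancel₀ hρ0 ?_⟩
    rw [← mul_assoc]
    exact f1.symm
  have hf : ∀ θ : ℝ, (exp (m * (θ * I) / 2) * x θ).im = 0 ∧
      (exp (m * (θ * I) / 2) * x θ) ≠ 0 := by
    intro θ
    obtain ⟨h1, h2⟩ := hx θ
    refine ⟨?_, mul_ne_zero (exp_ne_zero _) h1⟩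
    rw [← conj_eq_iff_im, map_mul]
    conv_rhs => rw [h2, ← mul_assoc, ← exp_add]
    congr 1
    rw [← exp_conj]
    congr 1
    have hc2 : (starRingEnd ℂ) (2 : ℂ) = 2 := map_ofNat _ 2
    simp only [map_div₀, map_mul, conj_ofReal, conj_I, hc2, map_intCast]
    ring
  by_contra hodd
  rw [Int.not_even_iff_odd] at hodd
  -- For odd `m` this nowhere vanishing real function would change sign over one turn.
  let f : ℝ → ℝ := fun θ => (exp (m * (θ * I) / 2) * x θ).re
  have hfc : Continuous f := by fun_prop
  have hf0 : ∀ θ, f θ ≠ 0 := fun θ h => (hf θ).2 (Complex.ext h (hf θ).1)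
  have hf2 : f (2 * Real.pi) = - f 0 := by
    have e1 : exp (m * (((2 * Real.pi : ℝ) : ℂ) * I) / 2) = -1 := by
      have : (m * (((2 * Real.pi : ℝ) : ℂ) * I) / 2) = m * (Real.pi * I) := by push_cast; ring
      rw [this, exp_int_mul, exp_pi_mul_I, hodd.neg_one_zpow]
    have e2 : x (2 * Real.pi) = x 0 := by
      simp only [x]
      have : exp (((2 * Real.pi : ℝ) : ℂ) * I) = exp (((0 : ℝ) : ℂ) * I) := by
        push_cast
        rw [exp_two_pi_mul_I]; simp
      rw [this]
    simp only [f, e1, e2]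
    simp
  have h1 : (0 : ℝ) ∈ Set.uIcc (f 0) (f (2 * Real.pi)) := by
    rw [hf2, Set.mem_uIcc]
    rcases le_total 0 (f 0) with h | h
    · right; constructor <;> linarith
    · left; constructor <;> linarith
  obtain ⟨θ, -, hθ⟩ := intermediate_value_uIcc (hfc.continuousOn) h1
  exact hf0 θ hθ

open Matrix in
/-- If the loop which rotates the standard basis `m` times about the third axis extends to the
disk as a family of linearly independent pairs in `ℝ³`, then `m` is even. -/
theorem even_of_linearIndependent_disk {c₁ c₂ : ℂ → Fin 3 → ℝ} (h₁ : ContinuousOn c₁ disk)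
    (h₂ : ContinuousOn c₂ disk) (hind : ∀ z ∈ disk, LinearIndependent ℝ ![c₁ z, c₂ z]) {m : ℤ}
    (hbd : ∀ z : ℂ, ‖z‖ = 1 → ∃ μ : ℝ, 0 < μ ∧ c₁ z = μ • planeComb (z ^ m) ![1, 0, 0] ![0, 1, 0] ∧
      c₂ z = μ • planeComb (I * z ^ m) ![1, 0, 0] ![0, 1, 0]) : Even m := by
  -- Gram–Schmidt without division.
  let e : ℂ → Fin 3 → ℝ := fun z => (c₁ z ⬝ᵥ c₁ z) • c₂ z - (c₁ z ⬝ᵥ c₂ z) • c₁ z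
  have hc1 : ∀ i, ContinuousOn (fun z => c₁ z i) disk := fun i => (continuousOn_pi.1 h₁) i
  have hc2 : ∀ i, ContinuousOn (fun z => c₂ z i) disk := fun i => (continuousOn_pi.1 h₂) i
  have hdot : ∀ {f g : ℂ → Fin 3 → ℝ}, (∀ i, ContinuousOn (fun z => f z i) disk) →
      (∀ i, ContinuousOn (fun z => g z i) disk) → ContinuousOn (fun z => f z ⬝ᵥ g z) disk :=
    fun hf hg => by
      simp only [dotProduct, Fin.sum_univ_three]
      exact (((hf 0).mul (hg 0)).add ((hf 1).mul (hg 1))).add ((hf 2).mul (hg 2))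
  have hec : ∀ i, ContinuousOn (fun z => e z i) disk := fun i =>
    ((hdot hc1 hc1).mul (hc2 i)).sub ((hdot hc1 hc2).mul (hc1 i))
  have horth : ∀ z, c₁ z ⬝ᵥ e z = 0 := fun z => by
    simp only [e, dotProduct_sub, dotProduct_smul, smul_eq_mul]
    ring
  have hpos : ∀ v : Fin 3 → ℝ, v ≠ 0 → 0 < v ⬝ᵥ v := fun v hv =>
    lt_of_le_of_ne (Finset.sum_nonneg fun i _ => mul_self_nonneg (v i)) fun h => hv (dotProduct_self_eq_zero.1 h.symm)
  have hn1 : ∀ z ∈ disk, 0 < c₁ z ⬝ᵥ c₁ z := fun z hz => hpos _ ((hind z hz).ne_zero 0)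
  have hne : ∀ z ∈ disk, 0 < e z ⬝ᵥ e z := by
    intro z hz
    refine hpos _ fun h => (hn1 z hz).ne' ?_
    refine (LinearIndependent.pair_iff.1 (hind z hz) (-(c₁ z ⬝ᵥ c₂ z)) (c₁ z ⬝ᵥ c₁ z) ?_).2
    rw [← h]
    simp only [e]
    module
  -- Real and imaginary parts are orthogonal and scaled to equal length, so `w` is isotropic.
  let w : Fin 3 → ℂ → ℂ := fun i z =>
    ((Real.sqrt (e z ⬝ᵥ e z) * c₁ z i : ℝ) : ℂ) + ((Real.sqrt (c₁ z ⬝ᵥ c₁ z) * e z i : ℝ) : ℂ) * I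
  have hwc : ∀ i, ContinuousOn (w i) disk := fun i =>
    (continuous_ofReal.comp_continuousOn ((hdot hec hec).sqrt.mul (hc1 i))).add
      ((continuous_ofReal.comp_continuousOn ((hdot hc1 hc1).sqrt.mul (hec i))).mul
        continuousOn_const)
  have hiso : ∀ z ∈ disk, w 0 z ^ 2 + w 1 z ^ 2 + w 2 z ^ 2 = 0 := by
    intro z hz
    have q1 := Real.sq_sqrt (hn1 z hz).le
    have q2 := Real.sq_sqrt (hne z hz).le
    have q3 := horth z
    simp only [dotProduct, Fin.sum_univ_three] at q3
    refine Complex.ext ?_ ?_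
    · have e1 : (w 0 z ^ 2 + w 1 z ^ 2 + w 2 z ^ 2).re =
          Real.sqrt (e z ⬝ᵥ e z) ^ 2 * (c₁ z ⬝ᵥ c₁ z) -
            Real.sqrt (c₁ z ⬝ᵥ c₁ z) ^ 2 * (e z ⬝ᵥ e z) := by
        simp [w, pow_two, dotProduct, Fin.sum_univ_three]
        ring
      rw [e1, q1, q2, zero_re]
      ring
    · have e1 : (w 0 z ^ 2 + w 1 z ^ 2 + w 2 z ^ 2).im =
          2 * Real.sqrt (e z ⬝ᵥ e z) * Real.sqrt (c₁ z ⬝ᵥ c₁ z) *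
          (c₁ z 0 * e z 0 + c₁ z 1 * e z 1 + c₁ z 2 * e z 2) := by
        simp [w, pow_two]
        ring
      rw [e1, q3, mul_zero, zero_im]
  -- Isotropic vectors of `ℂ³` correspond to symmetric matrices of determinant zero; this is the
  -- spinor double covering of `SO(3)` in coordinates. On the boundary `w = μ⁴ z̄ᵐ (1, i, 0)`, so
  -- only the first entry survives.
  refine even_of_symm_rank_one (a := fun z => w 0 z - I * w 1 z) (b := fun z => -w 2 z)
    (c := fun z => -(w 0 z + I * w 1 z)) ((hwc 0).sub (continuousOn_const.mul (hwc 1)))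
    (hwc 2).neg ((hwc 0).add (continuousOn_const.mul (hwc 1))).neg ?_ ?_ (m := m) ?_
  · intro z hz
    linear_combination -hiso z hz + w 1 z ^ 2 * I_sq
  · intro z hz
    have e1 : normSq (w 0 z - I * w 1 z) + 2 * normSq (-w 2 z) + normSq (-(w 0 z + I * w 1 z)) =
        2 * (normSq (w 0 z) + normSq (w 1 z) + normSq (w 2 z)) := by
      simp only [normSq_apply]
      simp
      ring
    have e2 : normSq (w 0 z) + normSq (w 1 z) + normSq (w 2 z) =
        2 * ((e z ⬝ᵥ e z) * (c₁ z ⬝ᵥ c₁ z)) := by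
      have q1 := Real.sq_sqrt (hn1 z hz).le
      have q2 := Real.sq_sqrt (hne z hz).le
      have : normSq (w 0 z) + normSq (w 1 z) + normSq (w 2 z) =
          Real.sqrt (e z ⬝ᵥ e z) ^ 2 * (c₁ z ⬝ᵥ c₁ z) +
            Real.sqrt (c₁ z ⬝ᵥ c₁ z) ^ 2 * (e z ⬝ᵥ e z) := by
        simp [w, normSq_apply, dotProduct, Fin.sum_univ_three]
        ring
      rw [this, q1, q2]
      ring
    rw [e1, e2]
    have := mul_pos (hne z hz) (hn1 z hz)
    linarith
  · intro z hz
    obtain ⟨μ, hμ, k1, k2⟩ := hbd z hz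
    have hτ := re_sq_add_im_sq_zpow hz m
    have c10 : c₁ z 0 = μ * (z ^ m).re := by rw [k1]; simp [planeComb]
    have c11 : c₁ z 1 = μ * (z ^ m).im := by rw [k1]; simp [planeComb]
    have c12 : c₁ z 2 = 0 := by rw [k1]; simp [planeComb]
    have c20 : c₂ z 0 = -(μ * (z ^ m).im) := by rw [k2]; simp [planeComb]
    have c21 : c₂ z 1 = μ * (z ^ m).re := by rw [k2]; simp [planeComb]
    have c22 : c₂ z 2 = 0 := by rw [k2]; simp [planeComb]
    have n1 : c₁ z ⬝ᵥ c₁ z = μ ^ 2 := by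
      simp only [dotProduct, Fin.sum_univ_three, c10, c11, c12]
      linear_combination μ ^ 2 * hτ
    have n12 : c₁ z ⬝ᵥ c₂ z = 0 := by
      simp only [dotProduct, Fin.sum_univ_three, c10, c11, c12, c20, c21, c22]
      ring
    have he : ∀ i, e z i = μ ^ 2 * c₂ z i := fun i => by simp [e, n1, n12]
    have n2 : e z ⬝ᵥ e z = (μ ^ 3) ^ 2 := by
      simp only [dotProduct, Fin.sum_univ_three, he, c20, c21, c22]
      linear_combination μ ^ 6 * hτ
    have hw : ∀ i, w i z = (μ ^ 3 : ℝ) * ((c₁ z i : ℂ) + (c₂ z i : ℂ) * I) := fun i => by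
      simp only [w, n1, n2, he]
      rw [Real.sqrt_sq (by positivity), Real.sqrt_sq hμ.le]
      push_cast
      ring
    have hconj : (starRingEnd ℂ) (z ^ m) = (z ^ m).re - (z ^ m).im * I := by
      refine Complex.ext ?_ ?_ <;> simp only [conj_re, conj_im] <;> simp [-map_zpow₀]
    refine ⟨by simp [hw, c12, c22], ?_, 2 * μ ^ 4, by positivity, ?_⟩
    · simp only [hw, c10, c11, c20, c21]
      push_cast
      linear_combination -(μ : ℂ) ^ 4 * (z ^ m).re * I_sq
    · simp only [hw, c10, c11, c20, c21, hconj]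
      push_cast
      linear_combination -(μ : ℂ) ^ 4 * (z ^ m).re * I_sq

open Matrix in
/-- Up to a positive factor, the coordinates of `v` in the basis `(f, g, f × g)`. -/
def crossCoords (f g v : Fin 3 → ℝ) : Fin 3 → ℝ :=
  ![v ⬝ᵥ (g ⨯₃ (f ⨯₃ g)), v ⬝ᵥ ((f ⨯₃ g) ⨯₃ f), v ⬝ᵥ (f ⨯₃ g)]

lemma continuous_crossCoords : Continuous (fun p : (Fin 3 → ℝ) × (Fin 3 → ℝ) × (Fin 3 → ℝ) =>
    crossCoords p.1 p.2.1 p.2.2) := by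
  refine continuous_pi fun i => ?_
  fin_cases i <;> simp [crossCoords, cross_apply, dotProduct, Fin.sum_univ_three] <;> fun_prop

lemma crossCoords_smul_add (f g v w : Fin 3 → ℝ) (s t : ℝ) :
    crossCoords f g (s • v + t • w) = s • crossCoords f g v + t • crossCoords f g w := by
  ext i
  fin_cases i <;> simp [crossCoords]

-- Up to the factor `|f × g|²`, the vectors `g × (f × g)`, `(f × g) × f` and `f × g` form the basis
-- dual to `f`, `g`, `f × g`.
open Matrix in
lemma crossCoords_fst_snd (f g : Fin 3 → ℝ) :
    crossCoords f g f = ((f ⨯₃ g) ⬝ᵥ (f ⨯₃ g)) • ![1, 0, 0] ∧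
      crossCoords f g g = ((f ⨯₃ g) ⬝ᵥ (f ⨯₃ g)) • ![0, 1, 0] := by
  constructor <;> ext i <;> fin_cases i <;>
    simp [crossCoords, cross_apply, dotProduct, Fin.sum_univ_three] <;> ring

open Matrix in
lemma eq_zero_of_crossCoords_eq_zero {f g v : Fin 3 → ℝ} (hfg : LinearIndependent ℝ ![f, g])
    (h : crossCoords f g v = 0) : v = 0 := by
  have h0 : v ⬝ᵥ (g ⨯₃ (f ⨯₃ g)) = 0 := congrFun h 0
  have h1 : v ⬝ᵥ ((f ⨯₃ g) ⨯₃ f) = 0 := congrFun h 1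
  have h2 : v ⬝ᵥ (f ⨯₃ g) = 0 := congrFun h 2
  have hN : (f ⨯₃ g) ⬝ᵥ (f ⨯₃ g) ≠ 0 := fun h =>
    crossProduct_ne_zero_iff_linearIndependent.2 hfg (dotProduct_self_eq_zero.1 h)
  have key : ((f ⨯₃ g) ⬝ᵥ (f ⨯₃ g)) • v = (v ⬝ᵥ (g ⨯₃ (f ⨯₃ g))) • f +
      (v ⬝ᵥ ((f ⨯₃ g) ⨯₃ f)) • g + (v ⬝ᵥ (f ⨯₃ g)) • (f ⨯₃ g) := by
    ext i
    fin_cases i <;> simp [cross_apply, dotProduct, Fin.sum_univ_three] <;> ring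
  rw [h0, h1, h2, zero_smul, zero_smul, zero_smul, add_zero, add_zero] at key
  exact (smul_eq_zero.1 key).resolve_left hN

open Matrix in
/-- If a loop of linearly independent pairs in `ℝ³` extends to the disk both before and after it
has been rotated `m` times, then `m` is even. -/
theorem even_of_disk_extensions {F G F' G' : ℂ → Fin 3 → ℝ} (hF : ContinuousOn F disk)
    (hG : ContinuousOn G disk) (hF' : ContinuousOn F' disk) (hG' : ContinuousOn G' disk)
    (hi : ∀ z ∈ disk, LinearIndependent ℝ ![F z, G z])
    (hi' : ∀ z ∈ disk, LinearIndependent ℝ ![F' z, G' z]) {m : ℤ}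
    (hbd : ∀ z : ℂ, ‖z‖ = 1 → F' z = planeComb (z ^ m) (F z) (G z) ∧
      G' z = planeComb (I * z ^ m) (F z) (G z)) : Even m := by
  -- In the moving frame `(F, G, F × G)`, defined over the whole disk, the first pair is constant up
  -- to a positive factor. The second pair then becomes the `m`-fold model loop on the boundary.
  refine even_of_linearIndependent_disk (c₁ := fun z => crossCoords (F z) (G z) (F' z))
    (c₂ := fun z => crossCoords (F z) (G z) (G' z))
    (continuous_crossCoords.comp_continuousOn (hF.prodMk (hG.prodMk hF')))
    (continuous_crossCoords.comp_continuousOn (hF.prodMk (hG.prodMk hG'))) ?_ (m := m) ?_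
  · intro z hz
    rw [LinearIndependent.pair_iff]
    intro s t hst
    rw [← crossCoords_smul_add] at hst
    exact LinearIndependent.pair_iff.1 (hi' z hz) s t
      (eq_zero_of_crossCoords_eq_zero (hi z hz) hst)
  · intro z hz
    have hzd : z ∈ disk := by simp [hz]
    obtain ⟨h1, h2⟩ := hbd z hz
    have hN : 0 < (F z ⨯₃ G z) ⬝ᵥ (F z ⨯₃ G z) :=
      lt_of_le_of_ne (Finset.sum_nonneg fun i _ => mul_self_nonneg _) fun h =>
        crossProduct_ne_zero_iff_linearIndependent.2 (hi z hzd) (dotProduct_self_eq_zero.1 h.symm)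
    refine ⟨_, hN, ?_, ?_⟩
    · rw [h1, planeComb, crossCoords_smul_add, (crossCoords_fst_snd _ _).1,
        (crossCoords_fst_snd _ _).2, planeComb]
      module
    · rw [h2, planeComb, crossCoords_smul_add, (crossCoords_fst_snd _ _).1,
        (crossCoords_fst_snd _ _).2, planeComb]
      module

/-- If a loop of linearly independent pairs in `ℝ³` extends to the disk after it has been changed
by loops which are homotopic to the `k`-fold and the `l`-fold rotation, then `k` and `l` have the
same parity. -/
theorem even_sub_of_disk_extensions {a₁ a₂ : ℂ → Fin 3 → ℝ}
    (h₁ : ∀ z, z ≠ 0 → ContinuousAt a₁ z) (h₂ : ∀ z, z ≠ 0 → ContinuousAt a₂ z)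
    (hind : ∀ z, z ≠ 0 → LinearIndependent ℝ ![a₁ z, a₂ z]) {k l : ℤ} {u w u' w' : ℂ → ℂ}
    (hk : RotationHomotopic k u w) (hl : RotationHomotopic l u' w') {F G F' G' : ℂ → Fin 3 → ℝ}
    (hF : ContinuousOn F disk) (hG : ContinuousOn G disk) (hF' : ContinuousOn F' disk)
    (hG' : ContinuousOn G' disk) (hi : ∀ z ∈ disk, LinearIndependent ℝ ![F z, G z])
    (hi' : ∀ z ∈ disk, LinearIndependent ℝ ![F' z, G' z])
    (hb : ∀ z : ℂ, ‖z‖ = 1 → F z = planeComb (u z) (a₁ z) (a₂ z) ∧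
      G z = planeComb (w z) (a₁ z) (a₂ z))
    (hb' : ∀ z : ℂ, ‖z‖ = 1 → F' z = planeComb (u' z) (a₁ z) (a₂ z) ∧
      G' z = planeComb (w' z) (a₁ z) (a₂ z)) : Even (l - k) := by
  have hz0 : ∀ z : ℂ, ‖z‖ = 1 → z ≠ 0 := fun z hz => norm_pos_iff.1 (by rw [hz]; exact one_pos)
  have hcont : ∀ {M : Type} [NormedAddCommGroup M] {v : M → ℂ} {p q : M → Fin 3 → ℝ} {x : M},
      ContinuousAt v x → ContinuousAt p x → ContinuousAt q x →
      ContinuousAt (fun y => planeComb (v y) (p y) (q y)) x := fun hv hp hq =>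
    ((continuous_re.continuousAt.comp hv).smul hp).add ((continuous_im.continuousAt.comp hv).smul hq)
  -- A collar in which the homotopy runs backwards replaces the boundary values given by `(u, w)` by
  -- the exact `k`-fold rotation.
  have norm : ∀ {k : ℤ} {u w : ℂ → ℂ}, RotationHomotopic k u w → ∀ {F G : ℂ → Fin 3 → ℝ},
      ContinuousOn F disk → ContinuousOn G disk →
      (∀ z ∈ disk, LinearIndependent ℝ ![F z, G z]) →
      (∀ z : ℂ, ‖z‖ = 1 → F z = planeComb (u z) (a₁ z) (a₂ z) ∧
        G z = planeComb (w z) (a₁ z) (a₂ z)) →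
      ∃ P : ℂ → (Fin 3 → ℝ) × (Fin 3 → ℝ), ContinuousOn P disk ∧
        (∀ z ∈ disk, P z ∈ indepPairs (Fin 3 → ℝ)) ∧
        ∀ z, ‖z‖ = 1 → P z = (planeComb (z ^ k) (a₁ z) (a₂ z),
          planeComb (I * z ^ k) (a₁ z) (a₂ z)) := by
    rintro k u w ⟨U, W, hU, hW, hpos, hU0, hW0, hU1, hW1⟩ F G hF hG hi hb
    obtain ⟨P, hP, hPi, hPb⟩ := exists_continuousOn_disk_of_homotopy
      (S := indepPairs (Fin 3 → ℝ)) (fun t z =>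
        (planeComb (U (1 - t) z) (a₁ z) (a₂ z), planeComb (W (1 - t) z) (a₁ z) (a₂ z)))
      (fun t z hz => by
        have hm : ContinuousAt (fun p : ℝ × ℂ => (1 - p.1, p.2)) (t, z) := by fun_prop
        have hU' : ContinuousAt (fun p : ℝ × ℂ => U (1 - p.1) p.2) (t, z) :=
          ContinuousAt.comp (g := Function.uncurry U) (f := fun p : ℝ × ℂ => (1 - p.1, p.2))
            (x := (t, z)) (hU (1 - t) z hz).continuousAt hm
        have hW' : ContinuousAt (fun p : ℝ × ℂ => W (1 - p.1) p.2) (t, z) :=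
          ContinuousAt.comp (g := Function.uncurry W) (f := fun p : ℝ × ℂ => (1 - p.1, p.2))
            (x := (t, z)) (hW (1 - t) z hz).continuousAt hm
        have ha : ContinuousAt (fun p : ℝ × ℂ => a₁ p.2) (t, z) :=
          ContinuousAt.comp (g := a₁) (h₁ z hz) continuousAt_snd
        have ha' : ContinuousAt (fun p : ℝ × ℂ => a₂ p.2) (t, z) :=
          ContinuousAt.comp (g := a₂) (h₂ z hz) continuousAt_snd
        exact (hcont hU' ha ha').prodMk (hcont hW' ha ha'))
      (fun t ht z hz => linearIndependent_planeComb
        (hpos (1 - t) ⟨by linarith [ht.2], by linarith [ht.1]⟩ z (hz0 z hz)) (hind z (hz0 z hz)))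
      (F := fun z => (F z, G z)) (hF.prodMk hG) hi (fun z hz => by
        simp only [sub_zero, hU1 z (hz0 z hz), hW1 z (hz0 z hz), (hb z hz).1, (hb z hz).2])
    refine ⟨P, hP, hPi, fun z hz => ?_⟩
    rw [hPb z hz]
    simp only [sub_self, hU0 z (hz0 z hz), hW0 z (hz0 z hz)]
  obtain ⟨P, hP, hPi, hPb⟩ := norm hk hF hG hi hb
  obtain ⟨P', hP', hPi', hPb'⟩ := norm hl hF' hG' hi' hb'
  refine even_of_disk_extensions (continuous_fst.comp_continuousOn hP)
    (continuous_snd.comp_continuousOn hP) (continuous_fst.comp_continuousOn hP')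
    (continuous_snd.comp_continuousOn hP') hPi hPi' fun z hz => ?_
  have hzz := hz0 z hz
  simp only [Function.comp_apply, hPb z hz, hPb' z hz, planeComb_planeComb, mul_assoc]
  rw [← zpow_add₀ hzz, sub_add_cancel]
  exact ⟨rfl, rfl⟩

end Parity

/-! ### Differentials of immersions -/

section Immersion

open OpenPartialHomeomorph

/-- The differential of an immersion is injective. -/
theorem mfderiv_injective_of_isImmersionAt {E F : Type*} [NormedAddCommGroup E] [NormedSpace ℝ E]
    [NormedAddCommGroup F] [NormedSpace ℝ F] {H G : Type*} [TopologicalSpace H] [TopologicalSpace G]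
    {I : ModelWithCorners ℝ E H} {J : ModelWithCorners ℝ F G} {M N : Type*} [TopologicalSpace M]
    [ChartedSpace H M] [TopologicalSpace N] [ChartedSpace G N] [IsManifold I ∞ M]
    [IsManifold J ∞ N] {f : M → N} {x : M} (h : IsImmersionAt I J ∞ f x) :
    Function.Injective (mfderiv I J f x) := by
  have hle : (1 : WithTop ℕ∞) ≤ ∞ := by simp
  have hdom := IsManifold.maximalAtlas_subset_of_le (I := I) (M := M) hle h.domChart_mem_maximalAtlas
  have hcod := IsManifold.maximalAtlas_subset_of_le (I := J) (M := N) hle h.codChart_mem_maximalAtlas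
  have hmd : h.domChart.MDifferentiable I I :=
    ⟨fun y hy => (mdifferentiableAt_of_mem_maximalAtlas hdom hy).mdifferentiableWithinAt,
      fun y hy => (mdifferentiableAt_symm_of_mem_maximalAtlas hdom hy).mdifferentiableWithinAt⟩
  have hf : MDifferentiableAt I J f x := h.contMDiffAt.mdifferentiableAt (by simp)
  -- In immersion charts `f` is `x ↦ (x, 0)`. Projecting away the complement gives a left inverse,
  -- to which the chain rule applies.
  let A : F →L[ℝ] E := (ContinuousLinearMap.fst ℝ E h.complement).comp
    h.equiv.symm.toContinuousLinearMap
  have hfx := h.mem_codChart_source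
  have hx := h.mem_domChart_source
  have hG : MDifferentiableAt J 𝓘(ℝ, E) (A ∘ J ∘ h.codChart) (f x) :=
    A.mdifferentiableAt.comp (f x) (J.mdifferentiableAt.comp (f x)
      (mdifferentiableAt_of_mem_maximalAtlas hcod hfx))
  have hW := h.writtenInCharts
  have heq : (I ∘ h.domChart) =ᶠ[𝓝 x] (A ∘ J ∘ h.codChart) ∘ f := by
    filter_upwards [h.domChart.open_source.mem_nhds hx] with y hy
    have hy' : y ∈ (h.domChart.extend I).source := by rwa [extend_source]
    have hw := hW ((h.domChart.extend I).map_source hy')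
    have h2 : A (h.codChart.extend J (f y)) = h.domChart.extend I y := by
      rw [Function.comp_apply, Function.comp_apply, Function.comp_apply,
        (h.domChart.extend I).left_inv hy'] at hw
      rw [hw]
      exact congrArg Prod.fst (h.equiv.symm_apply_apply _)
    exact h2.symm
  have hD : mfderiv I 𝓘(ℝ, E) (I ∘ h.domChart) x =
      (mfderiv J 𝓘(ℝ, E) (A ∘ J ∘ h.codChart) (f x)).comp (mfderiv I J f x) := by
    rw [heq.mfderiv_eq]
    exact mfderiv_comp x hG hf
  have hD' : mfderiv I 𝓘(ℝ, E) (I ∘ h.domChart) x =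
      (ContinuousLinearMap.id ℝ E).comp (mfderiv I I h.domChart x) := by
    rw [mfderiv_comp x I.mdifferentiableAt (hmd.mdifferentiableAt hx),
      I.hasMFDerivAt.mfderiv]
    rfl
  have hinj : Function.Injective (mfderiv I 𝓘(ℝ, E) (I ∘ h.domChart) x) := by
    rw [hD']
    exact hmd.mfderiv_injective hx
  rw [hD] at hinj
  exact Function.Injective.of_comp hinj

end Immersion

/-! ### Vector fields along maps -/

section Fields

variable {E : Type*} [NormedAddCommGroup E] [NormedSpace ℝ E] {H : Type*} [TopologicalSpace H]
  {I : ModelWithCorners ℝ E H} {M : Type*} [TopologicalSpace M] [ChartedSpace H M]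
  [IsManifold I 1 M]
  {EX : Type*} [NormedAddCommGroup EX] [NormedSpace ℝ EX] {HX : Type*} [TopologicalSpace HX]
  {IX : ModelWithCorners ℝ EX HX} {X : Type*} [TopologicalSpace X] [ChartedSpace HX X]
  {n : WithTop ℕ∞} {g : X → M} {s : Set X} {x₀ : X} {ι : Type*} [Fintype ι]

/-- A linear combination of vector fields along a map is as regular as the fields and the
coefficients. -/
lemma contMDiffWithinAt_sum_smul_field {b : ι → ∀ x, TangentSpace I (g x)} {c : ι → X → ℝ}
    (hx₀ : x₀ ∈ s) (hg : ContMDiffWithinAt IX I n g s x₀)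
    (hc : ∀ i, ContMDiffWithinAt IX 𝓘(ℝ, ℝ) n (c i) s x₀)
    (hb : ∀ i, ContMDiffWithinAt IX I.tangent n
      (fun x => (⟨g x, b i x⟩ : TangentBundle I M)) s x₀) :
    ContMDiffWithinAt IX I.tangent n
      (fun x => (⟨g x, ∑ i, c i x • b i x⟩ : TangentBundle I M)) s x₀ := by
  refine Bundle.contMDiffWithinAt_totalSpace.2 ⟨hg, ?_⟩
  have hb' := fun i => (Bundle.contMDiffWithinAt_totalSpace.1 (hb i)).2
  have hsum : ContMDiffWithinAt IX 𝓘(ℝ, E) n (fun x => ∑ i, c i x •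
      ((trivializationAt E (TangentSpace I : M → Type _) (g x₀)) ⟨g x, b i x⟩).2) s x₀ :=
    contMDiffWithinAt_finsetSum fun i _ => (hc i).smul (hb' i)
  have key : ∀ x, g x ∈ (trivializationAt E (TangentSpace I : M → Type _) (g x₀)).baseSet →
      ((trivializationAt E (TangentSpace I : M → Type _) (g x₀))
        ⟨g x, ∑ i, c i x • b i x⟩).2 = ∑ i, c i x •
      ((trivializationAt E (TangentSpace I : M → Type _) (g x₀)) ⟨g x, b i x⟩).2 := by
    intro x hx
    have := map_sum ((trivializationAt E (TangentSpace I : M → Type _) (g x₀)).linearEquivAt ℝ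
      (g x) hx) (fun i => c i x • b i x) Finset.univ
    simp only [map_smul] at this
    exact this
  have hmem : ∀ᶠ x in 𝓝[s] x₀, g x ∈ (trivializationAt E
      (TangentSpace I : M → Type _) (g x₀)).baseSet :=
    hg.continuousWithinAt.eventually ((Bundle.Trivialization.open_baseSet _).mem_nhds
      (FiberBundle.mem_baseSet_trivializationAt' (F := E)
        (E := (TangentSpace I : M → Type _)) (g x₀)))
  refine hsum.congr_of_eventuallyEq ?_ (key x₀ (hmem.self_of_nhdsWithin hx₀))
  filter_upwards [hmem] with x hx
  exact key x hx

/-- The coefficients of a vector field along a map with respect to a moving frame are as regular as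
the field and the frame. -/
lemma contMDiffWithinAt_coeff_field [FiniteDimensional ℝ E] {b : ι → ∀ x, TangentSpace I (g x)}
    {v : ∀ x, TangentSpace I (g x)} {c : X → ι → ℝ} (hx₀ : x₀ ∈ s)
    (hb : ∀ i, ContMDiffWithinAt IX I.tangent n
      (fun x => (⟨g x, b i x⟩ : TangentBundle I M)) s x₀)
    (hv : ContMDiffWithinAt IX I.tangent n (fun x => (⟨g x, v x⟩ : TangentBundle I M)) s x₀)
    (hcard : Fintype.card ι = Module.finrank ℝ E)
    (hc : ∀ x ∈ s, LinearIndependent ℝ (fun i => b i x) ∧ v x = ∑ i, c x i • b i x) (i : ι) :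
    ContMDiffWithinAt IX 𝓘(ℝ, ℝ) n (fun x => c x i) s x₀ := by
  have hb' := fun i => (Bundle.contMDiffWithinAt_totalSpace.1 (hb i)).2
  have hv' := Bundle.contMDiffWithinAt_totalSpace.1 hv
  refine contMDiffWithinAt_coeff hx₀ hb' hv'.2 hcard ?_ i
  have hmem : ∀ᶠ x in 𝓝[s] x₀, g x ∈ (trivializationAt E
      (TangentSpace I : M → Type _) (g x₀)).baseSet :=
    hv'.1.continuousWithinAt.eventually ((Bundle.Trivialization.open_baseSet _).mem_nhds
      (FiberBundle.mem_baseSet_trivializationAt' (F := E)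
        (E := (TangentSpace I : M → Type _)) (g x₀)))
  filter_upwards [hmem, self_mem_nhdsWithin] with x hx hxs
  obtain ⟨h1, h2⟩ := hc x hxs
  let L := (trivializationAt E (TangentSpace I : M → Type _) (g x₀)).linearEquivAt ℝ (g x) hx
  refine ⟨?_, ?_⟩
  · exact h1.map' L.toLinearMap L.ker
  · have := congrArg L h2
    rw [map_sum] at this
    simp only [map_smul] at this
    exact this

end Fields

/-! ### Smoothness of the velocity field -/

section Velocity

variable {H : Type*} [TopologicalSpace H]
  {J : ModelWithCorners ℝ (EuclideanSpace ℝ (Fin 3)) H}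
  {Y : Type*} [TopologicalSpace Y] [ChartedSpace H Y] [IsManifold J 1 Y]

/-- The velocity of a smooth closed curve is a smooth vector field along the curve. -/
lemma contMDiff_velocity {γ : Circle → Y} (hγ : ContMDiff (𝓡 1) J ∞ γ) :
    ContMDiff (𝓡 1) J.tangent ∞ (fun z => (⟨γ z, velocity J γ z⟩ : TangentBundle J Y)) := by
  intro z₀
  have hLie : LieGroup (𝓡 1) ∞ Circle := LieGroup.of_le (n := ω) le_top
  have hmul : ContMDiff ((𝓡 1).prod 𝓘(ℝ, ℝ)) J ∞
      (Function.uncurry fun (z : Circle) (t : ℝ) => γ (z * Circle.exp t)) :=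
    hγ.comp (contMDiff_fst.mul (contMDiff_circleExp.comp contMDiff_snd))
  -- The velocity is the `t`-derivative at `0` of a map smooth jointly in `z` and `t`, hence smooth
  -- in `z`.
  have h1 := ContMDiffAt.mfderiv (x₀ := z₀) (m := ∞) (n := ∞)
    (fun (z : Circle) (t : ℝ) => γ (z * Circle.exp t)) (fun _ => (0 : ℝ)) (hmul _)
    contMDiffAt_const (by simp)
  have h2 := ContMDiffAt.clm_apply_of_inCoordinates (IB₁ := 𝓘(ℝ, ℝ)) (IB₂ := J) (n := ∞)
    (IM := 𝓡 1) (F₁ := ℝ) (F₂ := EuclideanSpace ℝ (Fin 3)) (m₀ := z₀)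
    (E₁ := (TangentSpace 𝓘(ℝ, ℝ) : ℝ → Type _)) (E₂ := (TangentSpace J : Y → Type _))
    (b₁ := fun _ : Circle => (0 : ℝ)) (v := fun _ => (1 : ℝ))
    (b₂ := fun z : Circle => γ (z * Circle.exp 0))
    (ϕ := fun z => mfderiv 𝓘(ℝ, ℝ) J (fun t : ℝ => γ (z * Circle.exp t)) 0)
    h1 contMDiffAt_const (by simpa using hγ z₀)
  refine h2.congr_of_eventuallyEq (Filter.Eventually.of_forall fun z => ?_)
  -- The base points `γ z` and `γ (z * exp 0)` agree only propositionally, so the vector is read in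
  -- the model space.
  have e : γ z = γ (z * Circle.exp 0) := by simp
  exact congrArg (fun y => (⟨y, (velocity J γ z : EuclideanSpace ℝ (Fin 3))⟩ : TangentBundle J Y)) e

end Velocity

/-! ### Frames of the pulled-back tangent bundle -/

section DiskFrame

variable {G : Type*} [TopologicalSpace G] {E : Type*} [NormedAddCommGroup E]
  {W : Type*} [TopologicalSpace W] [ChartedSpace G W]

/-- Over the disk there are finitely many smooth vector fields along a smooth map which span every
tangent space. -/
theorem exists_spanning_fields [NormedSpace ℝ E] [FiniteDimensional ℝ E]
    {I : ModelWithCorners ℝ E G} [IsManifold I ∞ W]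
    {Δ : ℂ → W} (hΔ : ContMDiffOn 𝓘(ℝ, ℂ) I ∞ Δ disk) :
    ∃ (ι : Type) (_ : Fintype ι) (X : ι → ∀ z, TangentSpace I (Δ z)),
      (∀ i, ContMDiffOn 𝓘(ℝ, ℂ) I.tangent ∞
        (fun z => (⟨Δ z, X i z⟩ : TangentBundle I W)) disk) ∧
      ∀ z ∈ disk, Submodule.span ℝ (Set.range fun i => X i z) = ⊤ := by
  let e : ℂ → Bundle.Trivialization E (Bundle.TotalSpace.proj (F := E)
      (E := (TangentSpace I : W → Type _))) :=
    fun z => trivializationAt E (TangentSpace I : W → Type _) (Δ z)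
  have hr : ∀ z : ℂ, ∃ r > 0, z ∈ disk → ∀ y ∈ Metric.ball z r ∩ disk, Δ y ∈ (e z).baseSet := by
    intro z
    by_cases hz : z ∈ disk
    · have hmem : Δ ⁻¹' (e z).baseSet ∈ 𝓝[disk] z :=
        (hΔ z hz).continuousWithinAt ((Bundle.Trivialization.open_baseSet _).mem_nhds
          (FiberBundle.mem_baseSet_trivializationAt' (F := E)
            (E := (TangentSpace I : W → Type _)) (Δ z)))
      obtain ⟨r, hr, h⟩ := Metric.mem_nhdsWithin_iff.1 hmem
      exact ⟨r, hr, fun _ => h⟩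
    · exact ⟨1, one_pos, fun h => absurd h hz⟩
  choose r hr hrb using hr
  obtain ⟨t, htd, ht⟩ := (isCompact_closedBall (0 : ℂ) 1).elim_nhds_subcover
    (fun z => Metric.ball z (r z / 4)) (fun z _ => Metric.ball_mem_nhds _ (by linarith [hr z]))
  -- The bumps equal `1` on the balls of the cover and vanish beyond half the radius on which the
  -- local frame lives, so the cut-off frames extend by zero.
  let χ : ∀ z : ℂ, ContDiffBump z := fun z =>
    ⟨r z / 4, r z / 2, by linarith [hr z], by linarith [hr z]⟩
  let f := Module.finBasis ℝ E
  refine ⟨t × Fin (Module.finrank ℝ E), inferInstance,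
    fun p z => χ p.1 z • (e p.1).symm (Δ z) (f p.2), ?_, ?_⟩
  · rintro ⟨⟨z₀, hz₀⟩, j⟩ z hz
    have hz₀d := htd z₀ hz₀
    by_cases hzr : z ∈ Metric.ball z₀ (r z₀)
    · have hs : ContMDiffWithinAt 𝓘(ℝ, ℂ) I.tangent ∞
          (fun z => (⟨Δ z, (e z₀).symm (Δ z) (f j)⟩ : TangentBundle I W)) disk z := by
        have hmem : (⟨Δ z, (e z₀).symm (Δ z) (f j)⟩ : TangentBundle I W) ∈ (e z₀).source := by
          rw [(e z₀).mem_source]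
          exact hrb z₀ hz₀d z ⟨hzr, hz⟩
        refine ((e z₀).contMDiffWithinAt_iff (IB := I) (IM := 𝓘(ℝ, ℂ)) (n := ∞) (s := disk)
          (f := fun z => (⟨Δ z, (e z₀).symm (Δ z) (f j)⟩ : TangentBundle I W)) (x₀ := z) hmem).2 ⟨hΔ z hz, ?_⟩
        refine (contMDiffWithinAt_const (c := f j)).congr_of_eventuallyEq ?_ ?_
        · filter_upwards [self_mem_nhdsWithin,
            mem_nhdsWithin_of_mem_nhds (Metric.isOpen_ball.mem_nhds hzr)] with y hy hyr
          rw [(e z₀).apply_mk_symm (hrb z₀ hz₀d y ⟨hyr, hy⟩)]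
        · rw [(e z₀).apply_mk_symm (hrb z₀ hz₀d z ⟨hzr, hz⟩)]
      have h := contMDiffWithinAt_sum_smul_field (ι := Unit) (I := I)
        (b := fun _ z => (e z₀).symm (Δ z) (f j)) (c := fun _ z => χ z₀ z) hz (hΔ z hz)
        (fun _ => (((χ z₀).contDiff (n := ⊤)).contMDiff z).contMDiffWithinAt) (fun _ => hs)
      simpa using h
    · have h0 : ContMDiffWithinAt 𝓘(ℝ, ℂ) I.tangent ∞
          (fun z => (⟨Δ z, 0⟩ : TangentBundle I W)) disk z :=
        ((Bundle.contMDiff_zeroSection (IB := I) ℝ (TangentSpace I : W → Type _)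
          (n := ∞) (F := E)) (Δ z)).comp_contMDiffWithinAt z (hΔ z hz)
      have hχ : ∀ y, y ∉ Metric.ball z₀ (r z₀ / 2) → χ z₀ y = 0 := by
        intro y hy
        refine (χ z₀).zero_of_le_dist ?_
        simpa [χ] using hy
      refine h0.congr_of_eventuallyEq ?_ ?_
      · have : (Metric.closedBall z₀ (r z₀ / 2))ᶜ ∈ 𝓝 z := by
          refine Metric.isClosed_closedBall.isOpen_compl.mem_nhds fun h => hzr ?_
          rw [Metric.mem_closedBall] at h
          rw [Metric.mem_ball]
          linarith [hr z₀]
        filter_upwards [mem_nhdsWithin_of_mem_nhds this] with y hy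
        simp only [hχ y fun h => hy (Metric.ball_subset_closedBall h), zero_smul]
      · simp only [hχ z fun h => hzr (Metric.ball_subset_ball (by linarith [hr z₀]) h), zero_smul]
  · intro z hz
    obtain ⟨z₀, hz₀, hzz⟩ := Set.mem_iUnion₂.1 (ht hz)
    have hb := hrb z₀ (htd z₀ hz₀) z ⟨Metric.ball_subset_ball (by linarith [hr z₀]) hzz, hz⟩
    have hone : χ z₀ z = 1 := (χ z₀).one_of_mem_closedBall (Metric.ball_subset_closedBall hzz)
    let A := ((e z₀).linearEquivAt ℝ (Δ z) hb).symm
    rw [eq_top_iff, ← (f.map A).span_eq]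
    refine Submodule.span_mono ?_
    rintro _ ⟨j, rfl⟩
    refine ⟨(⟨z₀, hz₀⟩, j), ?_⟩
    simp only [hone, one_smul]
    rfl

/-- The linear combination map of a finite family of vectors. -/
def linComb {V ι : Type*} [AddCommGroup V] [Module ℝ V] [Fintype ι] (X : ι → V) :
    EuclideanSpace ℝ ι →ₗ[ℝ] V :=
  (Fintype.linearCombination ℝ X).comp (WithLp.linearEquiv 2 ℝ (ι → ℝ)).toLinearMap

lemma linComb_apply {V ι : Type*} [AddCommGroup V] [Module ℝ V] [Fintype ι] (X : ι → V)
    (c : EuclideanSpace ℝ ι) : linComb X c = ∑ i, c i • X i := rfl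

lemma range_adjoint_eq_orthogonal_ker {F E : Type*} [NormedAddCommGroup F]
    [InnerProductSpace ℝ F] [FiniteDimensional ℝ F] [NormedAddCommGroup E] [InnerProductSpace ℝ E]
    [FiniteDimensional ℝ E] (A : F →L[ℝ] E) :
    (LinearMap.ker A.toLinearMap)ᗮ = (ContinuousLinearMap.adjoint A).range := by
  have h : (ContinuousLinearMap.adjoint A).rangeᗮ = LinearMap.ker A.toLinearMap := by
    ext c
    simp only [Submodule.mem_orthogonal, LinearMap.mem_ker]
    constructor
    · intro h
      have := h (ContinuousLinearMap.adjoint A (A c)) ⟨_, rfl⟩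
      rw [ContinuousLinearMap.adjoint_inner_left] at this
      exact inner_self_eq_zero.1 this
    · rintro h _ ⟨x, rfl⟩
      have h' : A c = 0 := h
      change inner ℝ (ContinuousLinearMap.adjoint A x) c = 0
      rw [ContinuousLinearMap.adjoint_inner_left, h', inner_zero_right]
  rw [← h, Submodule.orthogonal_orthogonal]

lemma injective_adjoint_of_surjective {F E : Type*} [NormedAddCommGroup F]
    [InnerProductSpace ℝ F] [FiniteDimensional ℝ F] [NormedAddCommGroup E] [InnerProductSpace ℝ E]
    [FiniteDimensional ℝ E] {A : F →L[ℝ] E} (hA : Function.Surjective A) :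
    Function.Injective (ContinuousLinearMap.adjoint A) := by
  refine (injective_iff_map_eq_zero _).2 fun x hx => ?_
  obtain ⟨c, rfl⟩ := hA x
  have := ContinuousLinearMap.adjoint_inner_left A c (A c)
  rw [hx, inner_zero_left] at this
  exact inner_self_eq_zero.1 this.symm

/-- The pull-back of the tangent bundle to the disk under a smooth map has a smooth frame. -/
theorem exists_smooth_frame [InnerProductSpace ℝ E] [FiniteDimensional ℝ E]
    {I : ModelWithCorners ℝ E G} [IsManifold I ∞ W] {m : ℕ} (hm : Module.finrank ℝ E = m)
    {Δ : ℂ → W} (hΔ : ContMDiffOn 𝓘(ℝ, ℂ) I ∞ Δ disk) :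
    ∃ b : Fin m → ∀ z, TangentSpace I (Δ z),
      (∀ i, ContMDiffOn 𝓘(ℝ, ℂ) I.tangent ∞
        (fun z => (⟨Δ z, b i z⟩ : TangentBundle I W)) disk) ∧
      ∀ z ∈ disk, LinearIndependent ℝ (fun i => b i z) := by
  obtain ⟨ι, _, X, hX, hspan⟩ := exists_spanning_fields hΔ
  -- The spanning fields present the pulled-back bundle as a quotient of a trivial bundle with
  -- kernel `K`. The bundle `Kᗮ` maps isomorphically onto it, so framing `Kᗮ` is enough.
  let K : ℂ → Submodule ℝ (EuclideanSpace ℝ ι) := fun z => LinearMap.ker (linComb fun i => X i z)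
  let Q : ℂ → EuclideanSpace ℝ ι →L[ℝ] EuclideanSpace ℝ ι := fun z => (K z)ᗮ.starProjection
  have hQ : ContDiffOn ℝ ∞ Q disk := by
    intro z₀ hz₀
    let e := trivializationAt E (TangentSpace I : W → Type _) (Δ z₀)
    -- In a local trivialisation `Kᗮ` is the range of the adjoint of the surjection `A`, and that
    -- adjoint is injective, so the projection formula applies.
    let A : ℂ → EuclideanSpace ℝ ι →L[ℝ] E := fun z => euclideanComb fun i => (e ⟨Δ z, X i z⟩).2
    have hA : ContDiffWithinAt ℝ ∞ A disk z₀ := contDiffWithinAt_euclideanComb fun i =>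
      (Bundle.contMDiffWithinAt_totalSpace.1 (hX i z₀ hz₀)).2.contDiffWithinAt
    have hadj : ContDiffWithinAt ℝ ∞ (fun z => ContinuousLinearMap.adjoint (A z)) disk z₀ :=
      ((ContinuousLinearMap.adjoint : (EuclideanSpace ℝ ι →L[ℝ] E) ≃ₗᵢ⋆[ℝ]
        (E →L[ℝ] EuclideanSpace ℝ ι)).toLinearIsometry.toContinuousLinearMap
        |> fun A : (EuclideanSpace ℝ ι →L[ℝ] E) →L[ℝ] (E →L[ℝ] EuclideanSpace ℝ ι) =>
          A.contDiff).comp_contDiffWithinAt hA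
    refine contDiffWithinAt_starProjection_range hz₀ hadj ?_
    have hmem : ∀ᶠ z in 𝓝[disk] z₀, Δ z ∈ e.baseSet :=
      (hΔ z₀ hz₀).continuousWithinAt.eventually ((Bundle.Trivialization.open_baseSet _).mem_nhds
        (FiberBundle.mem_baseSet_trivializationAt' (F := E)
          (E := (TangentSpace I : W → Type _)) (Δ z₀)))
    filter_upwards [hmem, self_mem_nhdsWithin] with z hz hzd
    let T := e.linearEquivAt ℝ (Δ z) hz
    have hAT : ∀ c, A z c = T (linComb (fun i => X i z) c) := by
      intro c
      rw [linComb_apply, map_sum, euclideanComb_apply]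
      simp only [map_smul]
      rfl
    have hKA : K z = LinearMap.ker (A z).toLinearMap := by
      ext c
      change linComb _ c = 0 ↔ A z c = 0
      rw [hAT, map_eq_zero_iff T T.injective]
    have hsurj : Function.Surjective (A z) := by
      intro x
      have hx : T.symm x ∈ Submodule.span ℝ (Set.range fun i => X i z) := by
        rw [hspan z hzd]; trivial
      obtain ⟨c, hc⟩ := (Submodule.mem_span_range_iff_exists_fun ℝ).1 hx
      refine ⟨WithLp.toLp 2 c, ?_⟩
      rw [hAT, linComb_apply]
      exact (congrArg T hc).trans (T.apply_symm_apply x)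
    exact ⟨injective_adjoint_of_surjective hsurj, by rw [hKA, range_adjoint_eq_orthogonal_ker]⟩
  obtain ⟨P, -, hPs, hP⟩ := exists_transport_of_idempotent Q hQ.continuousOn
    (fun z _ f => Submodule.starProjection_eq_self_iff.2 (Submodule.starProjection_apply_mem _ _))
  have h0 : (0 : ℂ) ∈ disk := by simp
  have hdim : Module.finrank ℝ (K 0)ᗮ = m := by
    have h1 := (K 0).finrank_add_finrank_orthogonal
    have h2 := LinearMap.finrank_range_add_finrank_ker (linComb fun i => X i 0)
    have h3 : LinearMap.range (linComb fun i => X i 0) = ⊤ := by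
      rw [eq_top_iff, ← hspan 0 h0, Submodule.span_le]
      rintro _ ⟨i, rfl⟩
      classical
      exact ⟨EuclideanSpace.single i 1, by simp [linComb_apply, Finset.sum_ite_eq', ite_smul]⟩
    rw [h3, finrank_top] at h2
    have h4 : Module.finrank ℝ (TangentSpace I (Δ 0)) = m := hm
    change _ + Module.finrank ℝ (K 0) = _ at h2
    omega
  let f : Module.Basis (Fin m) ℝ (K 0)ᗮ := Module.finBasisOfFinrankEq ℝ _ hdim
  refine ⟨fun a z => ∑ i, (P z (f a)) i • X i z, fun a z hz => ?_, fun z hz => ?_⟩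
  · refine contMDiffWithinAt_sum_smul_field (c := fun i z => (P z (f a)) i) hz (hΔ z hz)
      (fun i => ?_) (fun i => hX i z hz)
    have h1 : ContDiffWithinAt ℝ ∞ (fun z => P z (f a)) disk z :=
      (hPs hQ z hz).clm_apply contDiffWithinAt_const
    exact ((EuclideanSpace.proj i : EuclideanSpace ℝ ι →L[ℝ] ℝ).contDiff.comp_contDiffWithinAt
      h1).contMDiffWithinAt
  · refine Fintype.linearIndependent_iff.2 fun c hc => ?_
    set x : (K 0)ᗮ := ∑ a, c a • f a with hx
    have h1 : linComb (fun i => X i z) (P z x) = 0 := by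
      rw [← hc, hx]
      simp only [Submodule.coe_sum, Submodule.coe_smul, map_sum, map_smul]
      rfl
    have h2 : P z x ∈ (K z)ᗮ := Submodule.starProjection_eq_self_iff.1 ((hP z hz).1 x)
    have h3 : P z (x : EuclideanSpace ℝ ι) = 0 := by
      have : P z (x : EuclideanSpace ℝ ι) ∈ K z := h1
      exact inner_self_eq_zero.1 ((Submodule.mem_orthogonal _ _).1 h2 _ this)
    have h4 := (hP z hz).2 x (Submodule.starProjection_eq_self_iff.2 x.2) h3
    have h5 : x = 0 := Subtype.ext h4
    exact Fintype.linearIndependent_iff.1 f.linearIndependent c h5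

end DiskFrame

/-! ### A frame of the normal bundle of the disk -/

section NormalFrame

variable {G : Type*} [TopologicalSpace G]
  {I : ModelWithCorners ℝ (EuclideanSpace ℝ (Fin 5)) G}
  {W : Type*} [TopologicalSpace W] [ChartedSpace G W]

variable (I) in
/-- The two coordinate fields of a disk. -/
def coordField (Δ : ℂ → W) (j : Fin 2) (z : ℂ) : TangentSpace I (Δ z) :=
  mfderivWithin 𝓘(ℝ, ℂ) I Δ disk z (Complex.basisOneI j : ℂ)

lemma span_range_basisOneI {V : Type*} [AddCommGroup V] [Module ℝ V] (A : ℂ →ₗ[ℝ] V) :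
    Submodule.span ℝ (Set.range fun j => A (Complex.basisOneI j)) = LinearMap.range A := by
  have h : (Set.range fun j => A (Complex.basisOneI j)) = A '' Set.range Complex.basisOneI := by
    rw [← Set.range_comp]; rfl
  rw [h, Submodule.span_image, Complex.basisOneI.span_eq, Submodule.map_top]

lemma span_coordField (Δ : ℂ → W) (z : ℂ) :
    Submodule.span ℝ (Set.range fun j => coordField I Δ j z) = tangentPlane I Δ z := by
  exact span_range_basisOneI (V := TangentSpace I (Δ z))
    (mfderivWithin 𝓘(ℝ, ℂ) I Δ disk z).toLinearMap

lemma linearIndependent_coordField {Δ : ℂ → W} {z : ℂ}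
    (h : Function.Injective (mfderivWithin 𝓘(ℝ, ℂ) I Δ disk z)) :
    LinearIndependent ℝ (fun j => coordField I Δ j z) :=
  Complex.basisOneI.linearIndependent.map' (mfderivWithin 𝓘(ℝ, ℂ) I Δ disk z).toLinearMap
    (LinearMap.ker_eq_bot.2 h)

lemma contMDiffOn_coordField [IsManifold I ∞ W] {Δ : ℂ → W}
    (hΔ : ContMDiffOn 𝓘(ℝ, ℂ) I ∞ Δ disk) (j : Fin 2) :
    ContMDiffOn 𝓘(ℝ, ℂ) I.tangent ∞
      (fun z => (⟨Δ z, coordField I Δ j z⟩ : TangentBundle I W)) disk := by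
  have hu : UniqueMDiffOn 𝓘(ℝ, ℂ) disk :=
    (uniqueDiffOn_convex (convex_closedBall (0 : ℂ) 1) (by
      rw [interior_closedBall _ one_ne_zero]; simp)).uniqueMDiffOn
  have h1 := hΔ.contMDiffOn_tangentMapWithin (m := ∞) (by simp) hu
  have h2 : ContMDiff 𝓘(ℝ, ℂ) 𝓘(ℝ, ℂ).tangent ∞
      (fun z : ℂ => (⟨z, (Complex.basisOneI j : ℂ)⟩ : TangentBundle 𝓘(ℝ, ℂ) ℂ)) := by
    intro z
    refine Bundle.contMDiffAt_totalSpace.2 ⟨contMDiffAt_id, ?_⟩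
    simpa using contMDiffAt_const
  exact h1.comp (h2.contMDiffOn (s := disk)) fun z hz => hz

/-- A normal frame of a disk: three smooth vector fields along the disk whose classes form a basis
of every fibre of the normal bundle. -/
theorem exists_normal_frame [IsManifold I ∞ W] {Δ : ℂ → W}
    (hΔ : ContMDiffOn 𝓘(ℝ, ℂ) I ∞ Δ disk)
    (himm : ∀ z ∈ disk, Function.Injective (mfderivWithin 𝓘(ℝ, ℂ) I Δ disk z)) :
    ∃ N : Fin 3 → ∀ z, TangentSpace I (Δ z),
      (∀ i, ContMDiffOn 𝓘(ℝ, ℂ) I.tangent ∞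
        (fun z => (⟨Δ z, N i z⟩ : TangentBundle I W)) disk) ∧
      ∀ z ∈ disk, ∀ c : Fin 3 → ℝ, ∑ i, c i • N i z ∈ tangentPlane I Δ z → c = 0 := by
  obtain ⟨b, hb, hbi⟩ := exists_smooth_frame (I := I) (m := 5) (by simp) hΔ
  have hex : ∀ (j : Fin 2) (z : ℂ), ∃ c : Fin 5 → ℝ, z ∈ disk →
      coordField I Δ j z = ∑ i, c i • b i z := by
    intro j z
    by_cases hz : z ∈ disk
    · have : FiniteDimensional ℝ (TangentSpace I (Δ z)) :=
        inferInstanceAs (FiniteDimensional ℝ (EuclideanSpace ℝ (Fin 5)))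
      have hc : Fintype.card (Fin 5) = Module.finrank ℝ (TangentSpace I (Δ z)) := by
        change _ = Module.finrank ℝ (EuclideanSpace ℝ (Fin 5))
        simp
      obtain ⟨c, hc⟩ := exists_coeff_of_linearIndependent (hbi z hz) hc (coordField I Δ j z)
      exact ⟨c, fun _ => hc⟩
    · exact ⟨0, fun h => absurd h hz⟩
  choose c hc using hex
  -- The global frame identifies the tangent planes of the disk with planes in `ℝ⁵`, where they have
  -- a smooth complement.
  let l : Fin 2 → ℂ → EuclideanSpace ℝ (Fin 5) := fun j z => WithLp.toLp 2 (c j z)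
  have hl : ∀ j, ContDiffOn ℝ ∞ (l j) disk := by
    intro j z hz
    refine contDiffWithinAt_euclidean.2 fun i => ContMDiffWithinAt.contDiffWithinAt ?_
    exact contMDiffWithinAt_coeff_field (b := b) (c := c j) hz (fun i => hb i z hz)
      (contMDiffOn_coordField hΔ j z hz) (by simp)
      (fun x hx => ⟨hbi x hx, hc j x hx⟩) i
  have hlc : ∀ z ∈ disk, ∀ j, linComb (fun i => b i z) (l j z) = coordField I Δ j z :=
    fun z hz j => (hc j z hz).symm
  have hinj : ∀ z ∈ disk, Function.Injective (linComb fun i => b i z) := by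
    intro z hz
    refine (injective_iff_map_eq_zero _).2 fun x hx => ?_
    ext i
    exact Fintype.linearIndependent_iff.1 (hbi z hz) (fun i => x i) hx i
  have hli : ∀ z ∈ disk, LinearIndependent ℝ (fun j => l j z) := by
    intro z hz
    refine LinearIndependent.of_comp (linComb fun i => b i z) ?_
    have : (linComb fun i => b i z) ∘ (fun j => l j z) = fun j => coordField I Δ j z :=
      funext fun j => hlc z hz j
    rw [this]
    exact linearIndependent_coordField (himm z hz)
  obtain ⟨C, hC, hCi⟩ := exists_smooth_complement (k := 2) (m := 3) (by simp) l hl hli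
  refine ⟨fun j z => ∑ i, C j z i • b i z, fun j z hz => ?_, fun z hz a ha => ?_⟩
  · refine contMDiffWithinAt_sum_smul_field (c := fun i z => C j z i) hz (hΔ z hz)
      (fun i => ?_) (fun i => hb i z hz)
    exact (contDiffWithinAt_euclidean.1 (hC j z hz) i).contMDiffWithinAt
  · refine hCi z hz a ?_
    rw [← span_coordField] at ha
    have h1 : (Set.range fun j => coordField I Δ j z) =
        (linComb fun i => b i z) '' Set.range fun j => l j z := by
      rw [← Set.range_comp]
      exact congrArg Set.range (funext fun j => (hlc z hz j).symm)
    have h2 : ∑ j, a j • ∑ i, C j z i • b i z = linComb (fun i => b i z) (∑ j, a j • C j z) := by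
      simp only [map_sum, map_smul]
      rfl
    rw [h1, h2, Submodule.span_image] at ha
    obtain ⟨y, hy, hye⟩ := ha
    exact hinj z hz hye ▸ hy

end NormalFrame

/-! ### From the circle to the punctured plane -/

section CircleExtend

open Complex

/-- The extension of a function on the circle to the plane that is constant on open rays. -/
def circleExtend {F : Type*} (f : Circle → F) (z : ℂ) : F := f (Circle.exp z.arg)

lemma circleExtend_coe {F : Type*} (f : Circle → F) (z : Circle) : circleExtend f z = f z := by
  rw [circleExtend, Circle.exp_arg]

/-- The argument jumps across the negative axis, but its image in the circle does not: near `z` that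
image is the fixed point `exp (arg z)` turned by the angle of `y / z`, which is close to `1`. -/
lemma contMDiffAt_circleExp_arg {z : ℂ} (hz : z ≠ 0) :
    ContMDiffAt 𝓘(ℝ, ℂ) (𝓡 1) ∞ (fun y : ℂ => Circle.exp y.arg) z := by
  have hLie : LieGroup (𝓡 1) ∞ Circle := LieGroup.of_le (n := ω) le_top
  have hlog : ContDiffAt ℝ ∞ (fun y : ℂ => (log (y / z)).im) z := by
    have h1 : ContDiffAt ℂ ∞ (fun y : ℂ => log (y / z)) z := by
      refine ContDiffAt.comp (g := log) z (contDiffAt_log ?_) (contDiffAt_id.div_const z)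
      rw [div_self hz]
      exact one_mem_slitPlane
    exact imCLM.contDiff.contDiffAt.comp z (h1.restrict_scalars ℝ)
  have h2 : ContMDiffAt 𝓘(ℝ, ℂ) (𝓡 1) ∞
      (fun y : ℂ => Circle.exp z.arg * Circle.exp (log (y / z)).im) z :=
    contMDiffAt_const.mul (contMDiff_circleExp.contMDiffAt.comp z hlog.contMDiffAt)
  refine h2.congr_of_eventuallyEq ?_
  filter_upwards [isOpen_ne.mem_nhds hz] with y hy
  have hexp : ∀ x : ℂ, x ≠ 0 → (Circle.exp x.arg : ℂ) = x / ‖x‖ := by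
    intro x hx
    rw [eq_div_iff (by simpa using hx), Circle.coe_exp, mul_comm, norm_mul_exp_arg_mul_I]
  refine Circle.ext ?_
  rw [Circle.coe_mul, log_im, hexp _ hy, hexp _ hz, hexp _ (div_ne_zero hy hz), norm_div]
  have h1 : (‖y‖ : ℂ) ≠ 0 := by simpa using hy
  have h2 : (‖z‖ : ℂ) ≠ 0 := by simpa using hz
  push_cast
  field_simp

lemma contDiffAt_circleExtend {F : Type*} [NormedAddCommGroup F] [NormedSpace ℝ F] {f : Circle → F}
    (hf : ContMDiff (𝓡 1) 𝓘(ℝ, F) ∞ f) {z : ℂ} (hz : z ≠ 0) :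
    ContDiffAt ℝ ∞ (circleExtend f) z :=
  ((hf _).comp z (contMDiffAt_circleExp_arg hz)).contDiffAt

end CircleExtend

/-! ### Uniqueness and naturality of plane combinations -/

section PlaneComb

variable {V : Type*} [AddCommGroup V] [Module ℝ V]

lemma planeComb_injective {p q : V} (h : LinearIndependent ℝ ![p, q]) {u w : ℂ}
    (huw : planeComb u p q = planeComb w p q) : u = w := by
  rw [LinearIndependent.pair_iff] at h
  obtain ⟨h1, h2⟩ := h (u.re - w.re) (u.im - w.im) (by
    have : planeComb u p q - planeComb w p q = 0 := sub_eq_zero.2 huw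
    rw [← this, planeComb, planeComb]; module)
  exact Complex.ext (sub_eq_zero.1 h1) (sub_eq_zero.1 h2)

lemma map_planeComb {V' : Type*} [AddCommGroup V'] [Module ℝ V'] (A : V →ₗ[ℝ] V') (u : ℂ)
    (p q : V) : A (planeComb u p q) = planeComb u (A p) (A q) := by
  simp [planeComb]

end PlaneComb

/-! ### Framings of the curve and their rotation numbers -/

section Curve

variable {H : Type*} [TopologicalSpace H]
  {J : ModelWithCorners ℝ (EuclideanSpace ℝ (Fin 3)) H}
  {Y : Type*} [TopologicalSpace Y] [ChartedSpace H Y] {γ : Circle → Y}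

lemma exists_eq_add_smul_velocity {z : Circle} {v w : TangentSpace J (γ z)}
    (h : (tangentLine J γ z).mkQ v = (tangentLine J γ z).mkQ w) :
    ∃ s : ℝ, v = s • velocity J γ z + w := by
  obtain ⟨s, hs⟩ := Submodule.mem_span_singleton.1 ((Submodule.Quotient.eq _).1 h)
  exact ⟨s, by rw [hs, sub_add_cancel]⟩

lemma mkQ_velocity (z : Circle) : (tangentLine J γ z).mkQ (velocity J γ z) = 0 :=
  (Submodule.Quotient.mk_eq_zero _).2 (Submodule.mem_span_singleton_self _)

variable [IsManifold J 1 Y] {o : ManifoldOrientation J Y}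

lemma Framing.velocity_ne_zero (φ : Framing o γ) (z : Circle) : velocity J γ z ≠ 0 := by
  obtain ⟨v, -, b, hb, -⟩ := φ.positive z
  have : b 0 = velocity J γ z := by rw [hb]; rfl
  rw [← this]
  exact b.ne_zero 0

lemma Framing.linearIndependent (φ : Framing o γ) (z : Circle) :
    LinearIndependent ℝ ![φ.vec 0 z, φ.vec 1 z] := by
  obtain ⟨v, hv, b, hb, -⟩ := φ.positive z
  rw [LinearIndependent.pair_iff]
  intro s t hst
  change ∀ i, _ = φ.vec i z at hv
  rw [← hv 0, ← hv 1, ← map_smul, ← map_smul, ← map_add] at hst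
  obtain ⟨r, hr⟩ := Submodule.mem_span_singleton.1 ((Submodule.Quotient.mk_eq_zero _).1 hst)
  have := Fintype.linearIndependent_iff.1 b.linearIndependent ![-r, s, t] (by
    simp only [hb, Fin.sum_univ_three]
    simp only [Matrix.cons_val_zero, Matrix.cons_val_one, Matrix.cons_val]
    rw [neg_smul, hr]
    abel)
  exact ⟨this 1, this 2⟩

lemma Framing.linearIndependent_lift (φ : Framing o γ) {z : Circle}
    {v : Fin 2 → TangentSpace J (γ z)}
    (hv : ∀ i, (tangentLine J γ z).mkQ (v i) = φ.vec i z) :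
    LinearIndependent ℝ ![velocity J γ z, v 0, v 1] := by
  refine Fintype.linearIndependent_iff.2 fun c hc => ?_
  simp only [Fin.sum_univ_three] at hc
  simp only [Matrix.cons_val_zero, Matrix.cons_val_one, Matrix.cons_val] at hc
  have h1 := congrArg (tangentLine J γ z).mkQ hc
  rw [map_add, map_add, map_smul, map_smul, map_smul, hv, hv, mkQ_velocity, map_zero, smul_zero,
    zero_add] at h1
  obtain ⟨h2, h3⟩ := LinearIndependent.pair_iff.1 (φ.linearIndependent z) _ _ h1
  rw [h2, h3, zero_smul, zero_smul, add_zero, add_zero] at hc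
  have h4 := (smul_eq_zero.1 hc).resolve_right (φ.velocity_ne_zero z)
  intro i
  fin_cases i
  · exact h4
  · exact h2
  · exact h3

/-- A pair of normal vectors is positive if and only if the determinant of its coefficients with
respect to a framing is. -/
lemma Framing.isPositiveNormalBasis_planeComb (φ : Framing o γ) (z : Circle) (u w : ℂ) :
    IsPositiveNormalBasis o γ z
      ![planeComb u (φ.vec 0 z) (φ.vec 1 z), planeComb w (φ.vec 0 z) (φ.vec 1 z)] ↔
      0 < ((starRingEnd ℂ) u * w).im := by
  obtain ⟨v, hv, b, hb, hbo⟩ := φ.positive z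
  have b0 : velocity J γ z = b 0 := by rw [hb]; rfl
  have b1 : v 0 = b 1 := by rw [hb]; rfl
  have b2 : v 1 = b 2 := by rw [hb]; rfl
  -- Other representatives differ by multiples of the velocity, the first of the three vectors,
  -- which the determinant does not see.
  have hdet : ∀ s t : ℝ, b.det ![velocity J γ z, s • velocity J γ z + planeComb u (v 0) (v 1),
      t • velocity J γ z + planeComb w (v 0) (v 1)] = ((starRingEnd ℂ) u * w).im := by
    intro s t
    rw [Module.Basis.det_apply, Matrix.det_fin_three, b0, b1, b2]
    simp [Module.Basis.toMatrix_apply, planeComb]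
    ring
  have hq : ∀ a : ℂ, (tangentLine J γ z).mkQ (planeComb a (v 0) (v 1)) =
      planeComb a (φ.vec 0 z) (φ.vec 1 z) := by
    intro a
    rw [map_planeComb, hv, hv]
  constructor
  · rintro ⟨v', hv', b', hb', hbo'⟩
    obtain ⟨s, hs⟩ := exists_eq_add_smul_velocity ((hv' 0).trans (hq u).symm)
    obtain ⟨t, ht⟩ := exists_eq_add_smul_velocity ((hv' 1).trans (hq w).symm)
    rw [← hdet s t, ← hs, ← ht, ← hb', ← Module.Basis.orientation_eq_iff_det_pos, hbo, hbo']
  · intro h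
    have hd := hdet 0 0
    simp only [zero_smul, zero_add] at hd
    have hbas := (Module.Basis.is_basis_iff_det b).2 (hd ▸ h.ne'.isUnit)
    refine ⟨![planeComb u (v 0) (v 1), planeComb w (v 0) (v 1)], ?_,
      Module.Basis.mk hbas.1 hbas.2.ge, by simp, ?_⟩
    · intro i
      fin_cases i
      · exact hq u
      · exact hq w
    · rw [← hbo, eq_comm, Module.Basis.orientation_eq_iff_det_pos, Module.Basis.coe_mk, hd]
      exact h

/-- A section of the normal bundle of the curve has coefficients with respect to a framing, which
are as regular as the section. -/
lemma Framing.exists_coeff (φ : Framing o γ) (hγ : ContMDiff (𝓡 1) J ∞ γ)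
    {EX : Type*} [NormedAddCommGroup EX] [NormedSpace ℝ EX] {HX : Type*} [TopologicalSpace HX]
    {IX : ModelWithCorners ℝ EX HX} {X : Type*} [TopologicalSpace X] [ChartedSpace HX X]
    {n : WithTop ℕ∞} (hn : n ≤ ∞) {p : X → Circle} (hp : ContMDiff IX (𝓡 1) n p)
    {ν : ∀ x, TangentSpace J (γ (p x))}
    (hν : ContMDiff IX J.tangent n (fun x => (⟨γ (p x), ν x⟩ : TangentBundle J Y))) :
    ∃ u : X → ℂ, ContMDiff IX 𝓘(ℝ, ℂ) n u ∧
      ∀ x, (tangentLine J γ (p x)).mkQ (ν x) = planeComb (u x) (φ.vec 0 (p x)) (φ.vec 1 (p x)) := by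
  choose v hv hvq using φ.smooth
  -- The velocity and lifts of `φ` frame `TY` along the curve; the coefficient of the velocity dies
  -- in the quotient. The map `p` covers both sections over the circle and, with `n = 0`, homotopies
  -- over `ℝ × ℝ`.
  let b : Fin 3 → ∀ x, TangentSpace J (γ (p x)) :=
    fun i x => ![velocity J γ (p x), v 0 (p x), v 1 (p x)] i
  have hb : ∀ i, ContMDiff IX J.tangent n (fun x => (⟨γ (p x), b i x⟩ : TangentBundle J Y)) := by
    intro i
    fin_cases i
    · exact ((contMDiff_velocity hγ).of_le hn).comp hp
    · exact ((hv 0).of_le hn).comp hp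
    · exact ((hv 1).of_le hn).comp hp
  have hbi : ∀ x, LinearIndependent ℝ (fun i => b i x) := fun x =>
    φ.linearIndependent_lift (v := fun i => v i (p x)) fun i => hvq i (p x)
  have hex : ∀ x, ∃ c : Fin 3 → ℝ, ν x = ∑ i, c i • b i x := by
    intro x
    have : FiniteDimensional ℝ (TangentSpace J (γ (p x))) :=
      inferInstanceAs (FiniteDimensional ℝ (EuclideanSpace ℝ (Fin 3)))
    refine exists_coeff_of_linearIndependent (hbi x) ?_ (ν x)
    change _ = Module.finrank ℝ (EuclideanSpace ℝ (Fin 3))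
    simp
  choose c hc using hex
  have hcs : ∀ i, ContMDiff IX 𝓘(ℝ, ℝ) n (fun x => c x i) := fun i x => by
    rw [← contMDiffWithinAt_univ]
    exact contMDiffWithinAt_coeff_field (Set.mem_univ x) (fun i => (hb i x).contMDiffWithinAt)
      (hν x).contMDiffWithinAt (by simp) (fun x _ => ⟨hbi x, hc x⟩) i
  refine ⟨fun x => Complex.equivRealProdCLM.symm (c x 1, c x 2), ?_, fun x => ?_⟩
  · exact Complex.equivRealProdCLM.symm.toContinuousLinearMap.contMDiff.comp
      ((hcs 1).prodMk_space (hcs 2))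
  · rw [hc x, Fin.sum_univ_three]
    change (tangentLine J γ (p x)).mkQ (c x 0 • velocity J γ (p x) + c x 1 • v 0 (p x) +
      c x 2 • v 1 (p x)) = _
    rw [map_add, map_add, map_smul, map_smul, map_smul, mkQ_velocity, hvq, hvq, smul_zero, zero_add]
    simp [planeComb]

lemma vadd_vec_zero (k : ℤ) (φ : Framing o γ) (z : Circle) :
    (k +ᵥ φ).vec 0 z = planeComb ((z : ℂ) ^ k) (φ.vec 0 z) (φ.vec 1 z) := by
  change rot (z ^ k) 0 0 • φ.vec 0 z + rot (z ^ k) 0 1 • φ.vec 1 z = _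
  simp [rot, planeComb]

lemma vadd_vec_one (k : ℤ) (φ : Framing o γ) (z : Circle) :
    (k +ᵥ φ).vec 1 z = planeComb (Complex.I * (z : ℂ) ^ k) (φ.vec 0 z) (φ.vec 1 z) := by
  change rot (z ^ k) 1 0 • φ.vec 0 z + rot (z ^ k) 1 1 • φ.vec 1 z = _
  simp [rot, planeComb]

/-- The rotation number of a framing relative to another one. -/
theorem Framing.exists_rotation (φ ψ : Framing o γ) (hγ : ContMDiff (𝓡 1) J ∞ γ) :
    ∃ (k : ℤ) (u w : ℂ → ℂ), RotationHomotopic k u w ∧ ∀ z : Circle,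
      ψ.vec 0 z = planeComb (u z) (φ.vec 0 z) (φ.vec 1 z) ∧
      ψ.vec 1 z = planeComb (w z) (φ.vec 0 z) (φ.vec 1 z) := by
  choose v hv hvq using ψ.smooth
  obtain ⟨u, hu, huq⟩ := φ.exists_coeff hγ le_rfl contMDiff_id (hv 0)
  obtain ⟨w, hw, hwq⟩ := φ.exists_coeff hγ le_rfl contMDiff_id (hv 1)
  have hpos : ∀ z, 0 < ((starRingEnd ℂ) (u z) * w z).im := by
    intro z
    rw [← φ.isPositiveNormalBasis_planeComb z]
    convert ψ.positive z using 1
    funext i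
    fin_cases i
    · exact (huq z).symm.trans (hvq 0 z)
    · exact (hwq z).symm.trans (hvq 1 z)
  obtain ⟨k, hk⟩ := exists_rotationHomotopic (fun z hz => contDiffAt_circleExtend hu hz)
    (fun z hz => contDiffAt_circleExtend hw hz) (fun z _ => hpos _)
  refine ⟨k, _, _, hk, fun z => ?_⟩
  rw [circleExtend_coe, circleExtend_coe]
  exact ⟨(hvq 0 z).symm.trans (huq z), (hvq 1 z).symm.trans (hwq z)⟩

/-- Framings with rotation number `k` relative to `φ` are homotopic to `k +ᵥ φ`. -/
theorem homotopic_vadd_of_rotationHomotopic {φ ψ : Framing o γ} {k : ℤ} {u w : ℂ → ℂ}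
    (h : RotationHomotopic k u w) (hψ : ∀ z : Circle,
      ψ.vec 0 z = planeComb (u z) (φ.vec 0 z) (φ.vec 1 z) ∧
      ψ.vec 1 z = planeComb (w z) (φ.vec 0 z) (φ.vec 1 z)) :
    Homotopic (k +ᵥ φ) ψ := by
  obtain ⟨U, V, hU, hV, hpos, hU0, hV0, hU1, hV1⟩ := h
  choose v hv hvq using φ.smooth
  have hz0 : ∀ z : Circle, (z : ℂ) ≠ 0 := fun z => z.coe_ne_zero
  have : Fact (Module.finrank ℝ ℂ = 1 + 1) := finrank_real_complex_fact'
  have hcoe : ContMDiff (𝓡 1) 𝓘(ℝ, ℂ) ∞ (fun z : Circle => (z : ℂ)) :=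
    contMDiff_coe_sphere (E := ℂ) (n := 1)
  let C : Fin 2 → ℝ → ℂ → ℂ := ![U, V]
  have hC : ∀ i t z, z ≠ 0 → ContDiffAt ℝ ∞ (Function.uncurry (C i)) (t, z) := by
    intro i
    fin_cases i
    · exact hU
    · exact hV
  have hCs : ∀ i t, ContMDiff (𝓡 1) 𝓘(ℝ, ℂ) ∞ (fun z : Circle => C i t z) := by
    intro i t z
    have h1 : ContDiffAt ℝ ∞ (fun y : ℂ => C i t y) z :=
      (hC i t z (hz0 z)).comp (z : ℂ) (contDiffAt_const.prodMk contDiffAt_id)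
    exact h1.contMDiffAt.comp z (hcoe z)
  have hCc : ∀ i, Continuous fun p : unitInterval × Circle => C i p.1 p.2 := by
    intro i
    refine continuous_iff_continuousAt.2 fun p => ?_
    exact ContinuousAt.comp (f := fun p : unitInterval × Circle => ((p.1 : ℝ), (p.2 : ℂ)))
      (hC i p.1 p.2 (hz0 p.2)).continuousAt (by fun_prop)
  -- Only the coefficients move; fixed lifts of `φ` supply smooth and jointly continuous
  -- representatives.
  let Φ : unitInterval → Framing o γ := fun t =>
    { vec := fun i z => planeComb (C i t z) (φ.vec 0 z) (φ.vec 1 z)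
      smooth := fun i => ⟨_, contMDiff_comb (Complex.reCLM.contMDiff.comp (hCs i t))
        (Complex.imCLM.contMDiff.comp (hCs i t)) (hv 0) (hv 1), fun z => by
          rw [map_add, map_smul, map_smul, hvq, hvq]; rfl⟩
      positive := fun z => by
        convert (φ.isPositiveNormalBasis_planeComb z _ _).2 (hpos t t.2 z (hz0 z)) using 1
        funext i
        fin_cases i <;> rfl }
  refine ⟨Φ, ?_, ?_, fun i => ⟨fun t z => (C i t z).re • v 0 z + (C i t z).im • v 1 z, ?_, ?_⟩⟩
  · ext i z
    fin_cases i
    · refine Eq.trans ?_ (vadd_vec_zero k φ z).symm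
      rw [← hU0 z (hz0 z)]; rfl
    · refine Eq.trans ?_ (vadd_vec_one k φ z).symm
      rw [← hV0 z (hz0 z)]; rfl
  · ext i z
    fin_cases i
    · refine Eq.trans ?_ (hψ z).1.symm
      rw [← hU1 z (hz0 z)]; rfl
    · refine Eq.trans ?_ (hψ z).2.symm
      rw [← hV1 z (hz0 z)]; rfl
  · exact continuous_comb (Complex.continuous_re.comp (hCc i)) (Complex.continuous_im.comp (hCc i))
      ((hv 0).continuous.comp continuous_snd) ((hv 1).continuous.comp continuous_snd)
  · intro t z
    rw [map_add, map_smul, map_smul, hvq, hvq]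
    rfl

/-- Rotating a framing `k ≠ 0` times changes its homotopy class. -/
theorem eq_zero_of_homotopic_vadd (hγ : ContMDiff (𝓡 1) J ∞ γ) {φ : Framing o γ} {k : ℤ}
    (h : Homotopic (k +ᵥ φ) φ) : k = 0 := by
  obtain ⟨Φ, h0, h1, h⟩ := h
  obtain ⟨v, hv, hvq⟩ := h 0
  -- Clamping the time extends the homotopy to the simply connected domain `ℝ × ℝ`. The first vector
  -- alone detects `k`.
  let τ : ℝ → unitInterval := Set.projIcc 0 1 zero_le_one
  have hτ0 : τ 0 = 0 := Set.projIcc_left _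
  have hτ1 : τ 1 = 1 := Set.projIcc_right _
  have hν : Continuous fun x : ℝ × ℝ =>
      (⟨γ (Circle.exp x.2), v (τ x.1) (Circle.exp x.2)⟩ : TangentBundle J Y) :=
    hv.comp (f := fun x : ℝ × ℝ => (τ x.1, Circle.exp x.2))
      ((continuous_projIcc.comp continuous_fst).prodMk (Circle.exp.continuous.comp continuous_snd))
  obtain ⟨u, hu, huq⟩ := φ.exists_coeff hγ (IX := 𝓘(ℝ, ℝ × ℝ)) (n := 0) (by simp)
    (p := fun x : ℝ × ℝ => Circle.exp x.2)
    (contMDiff_zero_iff.2 (Circle.exp.continuous.comp continuous_snd)) (contMDiff_zero_iff.2 hν)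
  have huv : ∀ t θ, (Φ (τ t)).vec 0 (Circle.exp θ) =
      planeComb (u (t, θ)) (φ.vec 0 (Circle.exp θ)) (φ.vec 1 (Circle.exp θ)) :=
    fun t θ => (hvq _ _).symm.trans (huq (t, θ))
  refine eq_zero_of_homotopy (H := u) hu.continuous ?_ ?_ ?_ ?_
  · rintro ⟨t, θ⟩ h
    have h2 := huv t θ
    rw [h, planeComb, Complex.zero_re, Complex.zero_im, zero_smul, zero_smul, add_zero] at h2
    exact ((Φ (τ t)).linearIndependent (Circle.exp θ)).ne_zero 0 h2
  · intro t θ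
    have h2 := huv t (θ + 2 * Real.pi)
    rw [Circle.exp_add_two_pi] at h2
    exact planeComb_injective (φ.linearIndependent _) (h2.symm.trans (huv t θ))
  · intro θ
    have h2 := huv 0 θ
    rw [hτ0, h0, vadd_vec_zero] at h2
    refine planeComb_injective (φ.linearIndependent _) (h2.symm.trans ?_)
    rw [Circle.coe_exp, ← Complex.exp_int_mul]
  · intro θ
    have h2 := huv 1 θ
    rw [hτ1, h1] at h2
    refine planeComb_injective (φ.linearIndependent _) (h2.symm.trans ?_)
    simp [planeComb]

end Curve

/-! ### Coordinates in the normal bundle of the disk -/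

section DiskNormal

variable {G : Type*} [TopologicalSpace G]
  {I : ModelWithCorners ℝ (EuclideanSpace ℝ (Fin 5)) G}
  {W : Type*} [TopologicalSpace W] [ChartedSpace G W]
  {Δ : ℂ → W} {N : Fin 3 → ∀ z, TangentSpace I (Δ z)}

/-- The combination of the classes of three vector fields in the normal bundle of a disk. -/
def normalComb (N : Fin 3 → ∀ z, TangentSpace I (Δ z)) (z : ℂ) :
    (Fin 3 → ℝ) →ₗ[ℝ] DiskNormal I Δ z :=
  Fintype.linearCombination ℝ fun j => (tangentPlane I Δ z).mkQ (N j z)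

lemma normalComb_apply (z : ℂ) (c : Fin 3 → ℝ) :
    normalComb N z c = (tangentPlane I Δ z).mkQ (∑ j, c j • N j z) := by
  rw [map_sum]
  simp only [map_smul]
  rfl

lemma normalComb_injective {z : ℂ}
    (h : ∀ c : Fin 3 → ℝ, ∑ i, c i • N i z ∈ tangentPlane I Δ z → c = 0) :
    Function.Injective (normalComb N z) := by
  refine (injective_iff_map_eq_zero _).2 fun c hc => h c ?_
  rw [normalComb_apply] at hc
  exact (Submodule.Quotient.mk_eq_zero _).1 hc

lemma linearIndependent_coordField_normal {z : ℂ}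
    (himm : Function.Injective (mfderivWithin 𝓘(ℝ, ℂ) I Δ disk z))
    (h : ∀ c : Fin 3 → ℝ, ∑ i, c i • N i z ∈ tangentPlane I Δ z → c = 0) :
    LinearIndependent ℝ (Sum.elim (fun j => coordField I Δ j z) (fun j => N j z)) := by
  refine Fintype.linearIndependent_iff.2 fun c hc => ?_
  rw [Fintype.sum_sum_type] at hc
  simp only [Sum.elim_inl, Sum.elim_inr] at hc
  have hmem : ∑ j, c (Sum.inl j) • coordField I Δ j z ∈ tangentPlane I Δ z := by
    rw [← span_coordField]
    exact Submodule.sum_mem _ fun j _ => Submodule.smul_mem _ _ (Submodule.subset_span ⟨j, rfl⟩)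
  have h1 : (fun j => c (Sum.inr j)) = 0 := by
    refine h _ ?_
    rw [eq_neg_of_add_eq_zero_right hc]
    exact Submodule.neg_mem _ hmem
  have h2 : ∑ j, c (Sum.inl j) • coordField I Δ j z = 0 := by
    have h3 : ∀ j, c (Sum.inr j) = 0 := fun j => congrFun h1 j
    simpa [h3] using hc
  have h4 := Fintype.linearIndependent_iff.1 (linearIndependent_coordField himm) _ h2
  rintro (j | j)
  · exact h4 j
  · exact congrFun h1 j

/-- A smooth section of the normal bundle of the disk along a map into the disk has smooth
coefficients with respect to a normal frame. -/
lemma exists_normalComb_eq [IsManifold I ∞ W] (hΔ : ContMDiffOn 𝓘(ℝ, ℂ) I ∞ Δ disk)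
    (himm : ∀ z ∈ disk, Function.Injective (mfderivWithin 𝓘(ℝ, ℂ) I Δ disk z))
    (hN : ∀ i, ContMDiffOn 𝓘(ℝ, ℂ) I.tangent ∞
      (fun z => (⟨Δ z, N i z⟩ : TangentBundle I W)) disk)
    (hNi : ∀ z ∈ disk, ∀ c : Fin 3 → ℝ, ∑ i, c i • N i z ∈ tangentPlane I Δ z → c = 0)
    {EX : Type*} [NormedAddCommGroup EX] [NormedSpace ℝ EX] {HX : Type*} [TopologicalSpace HX]
    {IX : ModelWithCorners ℝ EX HX} {X : Type*} [TopologicalSpace X] [ChartedSpace HX X]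
    {s : Set X} {p : X → ℂ} (hp : ContMDiffOn IX 𝓘(ℝ, ℂ) ∞ p s) (hps : Set.MapsTo p s disk)
    {ν : ∀ x, TangentSpace I (Δ (p x))}
    (hν : ContMDiffOn IX I.tangent ∞ (fun x => (⟨Δ (p x), ν x⟩ : TangentBundle I W)) s) :
    ∃ c : X → Fin 3 → ℝ, ContMDiffOn IX 𝓘(ℝ, Fin 3 → ℝ) ∞ c s ∧
      ∀ x ∈ s, normalComb N (p x) (c x) = (tangentPlane I Δ (p x)).mkQ (ν x) := by
  -- Coordinate fields and normal frame together frame `TW`; the tangential coefficients are dropped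
  -- in the quotient.
  let b : Fin 2 ⊕ Fin 3 → ∀ x, TangentSpace I (Δ (p x)) := fun i x =>
    Sum.elim (fun j => coordField I Δ j (p x)) (fun j => N j (p x)) i
  have hb : ∀ i, ContMDiffOn IX I.tangent ∞
      (fun x => (⟨Δ (p x), b i x⟩ : TangentBundle I W)) s := by
    rintro (j | j)
    · exact (contMDiffOn_coordField hΔ j).comp hp hps
    · exact (hN j).comp hp hps
  have hbi : ∀ x ∈ s, LinearIndependent ℝ (fun i => b i x) := fun x hx =>
    linearIndependent_coordField_normal (himm _ (hps hx)) (hNi _ (hps hx))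
  have hex : ∀ x, ∃ c : Fin 2 ⊕ Fin 3 → ℝ, x ∈ s → ν x = ∑ i, c i • b i x := by
    intro x
    by_cases hx : x ∈ s
    · have : FiniteDimensional ℝ (TangentSpace I (Δ (p x))) :=
        inferInstanceAs (FiniteDimensional ℝ (EuclideanSpace ℝ (Fin 5)))
      have hc : Fintype.card (Fin 2 ⊕ Fin 3) = Module.finrank ℝ (TangentSpace I (Δ (p x))) := by
        change _ = Module.finrank ℝ (EuclideanSpace ℝ (Fin 5))
        simp
      obtain ⟨c, hc⟩ := exists_coeff_of_linearIndependent (hbi x hx) hc (ν x)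
      exact ⟨c, fun _ => hc⟩
    · exact ⟨0, fun h => absurd h hx⟩
  choose c hc using hex
  refine ⟨fun x j => c x (Sum.inr j), ?_, fun x hx => ?_⟩
  · refine fun x hx => contMDiffWithinAt_pi_space.2 fun j => ?_
    exact contMDiffWithinAt_coeff_field (b := b) (c := c) hx (fun i => hb i x hx) (hν x hx)
      (by simp) (fun x hx => ⟨hbi x hx, hc x hx⟩) (Sum.inr j)
  · rw [normalComb_apply]
    refine (Submodule.Quotient.eq _).2 ?_
    have h1 : ∑ j, c x (Sum.inr j) • N j (p x) - ν x =
        -∑ j, c x (Sum.inl j) • coordField I Δ j (p x) := by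
      rw [hc x hx, Fintype.sum_sum_type]
      simp only [b, Sum.elim_inl, Sum.elim_inr]
      abel
    rw [h1, ← span_coordField]
    exact Submodule.neg_mem _ (Submodule.sum_mem _ fun j _ =>
      Submodule.smul_mem _ _ (Submodule.subset_span ⟨j, rfl⟩))

end DiskNormal

/-! ### Admissibility as an extension problem, and its parity -/

section Admissible

variable {H : Type*} [TopologicalSpace H]
  {J : ModelWithCorners ℝ (EuclideanSpace ℝ (Fin 3)) H}
  {Y : Type*} [TopologicalSpace Y] [ChartedSpace H Y]
  {G : Type*} [TopologicalSpace G]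
  {I : ModelWithCorners ℝ (EuclideanSpace ℝ (Fin 5)) G}
  {W : Type*} [TopologicalSpace W] [ChartedSpace G W]
  {ι : Y → W} {γ : Circle → Y} {Δ : ℂ → W}

/-- The induced map from the fibres of the normal bundle of the curve to those of the normal
bundle of the disk. -/
def normalMap (hΔ : IsSpanningDisk J I ι γ Δ) (z : Circle) :
    CurveNormal J γ z →ₗ[ℝ] DiskNormal I Δ z :=
  (tangentLine J γ z).mapQ (tangentPlane I Δ z) (mfderiv J I ι (γ z)).toLinearMap
    (Submodule.map_le_iff_le_comap.1 ((hΔ.clean z).symm.le.trans inf_le_right))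

lemma normalMap_mkQ (hΔ : IsSpanningDisk J I ι γ Δ) (z : Circle) (v : TangentSpace J (γ z)) :
    normalMap hΔ z ((tangentLine J γ z).mkQ v) =
      (tangentPlane I Δ z).mkQ (mfderiv J I ι (γ z) v) := rfl

/-- Clean intersection: a vector of `TY` whose image is tangent to the disk has the same image as a
vector tangent to the curve, and the differential of `ι` is injective. -/
lemma normalMap_injective (hΔ : IsSpanningDisk J I ι γ Δ) {z : Circle}
    (hι : Function.Injective (mfderiv J I ι (γ z))) : Function.Injective (normalMap hΔ z) := by
  refine (injective_iff_map_eq_zero _).2 fun q hq => ?_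
  obtain ⟨v, rfl⟩ := Submodule.mkQ_surjective _ q
  rw [normalMap_mkQ] at hq
  have h1 := (Submodule.Quotient.mk_eq_zero _).1 hq
  have h2 : mfderiv J I ι (γ z) v ∈ (tangentLine J γ z).map (mfderiv J I ι (γ z)).toLinearMap :=
    (hΔ.clean z).le ⟨⟨v, rfl⟩, h1⟩
  obtain ⟨y, hy, hyv⟩ := h2
  exact (Submodule.Quotient.mk_eq_zero _).2 (hι hyv ▸ hy)

variable [IsManifold J ∞ Y] [IsManifold I ∞ W] {o : ManifoldOrientation J Y}

/-- The differential of `ι` descends to the normal bundles, so the condition on all representatives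
is one equation between classes. -/
lemma admissible_iff_normalMap (hΔ : IsSpanningDisk J I ι γ Δ) (ψ : Framing o γ) :
    Admissible I ι Δ ψ ↔ ∃ B : ∀ z, Submodule ℝ (DiskNormal I Δ z), IsSubbundle Δ 2 B ∧
      ∃ Φ : Fin 2 → ∀ z, DiskNormal I Δ z, IsSmoothFrameOn Δ B Φ disk ∧
        ∀ (z : Circle) (i : Fin 2), normalMap hΔ z (ψ.vec i z) = Φ i z := by
  refine exists_congr fun B => and_congr_right fun _ => exists_congr fun Φ => and_congr_right
    fun _ => forall_congr' fun z => forall_congr' fun i => ⟨fun h => ?_, fun h v hv => ?_⟩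
  · obtain ⟨v, hv⟩ := Submodule.mkQ_surjective _ (ψ.vec i z)
    rw [← h v hv, ← hv, normalMap_mkQ]
  · rw [← h, ← hv, normalMap_mkQ]

/-- The boundary data of a spanning disk: relative to a normal frame of the disk, a framing of the
curve is a loop of linearly independent pairs in `ℝ³`, and admissibility is the existence of an
extension of this loop to the disk. -/
theorem exists_admissible_iff (hι : IsSmoothEmbedding J I ∞ ι) (hΔ : IsSpanningDisk J I ι γ Δ)
    (φ : Framing o γ) : ∃ a₁ a₂ : ℂ → Fin 3 → ℝ, (∀ z, z ≠ 0 → ContDiffAt ℝ ∞ a₁ z) ∧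
      (∀ z, z ≠ 0 → ContDiffAt ℝ ∞ a₂ z) ∧ (∀ z, z ≠ 0 → LinearIndependent ℝ ![a₁ z, a₂ z]) ∧
      ∀ (ψ : Framing o γ) (u w : ℂ → ℂ), (∀ z : Circle,
        ψ.vec 0 z = planeComb (u z) (φ.vec 0 z) (φ.vec 1 z) ∧
        ψ.vec 1 z = planeComb (w z) (φ.vec 0 z) (φ.vec 1 z)) →
      (Admissible I ι Δ ψ ↔ ∃ F G : ℂ → Fin 3 → ℝ, ContDiffOn ℝ ∞ F disk ∧
        ContDiffOn ℝ ∞ G disk ∧ (∀ z ∈ disk, LinearIndependent ℝ ![F z, G z]) ∧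
        ∀ z, ‖z‖ = 1 → F z = planeComb (u z) (a₁ z) (a₂ z) ∧
          G z = planeComb (w z) (a₁ z) (a₂ z)) := by
  obtain ⟨N, hN, hNi⟩ := exists_normal_frame hΔ.smooth hΔ.immersion
  choose v hv hvq using φ.smooth
  have : Fact (Module.finrank ℝ ℂ = 1 + 1) := finrank_real_complex_fact'
  have hcoe : ContMDiff (𝓡 1) 𝓘(ℝ, ℂ) ∞ (fun z : Circle => (z : ℂ)) :=
    contMDiff_coe_sphere (E := ℂ) (n := 1)
  have hdisk : ∀ z : Circle, (z : ℂ) ∈ disk := fun z =>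
    mem_closedBall_zero_iff.2 (Circle.norm_coe z).le
  have hιinj : ∀ y, Function.Injective (mfderiv J I ι y) := fun y =>
    mfderiv_injective_of_isImmersionAt (hι.isImmersion.isImmersionAt y)
  -- The coordinates of `φ` in the normal frame of the disk; extended along rays, they are the loops
  -- `a₁` and `a₂`.
  have hα : ∀ i, ∃ c : Circle → Fin 3 → ℝ, ContMDiff (𝓡 1) 𝓘(ℝ, Fin 3 → ℝ) ∞ c ∧
      ∀ z : Circle, normalComb N z (c z) = normalMap hΔ z (φ.vec i z) := by
    intro i
    have h1 : ContMDiff (𝓡 1) I.tangent ∞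
        (fun z => (⟨ι (γ z), mfderiv J I ι (γ z) (v i z)⟩ : TangentBundle I W)) :=
      (hι.contMDiff.contMDiff_tangentMap (m := ∞) (by simp)).comp (hv i)
    have h2 : ContMDiff (𝓡 1) I.tangent ∞ (fun z : Circle =>
        (⟨Δ z, (mfderiv J I ι (γ z) (v i z) : EuclideanSpace ℝ (Fin 5))⟩ : TangentBundle I W)) := by
      refine h1.congr fun z => ?_
      exact congrArg (fun y => (⟨y, (mfderiv J I ι (γ z) (v i z) : EuclideanSpace ℝ (Fin 5))⟩ :
        TangentBundle I W)) (hΔ.boundary z)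
    obtain ⟨c, hc, hcq⟩ := exists_normalComb_eq hΔ.smooth hΔ.immersion hN hNi
      (s := Set.univ) (p := fun z : Circle => (z : ℂ)) hcoe.contMDiffOn (fun z _ => hdisk z)
      h2.contMDiffOn
    refine ⟨c, contMDiffOn_univ.1 hc, fun z => (hcq z (Set.mem_univ z)).trans ?_⟩
    rw [← hvq i z, normalMap_mkQ]
  choose α hα hαq using hα
  have hαi : ∀ z, LinearIndependent ℝ ![α 0 z, α 1 z] := by
    intro z
    rw [LinearIndependent.pair_iff]
    intro s t hst
    refine LinearIndependent.pair_iff.1 (φ.linearIndependent z) s t ?_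
    refine normalMap_injective hΔ (hιinj _) ?_
    rw [map_add, map_smul, map_smul, ← hαq, ← hαq, ← map_smul, ← map_smul, ← map_add, hst, map_zero,
      map_zero]
  refine ⟨circleExtend (α 0), circleExtend (α 1), fun z hz => contDiffAt_circleExtend (hα 0) hz,
    fun z hz => contDiffAt_circleExtend (hα 1) hz, fun z _ => hαi _, fun ψ u w hψ => ?_⟩
  have hb : ∀ (z : Circle) (a : ℂ), normalMap hΔ z (planeComb a (φ.vec 0 z) (φ.vec 1 z)) =
      normalComb N z (planeComb a (circleExtend (α 0) z) (circleExtend (α 1) z)) := by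
    intro z a
    rw [map_planeComb, map_planeComb, circleExtend_coe, circleExtend_coe, hαq, hαq]
  rw [admissible_iff_normalMap hΔ]
  constructor
  · rintro ⟨B, -, Φ, ⟨hΦs, hΦ⟩, hΦb⟩
    have hF : ∀ i, ∃ F : ℂ → Fin 3 → ℝ, ContDiffOn ℝ ∞ F disk ∧
        ∀ z ∈ disk, normalComb N z (F z) = Φ i z := by
      intro i
      obtain ⟨x, hx, hxq⟩ := hΦs i
      obtain ⟨c, hc, hcq⟩ := exists_normalComb_eq hΔ.smooth hΔ.immersion hN hNi
        (s := disk) (p := fun z : ℂ => z) contMDiffOn_id (fun z hz => hz) hx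
      exact ⟨c, contMDiffOn_iff_contDiffOn.1 hc, fun z hz => (hcq z hz).trans (hxq z hz)⟩
    choose F hFs hFq using hF
    refine ⟨F 0, F 1, hFs 0, hFs 1, fun z hz => ?_, fun z hz => ?_⟩
    · have e : (fun i => Φ i z) = ![Φ 0 z, Φ 1 z] := by
        funext i
        fin_cases i <;> rfl
      have h1 := LinearIndependent.pair_iff.1 (e ▸ (hΦ z hz).1)
      rw [LinearIndependent.pair_iff]
      intro s t hst
      refine h1 s t ?_
      rw [← hFq 0 z hz, ← hFq 1 z hz, ← map_smul, ← map_smul, ← map_add, hst, map_zero]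
    · obtain ⟨z, rfl⟩ : ∃ y : Circle, (y : ℂ) = z := ⟨⟨z, mem_sphere_zero_iff_norm.2 hz⟩, rfl⟩
      have hinj := normalComb_injective (hNi z (hdisk z))
      constructor
      · refine hinj ?_
        rw [hFq 0 z (hdisk z), ← hΦb, (hψ z).1, hb]
      · refine hinj ?_
        rw [hFq 1 z (hdisk z), ← hΦb, (hψ z).2, hb]
  · rintro ⟨F, G, hF, hG, hi, hbd⟩
    let C : Fin 2 → ℂ → Fin 3 → ℝ := ![F, G]
    have hC : ∀ i, ContDiffOn ℝ ∞ (C i) disk := by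
      intro i
      fin_cases i
      · exact hF
      · exact hG
    let Φ : Fin 2 → ∀ z, DiskNormal I Δ z := fun i z => normalComb N z (C i z)
    -- The subbundle is the span of the extended pair, which frames it globally and so also locally.
    have hfr : IsSmoothFrameOn Δ (fun z => Submodule.span ℝ (Set.range fun i => Φ i z)) Φ disk := by
      refine ⟨fun i => ⟨fun z => ∑ j, C i z j • N j z, fun z hz => ?_, fun z _ =>
        (normalComb_apply z _).symm⟩, fun z hz => ⟨?_, rfl⟩⟩
      · exact contMDiffWithinAt_sum_smul_field (c := fun j z => C i z j) hz (hΔ.smooth z hz)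
          (fun j => (contDiffWithinAt_pi.1 (hC i z hz) j).contMDiffWithinAt) (fun j => hN j z hz)
      · have h1 := (hi z hz).map' (normalComb N z)
          (LinearMap.ker_eq_bot.2 (normalComb_injective (hNi z hz)))
        have e : (fun i => Φ i z) = normalComb N z ∘ ![F z, G z] := by
          funext i
          fin_cases i <;> rfl
        rw [e]
        exact h1
    refine ⟨_, fun z₀ _ => ⟨Set.univ, Filter.univ_mem, Φ, by rwa [Set.univ_inter]⟩, Φ, hfr,
      fun z i => ?_⟩
    have h1 := hbd z (Circle.norm_coe z)
    fin_cases i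
    · change normalMap hΔ z (ψ.vec 0 z) = normalComb N z (F z)
      rw [(hψ z).1, hb, h1.1]
    · change normalMap hΔ z (ψ.vec 1 z) = normalComb N z (G z)
      rw [(hψ z).2, hb, h1.2]

/-- The constant homotopy of the `k`-fold rotation. -/
lemma rotationHomotopic_zpow (k : ℤ) :
    RotationHomotopic k (fun z => z ^ k) (fun z => Complex.I * z ^ k) := by
  have h : ∀ (t : ℝ) (z : ℂ), z ≠ 0 → ContDiffAt ℝ ∞ (fun p : ℝ × ℂ => p.2 ^ k) (t, z) :=
    fun t z hz => (contDiffAt_zpow k hz).comp (t, z) contDiffAt_snd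
  exact ⟨fun _ z => z ^ k, fun _ z => Complex.I * z ^ k, h,
    fun t z hz => contDiffAt_const.mul (h t z hz), fun _ _ z hz => conj_mul_I_mul_im_pos hz k,
    fun _ _ => rfl, fun _ _ => rfl, fun _ _ => rfl, fun _ _ => rfl⟩

/-- Admissibility of a framing is the parity of its rotation number relative to a fixed framing. -/
theorem exists_admissible_iff_even (hι : IsSmoothEmbedding J I ∞ ι)
    (hΔ : IsSpanningDisk J I ι γ Δ) (φ : Framing o γ) :
    ∃ d : ℤ, ∀ (ψ : Framing o γ) (k : ℤ) (u w : ℂ → ℂ), RotationHomotopic k u w →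
      (∀ z : Circle, ψ.vec 0 z = planeComb (u z) (φ.vec 0 z) (φ.vec 1 z) ∧
        ψ.vec 1 z = planeComb (w z) (φ.vec 0 z) (φ.vec 1 z)) →
      (Admissible I ι Δ ψ ↔ Even (k + d)) := by
  obtain ⟨a₁, a₂, h₁, h₂, hind, hadm⟩ := exists_admissible_iff hι hΔ φ
  -- `exists_disk_extension` needs an inner product; `e` translates between coordinate triples and
  -- Euclidean space.
  let e := EuclideanSpace.equiv (Fin 3) ℝ
  have hext : ∃ d : ℤ, ∀ k : ℤ, Even (k + d) → ∀ u w : ℂ → ℂ, RotationHomotopic k u w →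
      ∃ F G : ℂ → Fin 3 → ℝ, ContDiffOn ℝ ∞ F disk ∧ ContDiffOn ℝ ∞ G disk ∧
        (∀ z ∈ disk, LinearIndependent ℝ ![F z, G z]) ∧ ∀ z, ‖z‖ = 1 →
          F z = planeComb (u z) (a₁ z) (a₂ z) ∧ G z = planeComb (w z) (a₁ z) (a₂ z) := by
    have hpair : ∀ {V V' : Type} [AddCommGroup V] [Module ℝ V] [AddCommGroup V'] [Module ℝ V']
        (A : V ≃ₗ[ℝ] V') {p q : V}, LinearIndependent ℝ ![p, q] →
        LinearIndependent ℝ ![A p, A q] := by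
      intro V V' _ _ _ _ A p q h
      have e : ![A p, A q] = A.toLinearMap ∘ ![p, q] := by
        funext i
        fin_cases i <;> rfl
      rw [e]
      exact h.map' A.toLinearMap A.ker
    obtain ⟨d, hd⟩ := exists_disk_extension (E := EuclideanSpace ℝ (Fin 3)) (by simp)
      (a₁ := fun z => e.symm (a₁ z)) (a₂ := fun z => e.symm (a₂ z))
      (fun z hz => e.symm.contDiff.contDiffAt.comp z (h₁ z hz))
      (fun z hz => e.symm.contDiff.contDiffAt.comp z (h₂ z hz))
      (fun z hz => hpair e.symm.toLinearEquiv (hind z hz))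
    refine ⟨d, fun k hk u w huw => ?_⟩
    obtain ⟨F, G, hF, hG, hi, hb⟩ := hd k hk u w huw
    refine ⟨fun z => e (F z), fun z => e (G z), e.contDiff.comp_contDiffOn hF,
      e.contDiff.comp_contDiffOn hG, fun z hz => hpair e.toLinearEquiv (hi z hz), fun z hz => ?_⟩
    have hmap : ∀ c : ℂ, e (planeComb c (e.symm (a₁ z)) (e.symm (a₂ z))) =
        planeComb c (a₁ z) (a₂ z) := by
      intro c
      simp [planeComb]
    exact ⟨(congrArg e (hb z hz).1).trans (hmap _), (congrArg e (hb z hz).2).trans (hmap _)⟩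
  obtain ⟨d, hd⟩ := hext
  refine ⟨d, fun ψ k u w huw hψ => (hadm ψ u w hψ).trans ⟨?_, fun h => hd k h u w huw⟩⟩
  rintro ⟨F, G, hF, hG, hi, hb⟩
  -- The `d`-fold rotation extends because `d + d` is even; it is the reference with which every
  -- other extension is compared.
  obtain ⟨F', G', hF', hG', hi', hb'⟩ := hd d (Even.add_self d) _ _ (rotationHomotopic_zpow d)
  have := even_sub_of_disk_extensions (fun z hz => (h₁ z hz).continuousAt)
    (fun z hz => (h₂ z hz).continuousAt) hind huw (rotationHomotopic_zpow d) hF.continuousOn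
    hG.continuousOn hF'.continuousOn hG'.continuousOn hi hi' hb hb'
  rw [Int.even_sub] at this
  rw [Int.even_add]
  exact this.symm

end Admissible

end

end AmbientSurgery

/-! ### The theorem -/

theorem lemma5p3
    {G : Type*} [TopologicalSpace G] (I : ModelWithCorners ℝ (EuclideanSpace ℝ (Fin 5)) G)
    {W : Type*} [TopologicalSpace W] [ChartedSpace G W] [IsManifold I ∞ W] [T2Space W]
    {H : Type*} [TopologicalSpace H] (J : ModelWithCorners ℝ (EuclideanSpace ℝ (Fin 3)) H)
    {Y : Type*} [TopologicalSpace Y] [ChartedSpace H Y] [IsManifold J ∞ Y] [T2Space Y]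
    (o : AmbientSurgery.ManifoldOrientation J Y)
    (ι : Y → W) (hι : IsSmoothEmbedding J I ∞ ι)
    (γ : Circle → Y) (hγ : IsSmoothEmbedding (𝓡 1) J ∞ γ)
    (Δ : ℂ → W) (hΔ : AmbientSurgery.IsSpanningDisk J I ι γ Δ)
    (φ : AmbientSurgery.Framing o γ) :
    (∀ (k : ℤ) (c : AmbientSurgery.FramingClass o γ), k +ᵥ c = c → k = 0) ∧
    (∀ c d : AmbientSurgery.FramingClass o γ, ∃ k : ℤ, k +ᵥ c = d) ∧
    ((∀ ψ : AmbientSurgery.Framing o γ, AmbientSurgery.Admissible I ι Δ ψ ↔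
        ∃ k : ℤ, Even k ∧ ψ.toClass = k +ᵥ φ.toClass) ∨
      (∀ ψ : AmbientSurgery.Framing o γ, AmbientSurgery.Admissible I ι Δ ψ ↔
        ∃ k : ℤ, Odd k ∧ ψ.toClass = k +ᵥ φ.toClass)) := by
  have hγs : ContMDiff (𝓡 1) J ∞ γ := hγ.contMDiff
  have hfree : ∀ (k : ℤ) (c : AmbientSurgery.FramingClass o γ), k +ᵥ c = c → k = 0 := by
    intro k c
    induction c using Quotient.inductionOn with
    | h χ => exact fun h => AmbientSurgery.eq_zero_of_homotopic_vadd hγs (Quotient.exact h)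
  have hclass : ∀ χ ψ : AmbientSurgery.Framing o γ, ∃ k u w,
      AmbientSurgery.RotationHomotopic k u w ∧
      (∀ z : Circle, ψ.vec 0 z = AmbientSurgery.planeComb (u z) (χ.vec 0 z) (χ.vec 1 z) ∧
        ψ.vec 1 z = AmbientSurgery.planeComb (w z) (χ.vec 0 z) (χ.vec 1 z)) ∧
      ψ.toClass = k +ᵥ χ.toClass := by
    intro χ ψ
    obtain ⟨k, u, w, h, hψ⟩ := χ.exists_rotation ψ hγs
    exact ⟨k, u, w, h, hψ,
      (Quotient.sound (AmbientSurgery.homotopic_vadd_of_rotationHomotopic h hψ)).symm⟩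
  refine ⟨hfree, ?_, ?_⟩
  · intro c d
    induction c using Quotient.inductionOn with
    | h χ =>
      induction d using Quotient.inductionOn with
      | h ψ =>
        obtain ⟨k, -, -, -, -, h⟩ := hclass χ ψ
        exact ⟨k, h.symm⟩
  obtain ⟨d, hd⟩ := AmbientSurgery.exists_admissible_iff_even hι hΔ φ
  have hadm : ∀ ψ : AmbientSurgery.Framing o γ, AmbientSurgery.Admissible I ι Δ ψ ↔
      ∃ k : ℤ, Even (k + d) ∧ ψ.toClass = k +ᵥ φ.toClass := by
    intro ψ
    obtain ⟨k, u, w, huw, hψ, hk⟩ := hclass φ ψ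
    rw [hd ψ k u w huw hψ]
    refine ⟨fun h => ⟨k, h, hk⟩, ?_⟩
    rintro ⟨l, hl, hlk⟩
    -- Freeness makes the rotation number of `ψ` unique, so its parity can be tested on any `l`
    -- realising the class.
    have h0 := hfree (-l + k) φ.toClass (by rw [add_vadd, ← hk, hlk, neg_vadd_vadd])
    have h1 : k = l := by omega
    rwa [h1]
  -- The parity of `d`, which depends on `φ` and the disk but not on `ψ`, selects the alternative.
  rcases Int.even_or_odd d with h | h
  · left
    intro ψ
    rw [hadm]
    simp only [Int.even_add, h, iff_true]
  · right
    intro ψ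
    rw [hadm]
    simp only [Int.even_add, Int.not_even_iff_odd.2 h, iff_false, Int.not_even_iff_odd]
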